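/- Setting. Let $\omega,H>0$, and let $\hat\mu\in C^3((-\infty,0])$, $\hat\lambda\in C^1((-\infty,0])$ be real functions with $\hat\mu>0$, $\hat\lambda+2\hat\mu>0$, equal to constants $\hat\mu_I,\hat\lambda_I$ for $Z\le -H$. For $\xi\in\mathbb C$ consider on $Z\le 0$ the Rayleigh system $$-(\hat\mu\varphi_1')'-i\xi\big((\hat\mu\varphi_3)'+\hat\lambda\varphi_3'\big)+(\hat\lambda+2\hat\mu)\xi^2\varphi_1=\omega^2\varphi_1,\qquad -((\hat\lambda+2\hat\mu)\varphi_3')'-i\xi\big((\hat\lambda\varphi_1)'+\hat\mu\varphi_1'\big)+\hat\mu\xi^2\varphi_3=\omega^2\varphi_3 .$$ Let $q_P,q_S$ be the quasi-momenta, $q_P^2=\frac{\omega^2}{\hat\lambda_I+2\hat\mu_I}-\xi^2$, $q_S^2=\frac{\omega^2}{\hat\mu_I}-\xi^2$, single-valued on the four-sheeted Riemann surface of triples $(\xi,q_P,q_S)$, and let $w_P,w_S,w_{PS}$ be the maps of this surface that change the sign of $q_P$, of $q_S$, of both. Let $f_P^-,f_S^-$ be the solutions (Jost solutions) that for $Z<-H$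 equal $(\xi,-q_P)e^{-iZq_P}$ and $(-q_S,-\xi)e^{-iZq_S}$. With $a(\Phi)=i\xi\hat\lambda\varphi_1+(\hat\lambda+2\hat\mu)\varphi_3'$ and $b(\Phi)=i\xi\hat\mu\varphi_3+\hat\mu\varphi_1'$ taken at $Z=0^-$, let $\Delta=a(f_P^-)b(f_S^-)-a(f_S^-)b(f_P^-)$ be the Rayleigh determinant and $$F(\xi)=\Delta(\xi)\,\Delta(w_P(\xi))\,\Delta(w_S(\xi))\,\Delta(w_{PS}(\xi)),$$ which depends only on $\xi\in\mathbb C$. Potential. Write $x=-Z\ge0$, let $'$ now denote $d/dx$, and put $\sigma=\hat\lambda+2\hat\mu$. Let $$M_1=\begin{pmatrix}-2\hat\mu'/\hat\mu & 1/\hat\mu-1/\sigma\\ -2\hat\mu^2(1/\hat\mu)''&2\hat\mu'/\hat\mu\end{pmatrix},\quad M_0=\begin{pmatrix}-\omega^2/\hat\mu&-(1/\sigma)'-2\hat\mu'/(\hat\mu\sigma)\\-2\omega^2\hat\mu'/\hat\mu&-\omega^2/\sigma-2\hat\mu^2(1/\hat\mu)''/\sigma\end{pmatrix},$$ and let $L$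 solve $L'=\tfrac12M_1L$, $L(0)=\mathrm{diag}(\hat\mu_I/\hat\mu(0),\hat\mu(0))$. The Pekeris--Markushevich potential is $Q=L^{-1}(M_0+\tfrac14M_1^2-\tfrac12M_1')L$. The background potential $Q_0$ is the matrix polynomial in $x$ that equals $Q$ for $x\ge H$, and $V=Q-Q_0$ on $[0,\infty)$. The class $\mathcal V_H$ consists of the continuous $V\in L^1(\mathbb R_+;\mathbb C^{2\times2})$ with $\mathrm{supp}\,V\subset[0,H]$ such that for every $\epsilon>0$ and all $i,j$ the set $(H-\epsilon,H)\cap\mathrm{supp}\,V_{ij}$ has positive Lebesgue measure. Theorem. Let $V\in\mathcal V_H$. Then $F$ is an entire function of exponential type, i.e. there are real constants $A,\alpha$ with $|F(\xi)|\le Ae^{\alpha|\xi|}$ for all sufficiently large $|\xi|$. Moreover, as $\operatorname{Re}\xi\to+\infty$ in the region where $|\xi|=O(e^{H\operatorname{Re}\xi})$ (in particular along every horizontal line, in every sector $|\operatorname{Im}\xi|\le k\operatorname{Re}\xi$, and in every region $|\operatorname{Im}\xi|\le(\operatorname{Re}\xi)^n$), one has $F(\xi)=O(|\xi|^8e^{8H|\operatorname{Re}\xi|})$.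 Precisely: for every $K\in\mathbb R$ there are $C>0$ and $R>0$ such that $$|F(\xi)|\le C\,|\xi|^{8}e^{8H|\operatorname{Re}\xi|}\qquad\text{for all }\xi\in\mathbb C\text{ with }\operatorname{Re}\xi\ge R\text{ and }|\xi|\le Ke^{H\operatorname{Re}\xi}.$$ -/

import Mathlib

open Set Complex MeasureTheory

noncomputable section

namespace Rayleigh

/-- An isotropic elastic half-space `Z ≤ 0`, with density-normalized Lamé parameters `lam`, `mu`
that are constant below the depth `H`, together with the frequency `omega`. Only the values of
`lam` and `mu` on `Z ≤ 0` are used. -/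
structure Medium where
  lam : ℝ → ℝ
  mu : ℝ → ℝ
  omega : ℝ
  H : ℝ
  omega_pos : 0 < omega
  H_pos : 0 < H
  mu_pos : ∀ Z ≤ 0, 0 < mu Z
  lam_add_two_mu_pos : ∀ Z ≤ 0, 0 < lam Z + 2 * mu Z
  mu_contDiff : ContDiffOn ℝ 3 mu (Iic 0)
  lam_contDiff : ContDiffOn ℝ 1 lam (Iic 0)
  mu_const : ∀ Z ≤ -H, mu Z = mu (-H)
  lam_const : ∀ Z ≤ -H, lam Z = lam (-H)

namespace Medium

variable (M : Medium)

/-- The value of `mu` in the homogeneous part. -/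
def muI : ℝ := M.mu (-M.H)

/-- The value of `lam` in the homogeneous part. -/
def lamI : ℝ := M.lam (-M.H)

end Medium

/-! ### The Riemann surface of the quasi-momenta -/

/-- The four-sheeted Riemann surface on which both quasi-momenta
`q_P = √(ω² / (λ_I + 2 μ_I) - ξ²)` and `q_S = √(ω² / μ_I - ξ²)` are single-valued: its points are
the triples `(ξ, q_P, q_S)`. The four sheets are given by the signs of `Im q_P` and `Im q_S`. -/
@[ext]
structure Surface (M : Medium) where
  xi : ℂ
  qP : ℂ
  qS : ℂ
  qP_sq : qP ^ 2 = (M.omega : ℂ) ^ 2 / (M.lamI + 2 * M.muI) - xi ^ 2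
  qS_sq : qS ^ 2 = (M.omega : ℂ) ^ 2 / M.muI - xi ^ 2

namespace Surface

variable {M : Medium}

/-- The sheet change that flips the sign of `q_P`. -/
def wP (p : Surface M) : Surface M where
  xi := p.xi
  qP := -p.qP
  qS := p.qS
  qP_sq := by rw [neg_sq, p.qP_sq]
  qS_sq := p.qS_sq

/-- The sheet change that flips the sign of `q_S`. -/
def wS (p : Surface M) : Surface M where
  xi := p.xi
  qP := p.qP
  qS := -p.qS
  qP_sq := p.qP_sq
  qS_sq := by rw [neg_sq, p.qS_sq]

/-- The sheet change that flips the signs of both `q_P` and `q_S`. -/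
def wPS (p : Surface M) : Surface M where
  xi := p.xi
  qP := -p.qP
  qS := -p.qS
  qP_sq := by rw [neg_sq, p.qP_sq]
  qS_sq := by rw [neg_sq, p.qS_sq]

/-- The point over `ξ` with `q_P = i √(ξ² - ω² / (λ_I + 2 μ_I))` and `q_S = i √(ξ² - ω² / μ_I)`,
where the real part of the square roots is nonnegative, so that `Im q_P, Im q_S ≥ 0`. -/
def physical (M : Medium) (xi : ℂ) : Surface M where
  xi := xi
  qP := I * (xi ^ 2 - (M.omega : ℂ) ^ 2 / (M.lamI + 2 * M.muI)) ^ (2⁻¹ : ℂ)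
  qS := I * (xi ^ 2 - (M.omega : ℂ) ^ 2 / M.muI) ^ (2⁻¹ : ℂ)
  qP_sq := by
    have h := Complex.cpow_nat_inv_pow
      (xi ^ 2 - (M.omega : ℂ) ^ 2 / (M.lamI + 2 * M.muI)) two_ne_zero
    push_cast at h
    rw [mul_pow, h, I_sq]; ring
  qS_sq := by
    have h := Complex.cpow_nat_inv_pow (xi ^ 2 - (M.omega : ℂ) ^ 2 / M.muI) two_ne_zero
    push_cast at h
    rw [mul_pow, h, I_sq]; ring

end Surface

/-! ### The Rayleigh system and the Rayleigh determinant -/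

/-- Derivative in `Z` on the half-line `Z ≤ 0`, one-sided at `0`. -/
def dZ (f : ℝ → ℂ) (Z : ℝ) : ℂ := derivWithin f (Iic 0) Z

/-- `Φ = (φ₁, φ₃)` is a classical solution, up to the boundary, of the Rayleigh system
`H Φ = ω² Φ` on the half-line `Z ≤ 0`. -/
structure IsRayleighSolution (M : Medium) (xi : ℂ) (Φ : ℝ → ℂ × ℂ) : Prop where
  contDiff_fst : ContDiffOn ℝ 2 (fun Z => (Φ Z).1) (Iic 0)
  contDiff_snd : ContDiffOn ℝ 2 (fun Z => (Φ Z).2) (Iic 0)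
  eq_fst : ∀ Z < 0,
    -dZ (fun t => (M.mu t : ℂ) * dZ (fun s => (Φ s).1) t) Z
      - I * xi * (dZ (fun t => (M.mu t : ℂ) * (Φ t).2) Z
          + (M.lam Z : ℂ) * dZ (fun t => (Φ t).2) Z)
      + ((M.lam Z : ℂ) + 2 * M.mu Z) * xi ^ 2 * (Φ Z).1
      = (M.omega : ℂ) ^ 2 * (Φ Z).1
  eq_snd : ∀ Z < 0,
    -dZ (fun t => ((M.lam t : ℂ) + 2 * M.mu t) * dZ (fun s => (Φ s).2) t) Z
      - I * xi * (dZ (fun t => (M.lam t : ℂ) * (Φ t).1) Z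
          + (M.mu Z : ℂ) * dZ (fun t => (Φ t).1) Z)
      + (M.mu Z : ℂ) * xi ^ 2 * (Φ Z).2
      = (M.omega : ℂ) ^ 2 * (Φ Z).2

/-- The unperturbed Jost solution `f_{P,0}^- = (ξ, -q_P) e^{-i Z q_P}`. -/
def jostP0 {M : Medium} (p : Surface M) (Z : ℝ) : ℂ × ℂ :=
  (p.xi * exp (-(I * Z * p.qP)), -p.qP * exp (-(I * Z * p.qP)))

/-- The unperturbed Jost solution `f_{S,0}^- = (-q_S, -ξ) e^{-i Z q_S}`. -/
def jostS0 {M : Medium} (p : Surface M) (Z : ℝ) : ℂ × ℂ :=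
  (-p.qS * exp (-(I * Z * p.qS)), -p.xi * exp (-(I * Z * p.qS)))

/-- The solution of the Rayleigh system that agrees with the given `Φ₀` below the depth `H`.
For `Φ₀ = f_{P,0}^-` and `Φ₀ = f_{S,0}^-` it exists and is unique on `Z ≤ 0` (linear Cauchy
problem started in the homogeneous part). -/
def solutionFromBelow (M : Medium) (xi : ℂ) (Φ₀ : ℝ → ℂ × ℂ) : ℝ → ℂ × ℂ :=
  Classical.epsilon fun Φ => IsRayleighSolution M xi Φ ∧ ∀ Z < -M.H, Φ Z = Φ₀ Z

/-- The Jost solution `f_P^-`. -/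
def jostP {M : Medium} (p : Surface M) : ℝ → ℂ × ℂ := solutionFromBelow M p.xi (jostP0 p)

/-- The Jost solution `f_S^-`. -/
def jostS {M : Medium} (p : Surface M) : ℝ → ℂ × ℂ := solutionFromBelow M p.xi (jostS0 p)

/-- The boundary operator `a(Φ) = i ξ λ φ₁ + (λ + 2 μ) ∂φ₃/∂Z` at `Z = 0⁻`. -/
def bdryA (M : Medium) (xi : ℂ) (Φ : ℝ → ℂ × ℂ) : ℂ :=
  I * xi * M.lam 0 * (Φ 0).1 + ((M.lam 0 : ℂ) + 2 * M.mu 0) * dZ (fun Z => (Φ Z).2) 0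

/-- The boundary operator `b(Φ) = i ξ μ φ₃ + μ ∂φ₁/∂Z` at `Z = 0⁻`. -/
def bdryB (M : Medium) (xi : ℂ) (Φ : ℝ → ℂ × ℂ) : ℂ :=
  I * xi * M.mu 0 * (Φ 0).2 + (M.mu 0 : ℂ) * dZ (fun Z => (Φ Z).1) 0

/-- The boundary matrix `B(ξ)`, with columns belonging to `f_P^-` and `f_S^-`. -/
def boundaryMatrix {M : Medium} (p : Surface M) : Matrix (Fin 2) (Fin 2) ℂ :=
  !![bdryA M p.xi (jostP p), bdryA M p.xi (jostS p);
     bdryB M p.xi (jostP p), bdryB M p.xi (jostS p)]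

/-- The Rayleigh determinant `Δ` on the Riemann surface. -/
def rayleighDet {M : Medium} (p : Surface M) : ℂ := (boundaryMatrix p).det

/-- `F(ξ) = Δ(ξ) Δ(w_P ξ) Δ(w_S ξ) Δ(w_PS ξ)`, the product of the Rayleigh determinants over the
four points of the Riemann surface above `ξ ∈ ℂ`. -/
def F (M : Medium) (xi : ℂ) : ℂ :=
  let p := Surface.physical M xi
  rayleighDet p * rayleighDet p.wP * rayleighDet p.wS * rayleighDet p.wPS

/-- The product does not depend on the point above `ξ` from which it is formed. -/
theorem F_eq {M : Medium} (p : Surface M) :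
    F M p.xi = rayleighDet p * rayleighDet p.wP * rayleighDet p.wS * rayleighDet p.wPS := by
  set r := Surface.physical M p.xi with hr
  have hxi : p.xi = r.xi := rfl
  have hP : p.qP = r.qP ∨ p.qP = -r.qP := by
    apply sq_eq_sq_iff_eq_or_eq_neg.mp
    rw [p.qP_sq, r.qP_sq, hxi]
  have hS : p.qS = r.qS ∨ p.qS = -r.qS := by
    apply sq_eq_sq_iff_eq_or_eq_neg.mp
    rw [p.qS_sq, r.qS_sq, hxi]
  have hF : F M p.xi =
      rayleighDet r * rayleighDet r.wP * rayleighDet r.wS * rayleighDet r.wPS := rfl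
  rw [hF]
  rcases hP with hP | hP <;> rcases hS with hS | hS
  · have e : p = r := Surface.ext hxi hP hS
    rw [e]
  · have e : p = r.wS := Surface.ext hxi hP hS
    have e1 : r.wS.wP = r.wPS := rfl
    have e2 : r.wS.wS = r := Surface.ext rfl rfl (neg_neg _)
    have e3 : r.wS.wPS = r.wP := Surface.ext rfl rfl (neg_neg _)
    rw [e, e1, e2, e3]; ring
  · have e : p = r.wP := Surface.ext hxi hP hS
    have e1 : r.wP.wS = r.wPS := rfl
    have e2 : r.wP.wP = r := Surface.ext rfl (neg_neg _) rfl
    have e3 : r.wP.wPS = r.wS := Surface.ext rfl (neg_neg _) rfl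
    rw [e, e1, e2, e3]; ring
  · have e : p = r.wPS := Surface.ext hxi hP hS
    have e1 : r.wPS.wS = r.wP := Surface.ext rfl rfl (neg_neg _)
    have e2 : r.wPS.wP = r.wS := Surface.ext rfl (neg_neg _) rfl
    have e3 : r.wPS.wPS = r := Surface.ext rfl (neg_neg _) (neg_neg _)
    rw [e, e1, e2, e3]; ring

/-! ### The Pekeris–Markushevich transform

In the depth variable `x = -Z ≥ 0`, the substitution `φ₃ = -ξ y₁`, `φ₁ = i (y₁' + y₂ / (λ + 2 μ))`
turns the Rayleigh system into `y'' = ξ² y + M₁ y' + M₀ y`, with coefficient matrices `M₁`, `M₀`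
that do not depend on `ξ`. If `L' = ½ M₁ L` and `y = L F`, this becomes `-F'' + Q F = -ξ² F` with
`Q = L⁻¹ (M₀ + ¼ M₁² - ½ M₁') L`. With `L(0) = diag (μ_I / μ(0), μ(0))` the free-surface
condition becomes `F' + Θ F = 0` at `x = 0`, where
`Θ = [[-μ'/μ, μ² / (2 μ_I (λ + 2 μ))], [(μ_I / μ) (2 ξ² - ω² / μ - μ (1/μ)''), 0]]` at `x = 0`. -/

/-- Derivative in the depth variable on the half-line `x ≥ 0`, one-sided at `0`. -/
def dx (f : ℝ → ℝ) (x : ℝ) : ℝ := derivWithin f (Ici 0) x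

namespace Medium

variable (M : Medium)

/-- `mu` as a function of the depth `x = -Z`. -/
def muX (x : ℝ) : ℝ := M.mu (-x)

/-- `lam` as a function of the depth `x = -Z`. -/
def lamX (x : ℝ) : ℝ := M.lam (-x)

/-- `λ + 2 μ` as a function of the depth. -/
def sigX (x : ℝ) : ℝ := M.lamX x + 2 * M.muX x

/-- The second derivative of `1 / μ` with respect to the depth. -/
def invMuDD (x : ℝ) : ℝ := dx (dx fun t => 1 / M.muX t) x

/-- The coefficient `M₁` of `y'`. -/
def M1 (x : ℝ) : Matrix (Fin 2) (Fin 2) ℝ :=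
  !![-(2 * dx M.muX x / M.muX x), 1 / M.muX x - 1 / M.sigX x;
     -(2 * M.muX x ^ 2 * M.invMuDD x), 2 * dx M.muX x / M.muX x]

/-- The coefficient `M₀` of `y`. -/
def M0 (x : ℝ) : Matrix (Fin 2) (Fin 2) ℝ :=
  !![-(M.omega ^ 2 / M.muX x),
       -dx (fun t => 1 / M.sigX t) x - 2 * dx M.muX x / (M.muX x * M.sigX x);
     -(2 * M.omega ^ 2 * dx M.muX x / M.muX x),
       -(M.omega ^ 2 / M.sigX x) - 2 * M.muX x ^ 2 * M.invMuDD x / M.sigX x]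

/-- The entrywise derivative `M₁'`. -/
def M1' (x : ℝ) : Matrix (Fin 2) (Fin 2) ℝ :=
  Matrix.of fun i j => dx (fun t => M.M1 t i j) x

/-- `L' = ½ M₁ L` on `x ≥ 0`, with `L(0) = diag (μ_I / μ(0), μ(0))`. -/
def IsGauge (L : ℝ → Matrix (Fin 2) (Fin 2) ℝ) : Prop :=
  L 0 = !![M.muI / M.muX 0, 0; 0, M.muX 0] ∧
  ∀ x, 0 ≤ x → ∀ i j,
    HasDerivWithinAt (fun t => L t i j) ((1 / 2) * (M.M1 x * L x) i j) (Ici 0) x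

/-- The solution `L` of this linear Cauchy problem, which exists and is unique on `x ≥ 0`. -/
def gauge : ℝ → Matrix (Fin 2) (Fin 2) ℝ := Classical.epsilon M.IsGauge

/-- The potential `Q = L⁻¹ (M₀ + ¼ M₁² - ½ M₁') L` of the transformed system. -/
def potential (x : ℝ) : Matrix (Fin 2) (Fin 2) ℝ :=
  (M.gauge x)⁻¹ * (M.M0 x + (1 / 4 : ℝ) • (M.M1 x * M.M1 x) - (1 / 2 : ℝ) • M.M1' x) * M.gauge x

/-- The constants `G_{ij}^H`: for `x ≥ H` one has `L⁻¹ diag (1, μ_I) = Gᵀ`. -/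
def GH : Matrix (Fin 2) (Fin 2) ℝ :=
  ((M.gauge M.H)⁻¹ * !![1, 0; 0, M.muI]).transpose

/-- `c_I = (λ_I + μ_I) / (λ_I + 2 μ_I)`. -/
def cI : ℝ := (M.lamI + M.muI) / (M.lamI + 2 * M.muI)

/-- `G_{21}(x)`. -/
def G21 (x : ℝ) : ℝ := -(M.cI / 2) * M.GH 0 0 * (x - M.H) + M.GH 1 0

/-- `G_{22}(x)`. -/
def G22 (x : ℝ) : ℝ := -(M.cI / 2) * M.GH 0 1 * (x - M.H) + M.GH 1 1

/-- The background potential `Q₀`, which is the restriction of `Q` to `x ≥ H`, extended to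
`x ≥ 0` by the same formula. -/
def background (x : ℝ) : Matrix (Fin 2) (Fin 2) ℝ :=
  M.omega ^ 2 • !![-(1 / M.muI), 0; 0, -(1 / (M.lamI + 2 * M.muI))]
  + (M.omega ^ 2 * ((M.lamI + M.muI) / (M.muI * (M.lamI + 2 * M.muI)))) •
    !![-(M.GH 0 1 * M.G21 x), M.G21 x * M.GH 0 0;
       -(M.GH 0 1 * M.G22 x), M.GH 0 1 * M.G21 x]

/-- The perturbed potential `V = Q - Q₀`, as a complex matrix. -/
def V (x : ℝ) : Matrix (Fin 2) (Fin 2) ℂ :=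
  (M.potential x - M.background x).map ((↑) : ℝ → ℂ)

end Medium

/-- The class `𝒱_H` of potentials on `ℝ₊ = [0, ∞)`: continuous, integrable, supported in `[0, H]`,
and such that the support of every entry meets every `(H - ε, H)` in a set of positive measure. -/
structure PotentialClass (H : ℝ) (V : ℝ → Matrix (Fin 2) (Fin 2) ℂ) : Prop where
  continuousOn : ContinuousOn V (Ici 0)
  integrableOn : ∀ i j, IntegrableOn (fun x => V x i j) (Ici 0)
  support : ∀ x, 0 ≤ x → V x ≠ 0 → x ≤ H
  volume_pos : ∀ ε > 0, ∀ i j, 0 < volume (Ioo (H - ε) H ∩ closure {x | 0 ≤ x ∧ V x i j ≠ 0})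

/-- An entire function `f` is of exponential type if `|f(z)| ≤ A e^{α |z|}` for large `|z|`,
with real constants `A` and `α`. -/
def IsExponentialType (f : ℂ → ℂ) : Prop :=
  Differentiable ℂ f ∧ ∃ A α r : ℝ, ∀ z : ℂ, r ≤ ‖z‖ → ‖f z‖ ≤ A * Real.exp (α * ‖z‖)

end Rayleigh

end

noncomputable section

namespace Rayleigh

/-! The state (φ₁, φ₃, a, b) of displacements and stresses obeys a linear first-order system whose
coefficients are quadratic polynomials in ξ. The transfer from depth H to the surface is therefore
entire in ξ (`exists_transfer`), and the Jost states at depth H are explicit entire functions of (ξ,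
q). So Δ is an entire function of (ξ, q_P, q_S). Since F does not depend on the signs of q_P and
q_S, it may be computed near any point with a local branch of the roots; it is continuous everywhere
and holomorphic off the finitely many branch points, hence entire. Grönwall's inequality for (ξφ₁,
ξφ₃, a, b), whose growth rate is O(|ξ|), gives exponential type.

For the sharp bound the fields y of the Pekeris–Markushevich transform are split into amplitudes D_±
= w ± ξy. As Z increases from -H to 0, D_+ decays like e^{-ξ(Z+H)} and D_- grows like e^{ξ(Z+H)}, up
to the bounded term ½M₁D_± and a coupling through y = (D_+ - D_-)/(2ξ), which is smaller by a factor
|ξ|. The bounded term is left to Grönwall's inequality, so the gauge L is not needed in the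
estimates.

Since (iq)² = ξ² - c, each quasi-momentum has iq ≈ -ξ or iq ≈ ξ. At the surface D_+ = O(A) and D_- =
O(|ξ|A), where A = 1 if iq ≈ -ξ and A = e^{2H Re ξ}/|ξ| if iq ≈ ξ (`IsWave.exists_amp_bound`). In
the second case the initial value of D_+ contributes O(|ξ|), and the restriction |ξ| ≤ K e^{H Re ξ}
is what makes this O(A).

Smallness of D_+ means y' ≈ -ξy at the surface, so a = O(|ξ|²A) while a + ib gains one power and is
O(|ξ|A) (`exists_boundary_bound`). As Δ is a determinant, b may be replaced by a + ib, and Δ =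
O(|ξ|³ A_P A_S). Over the four points above ξ each of the two exponential factors occurs twice, so F
= O(|ξ|¹² (e^{2H Re ξ}/|ξ|)⁴) = O(|ξ|⁸ e^{8H Re ξ}). -/

/-! ### A Grönwall inequality for dissipative systems -/

/-- Grönwall's inequality for a system `fᵢ' = -κᵢ fᵢ + rᵢ` with `Re κᵢ ≥ 0`: the dissipative
diagonal terms do not contribute to the growth, however large they are. -/
theorem norm_le_of_dissipative {ι : Type*} [Fintype ι] {f r : ι → ℝ → ℂ} {κ : ι → ℂ}
    {a b C ε : ℝ} (hC : 0 ≤ C) (hε : 0 ≤ ε) (hκ : ∀ i, 0 ≤ (κ i).re)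
    (hf : ∀ i, ContinuousOn (f i) (Icc a b))
    (hf' : ∀ i, ∀ t ∈ Ioo a b, HasDerivAt (f i) (-κ i * f i t + r i t) t)
    (hr : ∀ i, ∀ t ∈ Ioo a b, ‖r i t‖ ≤ C * (∑ j, ‖f j t‖ + ε)) :
    ∀ t ∈ Icc a b, ∀ i, ‖f i t‖ ≤
      Real.exp (C * (3 * Fintype.card ι + 1) * (t - a)) * (∑ j, ‖f j a‖ + ε) := by
  set n : ℝ := ((Fintype.card ι : ℕ) : ℝ) with hn
  have hn0 : 0 ≤ n := by positivity
  set K : ℝ := C * (3 * n + 1) with hK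
  have hK0 : 0 ≤ K := by positivity
  -- Adding ε² to the energy absorbs the constant forcing, so that h' ≤ K h is homogeneous. With S =
  -- ∑ ‖fᵢ‖, the rate 3n + 1 comes from 2S(S + ε) ≤ 3S² + ε² and S² ≤ n ∑ ‖fᵢ‖².
  set h : ℝ → ℝ := fun t => ε ^ 2 + ∑ i, ‖f i t‖ ^ 2 with hh
  set h' : ℝ → ℝ := fun t => ∑ i, 2 * inner ℝ (f i t) (-κ i * f i t + r i t) with hh'
  have hderiv : ∀ t ∈ Ioo a b, HasDerivAt h (h' t) t := by
    intro t ht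
    have : HasDerivAt (fun t => ∑ i, ‖f i t‖ ^ 2) (h' t) t :=
      HasDerivAt.fun_sum fun i _ => (hf' i t ht).norm_sq
    exact this.const_add _
  have hbound : ∀ t ∈ Ioo a b, h' t ≤ K * h t := by
    intro t ht
    have h1 : h' t ≤ ∑ i, 2 * (‖f i t‖ * (C * (∑ j, ‖f j t‖ + ε))) := by
      refine Finset.sum_le_sum fun i _ => ?_
      -- The size of κᵢ drops out here: the real inner product of fᵢ with -κᵢfᵢ is -Re κᵢ ‖fᵢ‖² ≤ 0.
      have e : inner ℝ (f i t) (-κ i * f i t + r i t)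
          = -(κ i).re * ‖f i t‖ ^ 2 + inner ℝ (f i t) (r i t) := by
        rw [inner_add_right]
        congr 1
        rw [Complex.inner, ← Complex.normSq_eq_norm_sq, Complex.normSq_apply]
        simp
        ring
      have h2 := real_inner_le_norm (f i t) (r i t)
      have h3 := mul_le_mul_of_nonneg_left (hr i t ht) (norm_nonneg (f i t))
      have h4 := mul_nonneg (hκ i) (sq_nonneg ‖f i t‖)
      rw [e]
      linarith
    rw [← Finset.mul_sum, ← Finset.sum_mul] at h1
    set S := ∑ i, ‖f i t‖ with hS
    have h2 : S ^ 2 ≤ n * ∑ i, ‖f i t‖ ^ 2 := by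
      have := sq_sum_le_card_mul_sum_sq (s := (Finset.univ : Finset ι)) (f := fun i => ‖f i t‖)
      simpa [hn] using this
    set T := ∑ i, ‖f i t‖ ^ 2 with hT
    have hT0 : 0 ≤ T := by positivity
    have h3 : 2 * (S * (C * (S + ε))) ≤ C * (3 * S ^ 2 + ε ^ 2) := by
      have : 2 * (S * (S + ε)) ≤ 3 * S ^ 2 + ε ^ 2 := by nlinarith [sq_nonneg (S - ε)]
      calc 2 * (S * (C * (S + ε))) = C * (2 * (S * (S + ε))) := by ring
        _ ≤ _ := by gcongr
    have h4 : 3 * S ^ 2 + ε ^ 2 ≤ (3 * n + 1) * (ε ^ 2 + T) := by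
      have := mul_nonneg hn0 (sq_nonneg ε)
      nlinarith
    calc h' t ≤ C * (3 * S ^ 2 + ε ^ 2) := h1.trans h3
      _ ≤ C * ((3 * n + 1) * (ε ^ 2 + T)) := by gcongr
      _ = K * h t := by rw [hK, hh]; ring
  have hcont : ContinuousOn h (Icc a b) := by
    refine continuousOn_const.add (continuousOn_finsetSum _ fun i _ => ?_)
    exact (hf i).norm.pow 2
  have hanti : AntitoneOn (fun t => h t * Real.exp (-K * t)) (Icc a b) := by
    have hd : ∀ t ∈ Ioo a b, HasDerivAt (fun t => h t * Real.exp (-K * t))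
        ((h' t - K * h t) * Real.exp (-K * t)) t := by
      intro t ht
      have h1 : HasDerivAt (fun t : ℝ => Real.exp (-K * t)) (Real.exp (-K * t) * (-K * 1)) t :=
        ((hasDerivAt_id t).const_mul (-K)).exp
      exact ((hderiv t ht).mul h1).congr_deriv (by ring)
    refine antitoneOn_of_deriv_nonpos (convex_Icc a b) (hcont.mul (by fun_prop)) ?_ ?_
    · rw [interior_Icc]
      exact fun t ht => (hd t ht).differentiableAt.differentiableWithinAt
    · rw [interior_Icc]
      intro t ht
      rw [(hd t ht).deriv]
      exact mul_nonpos_of_nonpos_of_nonneg (by linarith [hbound t ht]) (Real.exp_nonneg _)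
  intro t ht i
  have hab : a ≤ b := ht.1.trans ht.2
  have h1 := hanti (left_mem_Icc.2 hab) ht ht.1
  have h2 : h t ≤ Real.exp (K * (t - a)) * h a := by
    have := mul_le_mul_of_nonneg_right h1 (Real.exp_nonneg (K * t))
    simp only [mul_assoc, ← Real.exp_add] at this
    rw [show -K * t + K * t = 0 by ring, Real.exp_zero, mul_one,
      show -K * a + K * t = K * (t - a) by ring] at this
    linarith
  have h3 : h a ≤ (∑ j, ‖f j a‖ + ε) ^ 2 := by
    have h4 : ∑ j, ‖f j a‖ ^ 2 ≤ (∑ j, ‖f j a‖) ^ 2 :=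
      Finset.sum_sq_le_sq_sum_of_nonneg fun i _ => norm_nonneg _
    have h5 : 0 ≤ ∑ j, ‖f j a‖ := by positivity
    have h6 := mul_nonneg h5 hε
    simp only [hh]
    nlinarith
  have h4 : ‖f i t‖ ^ 2 ≤ h t := by
    have := Finset.single_le_sum (f := fun i => ‖f i t‖ ^ 2) (fun j _ => sq_nonneg _)
      (Finset.mem_univ i)
    simp only [hh]
    linarith [sq_nonneg ε]
  have h5 : (1 : ℝ) ≤ Real.exp (K * (t - a)) :=
    Real.one_le_exp (mul_nonneg hK0 (by linarith [ht.1]))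
  refine abs_le_of_sq_le_sq' ?_ (by positivity) |>.2
  calc ‖f i t‖ ^ 2 ≤ Real.exp (K * (t - a)) * (∑ j, ‖f j a‖ + ε) ^ 2 := by
        refine h4.trans (h2.trans ?_)
        gcongr
    _ ≤ Real.exp (K * (t - a)) ^ 2 * (∑ j, ‖f j a‖ + ε) ^ 2 := by
        gcongr
        nlinarith
    _ = _ := by ring

/-! ### Linear Cauchy problems with a holomorphic parameter -/

/-- Inversion is holomorphic on the units of a Banach algebra. This is the source of the analytic
dependence of solutions on ξ. -/
theorem differentiable_inverse_one_sub_quadratic {R : Type*} [NormedRing R] [NormedAlgebra ℂ R]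
    [CompleteSpace R] {k₀ k₁ k₂ : R} (h : ∀ z : ℂ, IsUnit (1 - (k₀ + z • k₁ + z ^ 2 • k₂))) :
    Differentiable ℂ fun z : ℂ => Ring.inverse (1 - (k₀ + z • k₁ + z ^ 2 • k₂)) := fun z =>
  (differentiableAt_inverse (𝕜 := ℂ) (h z)).comp z
    (f := fun z : ℂ => 1 - (k₀ + z • k₁ + z ^ 2 • k₂)) (by fun_prop)

section Volterra

variable {E : Type*} [NormedAddCommGroup E] [NormedSpace ℂ E] {a b : ℝ}

theorem continuous_volterra_integrand (hab : a ≤ b) {A : ℝ → E →L[ℂ] E} (hA : Continuous A)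
    (u : C(Icc a b, E)) : Continuous fun t => A t (u (projIcc a b hab t)) :=
  hA.clm_apply (u.continuous.comp continuous_projIcc)

/-- The Volterra operator `u ↦ ∫ₐ A u` on continuous functions on `[a, b]`. -/
def volterra (hab : a ≤ b) (A : ℝ → E →L[ℂ] E) (hA : Continuous A) :
    C(Icc a b, E) →L[ℂ] C(Icc a b, E) :=
  LinearMap.mkContinuousOfExistsBound
    { toFun := fun u =>
        ⟨fun s => ∫ t in a..s, A t (u (projIcc a b hab t)), by
          have := intervalIntegral.continuous_primitive (μ := volume)
            (fun c d => (continuous_volterra_integrand hab hA u).intervalIntegrable c d) a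
          exact this.comp continuous_subtype_val⟩
      map_add' := fun u v => by
        ext s
        simp only [ContinuousMap.coe_mk, ContinuousMap.add_apply, map_add]
        exact intervalIntegral.integral_add
          ((continuous_volterra_integrand hab hA u).intervalIntegrable _ _)
          ((continuous_volterra_integrand hab hA v).intervalIntegrable _ _)
      map_smul' := fun c u => by
        ext s
        simp only [ContinuousMap.coe_mk, ContinuousMap.smul_apply, map_smul, RingHom.id_apply]
        exact intervalIntegral.integral_smul _ _ } (by
    obtain ⟨C, hC⟩ := isCompact_Icc.exists_bound_of_continuousOn (s := Icc a b) hA.continuousOn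
    have hC0 : 0 ≤ C := (norm_nonneg _).trans (hC a (left_mem_Icc.2 hab))
    refine ⟨C * (b - a), fun u => ?_⟩
    rw [ContinuousMap.norm_le _ (by have := sub_nonneg.2 hab; positivity)]
    intro s
    simp only [LinearMap.coe_mk, AddHom.coe_mk, ContinuousMap.coe_mk]
    have : ‖∫ t in a..s, A t (u (projIcc a b hab t))‖ ≤ C * ‖u‖ * |(s : ℝ) - a| := by
      refine intervalIntegral.norm_integral_le_of_norm_le_const fun t ht => ?_
      rw [uIoc_of_le s.2.1] at ht
      refine ((A t).le_opNorm _).trans ?_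
      gcongr
      · exact hC t ⟨ht.1.le, ht.2.trans s.2.2⟩
      · exact u.norm_coe_le_norm _
    refine this.trans ?_
    rw [abs_of_nonneg (sub_nonneg.2 s.2.1)]
    calc C * ‖u‖ * (s - a) ≤ C * ‖u‖ * (b - a) := by gcongr; exact s.2.2
      _ = _ := by ring)

theorem volterra_apply (hab : a ≤ b) {A : ℝ → E →L[ℂ] E} (hA : Continuous A)
    (u : C(Icc a b, E)) (s : Icc a b) :
    volterra hab A hA u s = ∫ t in a..s, A t (u (projIcc a b hab t)) := rfl

/-- Each further integration raises the power of s - a by one and divides by it, which produces the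
factorial. -/
theorem norm_volterra_pow_apply_le (hab : a ≤ b) {A : ℝ → E →L[ℂ] E} (hA : Continuous A)
    {C : ℝ} (hC : ∀ t ∈ Icc a b, ‖A t‖ ≤ C) (n : ℕ) (u : C(Icc a b, E)) (s : Icc a b) :
    ‖(volterra hab A hA ^ n) u s‖ ≤ C ^ n * ((s : ℝ) - a) ^ n / n.factorial * ‖u‖ := by
  have hC0 : 0 ≤ C := (norm_nonneg _).trans (hC a (left_mem_Icc.2 hab))
  induction n generalizing s with
  | zero => simpa using u.norm_coe_le_norm s
  | succ n ih =>
    rw [pow_succ', mul_apply_eq_comp, volterra_apply]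
    have h1 : ∀ t ∈ Ioc a (s : ℝ), ‖A t ((volterra hab A hA ^ n) u (projIcc a b hab t))‖ ≤
        C ^ (n + 1) / n.factorial * ‖u‖ * (t - a) ^ n := by
      intro t ht
      have ht' : t ∈ Icc a b := ⟨ht.1.le, ht.2.trans s.2.2⟩
      refine ((A t).le_opNorm _).trans ?_
      have := ih (projIcc a b hab t)
      rw [projIcc_of_mem hab ht'] at this ⊢
      calc _ ≤ C * (C ^ n * (t - a) ^ n / n.factorial * ‖u‖) := by
            gcongr
            exact hC t ht'
        _ = _ := by ring
    have h2 := intervalIntegral.norm_integral_le_of_norm_le (μ := volume) s.2.1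
      (f := fun t => A t ((volterra hab A hA ^ n) u (projIcc a b hab t)))
      (g := fun t => C ^ (n + 1) / n.factorial * ‖u‖ * (t - a) ^ n)
      (Filter.Eventually.of_forall h1) ((by fun_prop : Continuous _).intervalIntegrable _ _)
    refine h2.trans (le_of_eq ?_)
    rw [intervalIntegral.integral_const_mul,
      intervalIntegral.integral_comp_sub_right (fun t => t ^ n) a, integral_pow]
    rw [Nat.factorial_succ]
    push_cast
    field_simp
    simp

variable [CompleteSpace E]

/-- The factorial bound makes some power Kⁿ of the Volterra operator a strict contraction, on an
interval of any length. Then 1 - Kⁿ = (1 - K)(1 + K + ⋯ + Kⁿ⁻¹) is a unit with commuting factors, so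
1 - K is one as well. -/
theorem isUnit_one_sub_volterra (hab : a ≤ b) {A : ℝ → E →L[ℂ] E} (hA : Continuous A) :
    IsUnit (1 - volterra hab A hA) := by
  obtain ⟨C, hC⟩ := isCompact_Icc.exists_bound_of_continuousOn (s := Icc a b) hA.continuousOn
  have hC0 : 0 ≤ C := (norm_nonneg _).trans (hC a (left_mem_Icc.2 hab))
  have hlim := FloorSemiring.tendsto_pow_div_factorial_atTop (C * (b - a))
  obtain ⟨n, hn⟩ := (hlim.eventually (gt_mem_nhds one_pos)).exists
  have hba := sub_nonneg.2 hab
  have hnorm : ‖volterra hab A hA ^ n‖ < 1 := by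
    refine lt_of_le_of_lt (ContinuousLinearMap.opNorm_le_bound _ (by positivity) fun u => ?_) hn
    rw [ContinuousMap.norm_le _ (by positivity)]
    intro s
    refine (norm_volterra_pow_apply_le hab hA hC n u s).trans ?_
    rw [mul_pow]
    have := sub_nonneg.2 s.2.1
    gcongr
    exact s.2.2
  have h1 : IsUnit (1 - volterra hab A hA ^ n) :=
    isUnit_one_sub_of_norm_lt_one (R := C(Icc a b, E) →L[ℂ] C(Icc a b, E)) hnorm
  rw [← mul_neg_geom_sum] at h1
  have h3 : Commute (1 - volterra hab A hA) (∑ i ∈ Finset.range n, volterra hab A hA ^ i) :=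
    Commute.sum_right _ _ _ fun i _ =>
      ((Commute.one_left _).sub_left (Commute.refl _)).pow_right _
  exact (h3.isUnit_mul_iff.1 h1).1

/-- The Cauchy problem `u' = (A₀ + z A₁ + z² A₂) u`, `u(a) = v`, has a solution on `[a, b]` whose
value at `b` is an entire function of the parameter `z`. -/
theorem exists_linear_ode_solution (hab : a ≤ b) {A₀ A₁ A₂ : ℝ → E →L[ℂ] E}
    (h₀ : Continuous A₀) (h₁ : Continuous A₁) (h₂ : Continuous A₂) (v : E) :
    ∃ u : ℂ → ℝ → E, (∀ z, u z a = v) ∧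
      (∀ z, ∀ t ∈ Icc a b, HasDerivAt (u z) ((A₀ t + z • A₁ t + z ^ 2 • A₂ t) (u z t)) t) ∧
      Differentiable ℂ fun z => u z b := by
  set A : ℂ → ℝ → E →L[ℂ] E := fun z t => A₀ t + z • A₁ t + z ^ 2 • A₂ t with hA
  have hAc : ∀ z, Continuous (A z) := fun z => by fun_prop
  set K : ℂ → C(Icc a b, E) →L[ℂ] C(Icc a b, E) := fun z => volterra hab (A z) (hAc z) with hK
  have hKeq : ∀ z, K z = volterra hab A₀ h₀ + z • volterra hab A₁ h₁ +
      z ^ 2 • volterra hab A₂ h₂ := by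
    intro z
    ext u s
    simp only [hK, hA, add_apply, smul_apply,
      ContinuousMap.add_apply, ContinuousMap.smul_apply, volterra_apply]
    rw [intervalIntegral.integral_add, intervalIntegral.integral_add,
      intervalIntegral.integral_smul, intervalIntegral.integral_smul]
    · exact (continuous_volterra_integrand hab h₀ u).intervalIntegrable _ _
    · exact ((continuous_volterra_integrand hab h₁ u).const_smul z).intervalIntegrable _ _
    · exact ((continuous_volterra_integrand hab h₀ u).add
        ((continuous_volterra_integrand hab h₁ u).const_smul z)).intervalIntegrable _ _
    · exact ((continuous_volterra_integrand hab h₂ u).const_smul (z ^ 2)).intervalIntegrable _ _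
  set w : ℂ → C(Icc a b, E) := fun z => Ring.inverse (1 - K z) (ContinuousMap.const _ v) with hw
  have hunit : ∀ z, IsUnit (1 - K z) := fun z => isUnit_one_sub_volterra hab (hAc z)
  have hwd : Differentiable ℂ w := by
    have h1 := differentiable_inverse_one_sub_quadratic
      (R := C(Icc a b, E) →L[ℂ] C(Icc a b, E)) (k₀ := volterra hab A₀ h₀)
      (k₁ := volterra hab A₁ h₁) (k₂ := volterra hab A₂ h₂) fun z => by
        rw [← hKeq]
        exact hunit z
    simp only [← hKeq] at h1
    exact h1.clm_apply (differentiable_const _)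
  have hweq : ∀ z, w z = ContinuousMap.const _ v + K z (w z) := by
    intro z
    have h1 : (1 - K z) (w z) = ContinuousMap.const _ v := by
      rw [hw, ← mul_apply_eq_comp, Ring.mul_inverse_cancel _ (hunit z)]
      rfl
    rw [← h1]
    simp
  -- The fixed point `w z` lives on [a, b] only. The integral formula with its constant extension is
  -- defined on all of ℝ, so the derivatives at the endpoints are two-sided.
  refine ⟨fun z s => v + ∫ t in a..s, A z t (w z (projIcc a b hab t)), fun z => by simp, ?_, ?_⟩
  · intro z t ht
    have hc := continuous_volterra_integrand hab (hAc z) (w z)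
    have h1 := (hc.integral_hasStrictDerivAt a t).hasDerivAt.const_add v
    refine h1.congr_deriv ?_
    congr 1
    conv_lhs => rw [hweq z]
    rw [ContinuousMap.add_apply, ContinuousMap.const_apply, volterra_apply, projIcc_of_mem hab ht]
  · have h1 : ∀ z, v + ∫ t in a..b, A z t (w z (projIcc a b hab t)) =
        ContinuousMap.evalCLM ℂ (⟨b, right_mem_Icc.2 hab⟩ : Icc a b) (w z) := by
      intro z
      rw [ContinuousMap.evalCLM_apply]
      conv_rhs => rw [hweq z]
      rfl
    simp only [h1]
    exact (ContinuousLinearMap.differentiable _).comp hwd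

end Volterra

/-! ### The Rayleigh system as a first-order system -/

namespace Medium

variable (M : Medium)

/-- `λ + 2 μ` as a function of `Z`. -/
def sig (Z : ℝ) : ℝ := M.lam Z + 2 * M.mu Z

theorem sig_pos {Z : ℝ} (hZ : Z ≤ 0) : 0 < M.sig Z := M.lam_add_two_mu_pos Z hZ

theorem mu_ne_zero {Z : ℝ} (hZ : Z ≤ 0) : (M.mu Z : ℂ) ≠ 0 :=
  ofReal_ne_zero.2 (M.mu_pos Z hZ).ne'

theorem sig_ne_zero {Z : ℝ} (hZ : Z ≤ 0) : (M.sig Z : ℂ) ≠ 0 :=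
  ofReal_ne_zero.2 (M.sig_pos hZ).ne'

theorem neg_H_neg : -M.H < 0 := neg_lt_zero.2 M.H_pos

theorem sig_contDiff : ContDiffOn ℝ 1 M.sig (Iic 0) :=
  M.lam_contDiff.add (contDiffOn_const.mul (M.mu_contDiff.of_le (by norm_num)))

theorem mu_contDiff_ofReal : ContDiffOn ℝ 3 (fun Z => (M.mu Z : ℂ)) (Iic 0) :=
  ofRealCLM.contDiff.comp_contDiffOn M.mu_contDiff

theorem lam_contDiff_ofReal : ContDiffOn ℝ 1 (fun Z => (M.lam Z : ℂ)) (Iic 0) :=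
  ofRealCLM.contDiff.comp_contDiffOn M.lam_contDiff

theorem sig_contDiff_ofReal : ContDiffOn ℝ 1 (fun Z => (M.sig Z : ℂ)) (Iic 0) :=
  ofRealCLM.contDiff.comp_contDiffOn M.sig_contDiff

theorem sig_const {Z : ℝ} (hZ : Z ≤ -M.H) : M.sig Z = M.sig (-M.H) := by
  simp [sig, M.mu_const Z hZ, M.lam_const Z hZ]

/-- The coefficient matrix of the Rayleigh system as a first-order system for the state
`(φ₁, φ₃, a, b)` formed by displacements and stresses. -/
def generator (xi : ℂ) (Z : ℝ) : Matrix (Fin 4) (Fin 4) ℂ :=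
  !![0, -(I * xi), 0, 1 / M.mu Z;
     -(I * xi * M.lam Z / M.sig Z), 0, 1 / M.sig Z, 0;
     0, -(M.omega : ℂ) ^ 2, 0, -(I * xi);
     (M.sig Z - (M.lam Z : ℂ) ^ 2 / M.sig Z) * xi ^ 2 - (M.omega : ℂ) ^ 2, 0,
       -(I * xi * M.lam Z / M.sig Z), 0]

/-- The state `(φ₁, φ₃, a, b)` of a displacement field. -/
def state (xi : ℂ) (Φ : ℝ → ℂ × ℂ) (Z : ℝ) : Fin 4 → ℂ :=
  ![(Φ Z).1, (Φ Z).2,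
    I * xi * M.lam Z * (Φ Z).1 + ((M.lam Z : ℂ) + 2 * M.mu Z) * dZ (fun Z => (Φ Z).2) Z,
    I * xi * M.mu Z * (Φ Z).2 + (M.mu Z : ℂ) * dZ (fun Z => (Φ Z).1) Z]

theorem generator_mulVec (xi : ℂ) (Z : ℝ) (u : Fin 4 → ℂ) :
    (M.generator xi Z).mulVec u =
      ![-(I * xi) * u 1 + 1 / M.mu Z * u 3,
        -(I * xi * M.lam Z / M.sig Z) * u 0 + 1 / M.sig Z * u 2,
        -(M.omega : ℂ) ^ 2 * u 1 + -(I * xi) * u 3,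
        ((M.sig Z - (M.lam Z : ℂ) ^ 2 / M.sig Z) * xi ^ 2 - (M.omega : ℂ) ^ 2) * u 0
          + -(I * xi * M.lam Z / M.sig Z) * u 2] := by
  ext i
  fin_cases i <;> simp [generator, Matrix.mulVec, dotProduct, Fin.sum_univ_four]

theorem bdryA_eq_state (xi : ℂ) (Φ : ℝ → ℂ × ℂ) : bdryA M xi Φ = M.state xi Φ 0 2 := rfl

theorem bdryB_eq_state (xi : ℂ) (Φ : ℝ → ℂ × ℂ) : bdryB M xi Φ = M.state xi Φ 0 3 := rfl

theorem continuousOn_generator (xi : ℂ) : ContinuousOn (M.generator xi) (Iic 0) := by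
  have hmu := M.mu_contDiff_ofReal.continuousOn
  have hlam := M.lam_contDiff_ofReal.continuousOn
  have hsig := M.sig_contDiff_ofReal.continuousOn
  have h1 : ContinuousOn (fun Z => 1 / (M.mu Z : ℂ)) (Iic 0) :=
    continuousOn_const.div hmu fun Z hZ => M.mu_ne_zero hZ
  have h2 : ContinuousOn (fun Z => 1 / (M.sig Z : ℂ)) (Iic 0) :=
    continuousOn_const.div hsig fun Z hZ => M.sig_ne_zero hZ
  have h3 : ContinuousOn (fun Z => -(I * xi * M.lam Z / M.sig Z)) (Iic 0) :=
    ((continuousOn_const.mul hlam).div hsig fun Z hZ => M.sig_ne_zero hZ).neg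
  have h4 : ContinuousOn (fun Z => (M.sig Z - (M.lam Z : ℂ) ^ 2 / M.sig Z) * xi ^ 2
      - (M.omega : ℂ) ^ 2) (Iic 0) :=
    ((hsig.sub ((hlam.pow 2).div hsig fun Z hZ => M.sig_ne_zero hZ)).mul
      continuousOn_const).sub continuousOn_const
  refine continuousOn_pi.2 fun i => continuousOn_pi.2 fun j => ?_
  fin_cases i <;> fin_cases j <;>
    first | exact continuousOn_const | exact h1 | exact h2 | exact h3 | exact h4

end Medium

theorem hasDerivWithinAt_dZ {f : ℝ → ℂ} {n : WithTop ℕ∞} (hf : ContDiffOn ℝ n f (Iic 0))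
    (hn : n ≠ 0) {Z : ℝ} (hZ : Z ≤ 0) : HasDerivWithinAt f (dZ f Z) (Iic 0) Z :=
  ((hf.differentiableOn hn) Z hZ).hasDerivWithinAt

theorem contDiffOn_dZ {f : ℝ → ℂ} {n m : WithTop ℕ∞} (hf : ContDiffOn ℝ n f (Iic 0))
    (hn : m + 1 ≤ n) : ContDiffOn ℝ m (dZ f) (Iic 0) :=
  hf.derivWithin (uniqueDiffOn_Iic 0) hn

theorem contDiffOn_succ_of_dZ {f g : ℝ → ℂ} {n : ℕ}
    (hf : ∀ Z ≤ 0, HasDerivWithinAt f (g Z) (Iic 0) Z) (hg : ContDiffOn ℝ n g (Iic 0)) :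
    ContDiffOn ℝ (n + 1) f (Iic 0) := by
  rw [contDiffOn_succ_iff_derivWithin (uniqueDiffOn_Iic 0)]
  refine ⟨fun Z hZ => (hf Z hZ).differentiableWithinAt, by simp, ?_⟩
  exact hg.congr fun Z hZ => (hf Z hZ).derivWithin (uniqueDiffOn_Iic 0 Z hZ)

/-! ### Equivalence of the Rayleigh system and the first-order system -/

namespace IsRayleighSolution

variable {M : Medium} {xi : ℂ} {Φ : ℝ → ℂ × ℂ}

theorem continuousOn_state (h : IsRayleighSolution M xi Φ) :
    ContinuousOn (M.state xi Φ) (Iic 0) := by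
  have hmu := M.mu_contDiff_ofReal.continuousOn
  have hlam := M.lam_contDiff_ofReal.continuousOn
  have h1 := h.contDiff_fst.continuousOn
  have h3 := h.contDiff_snd.continuousOn
  have d1 := (contDiffOn_dZ (m := 1) h.contDiff_fst (by norm_num)).continuousOn
  have d3 := (contDiffOn_dZ (m := 1) h.contDiff_snd (by norm_num)).continuousOn
  refine continuousOn_pi.2 fun i => ?_
  fin_cases i
  · exact h1
  · exact h3
  · exact ((continuousOn_const.mul hlam).mul h1).add
      ((hlam.add (continuousOn_const.mul hmu)).mul d3)
  · exact ((continuousOn_const.mul hmu).mul h3).add (hmu.mul d1)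

/-- The first two rows are the definitions of b and a solved for φ₁' and φ₃'. The last two are the
Rayleigh equations: their terms (μφ₁')' + iξ(μφ₃)' and ((λ+2μ)φ₃')' + iξ(λφ₁)' are the derivatives
of b and a. -/
theorem hasDerivAt_state (h : IsRayleighSolution M xi Φ) {Z : ℝ} (hZ : Z < 0) :
    HasDerivAt (M.state xi Φ) ((M.generator xi Z).mulVec (M.state xi Φ Z)) Z := by
  have hnhds : Iic (0 : ℝ) ∈ nhds Z := Iic_mem_nhds hZ
  have hmu : ContDiffOn ℝ 1 (fun Z => (M.mu Z : ℂ)) (Iic 0) :=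
    M.mu_contDiff_ofReal.of_le (by norm_num)
  have hlam := M.lam_contDiff_ofReal
  have h1 := h.contDiff_fst
  have h3 := h.contDiff_snd
  have h1' : ContDiffOn ℝ 1 (fun Z => (Φ Z).1) (Iic 0) := h1.of_le (by norm_num)
  have h3' : ContDiffOn ℝ 1 (fun Z => (Φ Z).2) (Iic 0) := h3.of_le (by norm_num)
  have d1 : ContDiffOn ℝ 1 (dZ fun Z => (Φ Z).1) (Iic 0) := contDiffOn_dZ h1 (by norm_num)
  have d3 : ContDiffOn ℝ 1 (dZ fun Z => (Φ Z).2) (Iic 0) := contDiffOn_dZ h3 (by norm_num)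
  have hD : ∀ {f : ℝ → ℂ}, ContDiffOn ℝ 1 f (Iic 0) → HasDerivAt f (dZ f Z) Z := fun hf =>
    (hasDerivWithinAt_dZ hf one_ne_zero hZ.le).hasDerivAt hnhds
  have e1 := h.eq_fst Z hZ
  have e3 := h.eq_snd Z hZ
  have m0 := M.mu_ne_zero hZ.le
  have s0 := M.sig_ne_zero hZ.le
  have s1 : (M.sig Z : ℂ) = M.lam Z + 2 * M.mu Z := by simp [Medium.sig]
  rw [s1] at s0
  rw [M.generator_mulVec, hasDerivAt_pi]
  intro i
  fin_cases i
  · refine (hD h1').congr_deriv ?_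
    simp [Medium.state]
    field_simp
    ring
  · refine (hD h3').congr_deriv ?_
    simp [Medium.state, s1]
    field_simp
    ring
  · have := ((hD (hlam.mul h1')).const_mul (I * xi)).add
      (hD ((hlam.add ((contDiffOn_const (c := (2 : ℂ))).mul hmu)).mul d3))
    refine (this.congr_deriv ?_).congr_of_eventuallyEq (.of_forall fun t => ?_)
    · simp [Medium.state]
      linear_combination (-1 : ℂ) * e3 + xi ^ 2 * M.mu Z * (Φ Z).2 * I_sq
    · simp [Medium.state]
      ring
  · have := ((hD (hmu.mul h3')).const_mul (I * xi)).add (hD (hmu.mul d1))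
    refine (this.congr_deriv ?_).congr_of_eventuallyEq (.of_forall fun t => ?_)
    · simp [Medium.state, s1]
      field_simp
      linear_combination (-(M.lam Z + 2 * M.mu Z : ℂ)) * e1
        + xi ^ 2 * (M.lam Z : ℂ) ^ 2 * (Φ Z).1 * I_sq
    · simp [Medium.state]
      ring

end IsRayleighSolution

/-- A solution of the first-order system yields a solution of the Rayleigh system. -/
theorem isRayleighSolution_of_hasDerivWithinAt {M : Medium} {xi : ℂ} {u : ℝ → Fin 4 → ℂ}
    (hu : ∀ Z ≤ 0, HasDerivWithinAt u ((M.generator xi Z).mulVec (u Z)) (Iic 0) Z) :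
    IsRayleighSolution M xi fun Z => (u Z 0, u Z 1) := by
  have hmu : ContDiffOn ℝ 1 (fun Z => (M.mu Z : ℂ)) (Iic 0) :=
    M.mu_contDiff_ofReal.of_le (by norm_num)
  have hlam := M.lam_contDiff_ofReal
  have hsig := M.sig_contDiff_ofReal
  have huc : ContinuousOn u (Iic 0) := fun Z hZ => (hu Z hZ).continuousWithinAt
  have hgc : ContinuousOn (fun Z => (M.generator xi Z).mulVec (u Z)) (Iic 0) := by
    have := M.continuousOn_generator xi
    refine continuousOn_pi.2 fun i => ?_
    simp only [Matrix.mulVec, dotProduct]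
    refine continuousOn_finsetSum _ fun j _ => ?_
    exact ((continuousOn_pi.1 ((continuousOn_pi.1 this) i)) j).mul (continuousOn_pi.1 huc j)
  have hui : ∀ i, ∀ Z ≤ 0,
      HasDerivWithinAt (fun Z => u Z i) ((M.generator xi Z).mulVec (u Z) i) (Iic 0) Z :=
    fun i Z hZ => (hasDerivWithinAt_pi.1 (hu Z hZ)) i
  -- Bootstrap: a continuous generator makes u of class C¹; then φ₁' and φ₃' are products of C¹
  -- functions, so φ₁ and φ₃ are C².
  have hu1 : ∀ i, ContDiffOn ℝ 1 (fun Z => u Z i) (Iic 0) := fun i => by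
    have := contDiffOn_succ_of_dZ (n := 0) (hui i)
      (contDiffOn_zero.2 (continuousOn_pi.1 hgc i))
    simpa using this
  have hd0 : ∀ Z ≤ 0, HasDerivWithinAt (fun Z => u Z 0)
      (-(I * xi) * u Z 1 + 1 / M.mu Z * u Z 3) (Iic 0) Z := fun Z hZ => by
    simpa [M.generator_mulVec] using hui 0 Z hZ
  have hd1 : ∀ Z ≤ 0, HasDerivWithinAt (fun Z => u Z 1)
      (-(I * xi * M.lam Z / M.sig Z) * u Z 0 + 1 / M.sig Z * u Z 2) (Iic 0) Z := fun Z hZ => by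
    simpa [M.generator_mulVec] using hui 1 Z hZ
  have hd2 : ∀ Z ≤ 0, HasDerivWithinAt (fun Z => u Z 2)
      (-(M.omega : ℂ) ^ 2 * u Z 1 + -(I * xi) * u Z 3) (Iic 0) Z := fun Z hZ => by
    simpa [M.generator_mulVec] using hui 2 Z hZ
  have hd3 : ∀ Z ≤ 0, HasDerivWithinAt (fun Z => u Z 3)
      (((M.sig Z - (M.lam Z : ℂ) ^ 2 / M.sig Z) * xi ^ 2 - (M.omega : ℂ) ^ 2) * u Z 0
          + -(I * xi * M.lam Z / M.sig Z) * u Z 2) (Iic 0) Z := fun Z hZ => by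
    simpa [M.generator_mulVec] using hui 3 Z hZ
  have hz0 : ∀ Z ≤ 0, dZ (fun Z => u Z 0) Z = -(I * xi) * u Z 1 + 1 / M.mu Z * u Z 3 :=
    fun Z hZ => (hd0 Z hZ).derivWithin (uniqueDiffOn_Iic 0 Z hZ)
  have hz1 : ∀ Z ≤ 0, dZ (fun Z => u Z 1) Z =
      -(I * xi * M.lam Z / M.sig Z) * u Z 0 + 1 / M.sig Z * u Z 2 :=
    fun Z hZ => (hd1 Z hZ).derivWithin (uniqueDiffOn_Iic 0 Z hZ)
  have hmi : ContDiffOn ℝ 1 (fun Z => 1 / (M.mu Z : ℂ)) (Iic 0) := by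
    simp only [one_div]
    exact hmu.inv fun Z hZ => M.mu_ne_zero hZ
  have hsi : ContDiffOn ℝ 1 (fun Z => 1 / (M.sig Z : ℂ)) (Iic 0) := by
    simp only [one_div]
    exact hsig.inv fun Z hZ => M.sig_ne_zero hZ
  have hls : ContDiffOn ℝ 1 (fun Z => I * xi * M.lam Z / M.sig Z) (Iic 0) := by
    simp only [div_eq_mul_inv]
    exact (contDiffOn_const.mul hlam).mul (hsig.inv fun Z hZ => M.sig_ne_zero hZ)
  have hcd0 : ContDiffOn ℝ 1 (fun Z => -(I * xi) * u Z 1 + 1 / M.mu Z * u Z 3) (Iic 0) :=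
    (contDiffOn_const.mul (hu1 1)).add
      (hmi.mul (hu1 3))
  have hcd1 : ContDiffOn ℝ 1
      (fun Z => -(I * xi * M.lam Z / M.sig Z) * u Z 0 + 1 / M.sig Z * u Z 2) (Iic 0) :=
    (hls.neg.mul (hu1 0)).add (hsi.mul (hu1 2))
  have two : ((1 : ℕ) : WithTop ℕ∞) + 1 = 2 := by norm_num
  refine ⟨?_, ?_, fun Z hZ => ?_, fun Z hZ => ?_⟩
  · rw [← two]
    exact contDiffOn_succ_of_dZ hd0 (by exact_mod_cast hcd0)
  · rw [← two]
    exact contDiffOn_succ_of_dZ hd1 (by exact_mod_cast hcd1)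
  · have hU := uniqueDiffOn_Iic (0 : ℝ) Z hZ.le
    have s0 := M.sig_ne_zero hZ.le
    have s1 : (M.sig Z : ℂ) = M.lam Z + 2 * M.mu Z := by simp [Medium.sig]
    have hp := hasDerivWithinAt_dZ (hmu.mul (hu1 1)) one_ne_zero hZ.le
    -- On all of Z ≤ 0 one has μφ₁' = b - iξμφ₃, so the second-order term is obtained from the
    -- equation for b. The equation for φ₃ is treated in the same way through a.
    have hm : dZ (fun t => (M.mu t : ℂ) * dZ (fun s => u s 0) t) Z =
        (((M.sig Z - (M.lam Z : ℂ) ^ 2 / M.sig Z) * xi ^ 2 - (M.omega : ℂ) ^ 2) * u Z 0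
          + -(I * xi * M.lam Z / M.sig Z) * u Z 2)
          - I * xi * dZ (fun t => (M.mu t : ℂ) * u t 1) Z := by
      refine HasDerivWithinAt.derivWithin ?_ hU
      refine ((hd3 Z hZ.le).sub (hp.const_mul (I * xi))).congr_of_mem (fun t ht => ?_) hZ.le
      simp only [hz0 t ht]
      have := M.mu_ne_zero ht
      simp
      field_simp
      ring
    simp only
    rw [hm, hz1 Z hZ.le, ← s1]
    field_simp
    linear_combination ((M.lam Z : ℂ) ^ 2 * xi ^ 2 * u Z 0) * I_sq
  · have hU := uniqueDiffOn_Iic (0 : ℝ) Z hZ.le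
    have m0 := M.mu_ne_zero hZ.le
    have hp := hasDerivWithinAt_dZ (hlam.mul (hu1 0)) one_ne_zero hZ.le
    have hm : dZ (fun t => ((M.lam t : ℂ) + 2 * M.mu t) * dZ (fun s => u s 1) t) Z =
        (-(M.omega : ℂ) ^ 2 * u Z 1 + -(I * xi) * u Z 3)
          - I * xi * dZ (fun t => (M.lam t : ℂ) * u t 0) Z := by
      refine HasDerivWithinAt.derivWithin ?_ hU
      refine ((hd2 Z hZ.le).sub (hp.const_mul (I * xi))).congr_of_mem (fun t ht => ?_) hZ.le
      simp only [hz1 t ht]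
      have s0 := M.sig_ne_zero ht
      have s1 : (M.lam t : ℂ) + 2 * M.mu t = M.sig t := by simp [Medium.sig]
      rw [s1]
      simp
      field_simp
      ring
    simp only
    rw [hm, hz0 Z hZ.le]
    field_simp
    linear_combination ((M.mu Z : ℂ) * xi ^ 2 * u Z 1) * I_sq

namespace Medium

variable (M : Medium)

/-! ### Transfer from the depth `H` to the surface -/

theorem generator_eq_of_le {xi : ℂ} {Z : ℝ} (hZ : Z ≤ -M.H) :
    M.generator xi Z = M.generator xi (-M.H) := by
  simp [generator, M.mu_const Z hZ, M.lam_const Z hZ, M.sig_const hZ]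

/-- The entries are polynomials in ξ of degree at most two, so the coefficients can be interpolated
from the values at 0, 1 and -1 and inherit their continuity in Z. -/
theorem generator_eq_quadratic (xi : ℂ) (Z : ℝ) :
    M.generator xi Z = M.generator 0 Z
      + xi • ((2⁻¹ : ℂ) • (M.generator 1 Z - M.generator (-1) Z))
      + xi ^ 2 • ((2⁻¹ : ℂ) • (M.generator 1 Z + M.generator (-1) Z) - M.generator 0 Z) := by
  ext i j
  fin_cases i <;> fin_cases j <;> simp [generator] <;> try ring_nf
  all_goals simp

/-- A solution of the first-order system on `[-H, 0]` that vanishes at `-H` is zero. -/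
theorem eq_zero_of_generator {xi : ℂ} {u : ℝ → Fin 4 → ℂ}
    (hc : ContinuousOn u (Icc (-M.H) 0))
    (hu : ∀ Z ∈ Ioo (-M.H) 0, HasDerivAt u ((M.generator xi Z).mulVec (u Z)) Z)
    (h0 : u (-M.H) = 0) : u 0 = 0 := by
  obtain ⟨C, hC⟩ := isCompact_Icc.exists_bound_of_continuousOn
    (E := Fin 4 → Fin 4 → ℂ) (f := M.generator xi)
    ((M.continuousOn_generator xi).mono (Icc_subset_Iic_self (a := -M.H)))
  have hH := M.neg_H_neg.le
  have hC0 : 0 ≤ C := (norm_nonneg _).trans (hC 0 (right_mem_Icc.2 hH))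
  have key := norm_le_of_dissipative (f := fun i Z => u Z i)
    (r := fun i Z => (M.generator xi Z).mulVec (u Z) i) (κ := 0) (ε := 0) hC0 le_rfl
    (fun i => by simp) (fun i => continuousOn_pi.1 hc i)
    (fun i t ht => by simpa using (hasDerivAt_pi.1 (hu t ht)) i) (fun i t ht => by
      rw [add_zero, Finset.mul_sum]
      simp only [Matrix.mulVec, dotProduct]
      refine (norm_sum_le _ _).trans (Finset.sum_le_sum fun j _ => ?_)
      rw [norm_mul]
      gcongr
      exact ((norm_le_pi_norm (M.generator xi t i) j).trans
        (norm_le_pi_norm (fun i j => M.generator xi t i j) i)).trans (hC t (Ioo_subset_Icc_self ht)))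
    0 (right_mem_Icc.2 hH)
  ext i
  simpa [h0] using key i

theorem exists_generator_solution (v : Fin 4 → ℂ) :
    ∃ u : ℂ → ℝ → Fin 4 → ℂ, (∀ z, u z (-M.H) = v) ∧
      (∀ z, ∀ Z ∈ Icc (-M.H) 0, HasDerivAt (u z) ((M.generator z Z).mulVec (u z Z)) Z) ∧
      Differentiable ℂ fun z => u z 0 := by
  set Λ : Matrix (Fin 4) (Fin 4) ℂ →ₗ[ℂ] ((Fin 4 → ℂ) →L[ℂ] (Fin 4 → ℂ)) :=
    (Matrix.toLin'.trans LinearMap.toContinuousLinearMap).toLinearMap with hΛ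
  have hΛc : Continuous Λ := LinearMap.continuous_of_finiteDimensional Λ
  -- The coefficients are controlled only for Z ≤ 0; freezing them at 0 extends them continuously to
  -- ℝ.
  have hg : ∀ z, Continuous fun t : ℝ => M.generator z (min t 0) := fun z =>
    (M.continuousOn_generator z).comp_continuous (by fun_prop) fun t => mem_Iic.2 (min_le_right _ _)
  obtain ⟨u, h1, h2, h3⟩ := exists_linear_ode_solution M.neg_H_neg.le
    (A₀ := fun t => Λ (M.generator 0 (min t 0)))
    (A₁ := fun t => Λ ((2⁻¹ : ℂ) • (M.generator 1 (min t 0) - M.generator (-1) (min t 0))))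
    (A₂ := fun t => Λ ((2⁻¹ : ℂ) • (M.generator 1 (min t 0) + M.generator (-1) (min t 0))
      - M.generator 0 (min t 0)))
    (hΛc.comp (hg 0)) (hΛc.comp (((hg 1).sub (hg (-1))).const_smul (2⁻¹ : ℂ)))
    (hΛc.comp ((((hg 1).add (hg (-1))).const_smul (2⁻¹ : ℂ)).sub (hg 0))) v
  refine ⟨u, h1, fun z Z hZ => (h2 z Z hZ).congr_deriv ?_, h3⟩
  rw [← map_smul, ← map_smul, ← map_add, ← map_add, ← generator_eq_quadratic, min_eq_left hZ.2]
  simp [hΛ]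

/-- The state at the surface is a linear function of the state at depth `H`, with coefficients
that are entire in `ξ`. -/
theorem exists_transfer : ∃ T : ℂ → Matrix (Fin 4) (Fin 4) ℂ,
    (∀ i j, Differentiable ℂ fun z => T z i j) ∧
    ∀ (xi : ℂ) (Φ : ℝ → ℂ × ℂ), IsRayleighSolution M xi Φ →
      M.state xi Φ 0 = (T xi).mulVec (M.state xi Φ (-M.H)) := by
  choose U hU1 hU2 hU3 using fun k : Fin 4 => M.exists_generator_solution (Pi.single k 1)
  refine ⟨fun z => Matrix.of fun i k => U k z 0 i, fun i j => ?_, fun xi Φ h => ?_⟩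
  · exact fun z => (differentiableAt_pi.1 (hU3 j z)) i
  · set s := M.state xi Φ (-M.H) with hs
    set w : ℝ → Fin 4 → ℂ := fun Z => ∑ k, s k • U k xi Z with hw
    have hwd : ∀ Z ∈ Icc (-M.H) 0, HasDerivAt w ((M.generator xi Z).mulVec (w Z)) Z := by
      intro Z hZ
      refine (HasDerivAt.fun_sum fun k (_ : k ∈ Finset.univ) =>
        (hU2 k xi Z hZ).const_smul (s k)).congr_deriv ?_
      simp only [hw, ← Matrix.mulVecLin_apply, map_sum, map_smul]
    -- By uniqueness Φ is the combination of the four fundamental solutions with the same state at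
    -- -H.
    have h0 := M.eq_zero_of_generator (xi := xi) (u := fun Z => M.state xi Φ Z - w Z)
      ((h.continuousOn_state.mono Icc_subset_Iic_self).sub fun Z hZ =>
        (hwd Z hZ).continuousAt.continuousWithinAt)
      (fun Z hZ => by
        rw [Matrix.mulVec_sub]
        exact (h.hasDerivAt_state hZ.2).sub (hwd Z (Ioo_subset_Icc_self hZ)))
      (by
        ext i
        simp [hw, hU1, ← hs, Pi.single_apply])
    ext i
    have := congrFun (sub_eq_zero.1 h0) i
    rw [this]
    simp [hw, Matrix.mulVec, dotProduct, mul_comm]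

/-! ### Modes of the homogeneous half-space -/

/-- The state of the compressional wave `f_{P,0}^-`, without its exponential factor. -/
def modeP (xi q : ℂ) : Fin 4 → ℂ :=
  ![xi, -q, I * ((M.omega : ℂ) ^ 2 - 2 * M.muI * xi ^ 2), -(2 * I * M.muI * xi * q)]

/-- The state of the shear wave `f_{S,0}^-`, without its exponential factor. -/
def modeS (xi q : ℂ) : Fin 4 → ℂ :=
  ![-q, -xi, 2 * I * M.muI * xi * q, I * ((M.omega : ℂ) ^ 2 - 2 * M.muI * xi ^ 2)]

theorem sigI_eq : (M.sig (-M.H) : ℂ) = M.lamI + 2 * M.muI := by simp [sig, lamI, muI]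

theorem sigI_ne_zero : (M.lamI : ℂ) + 2 * M.muI ≠ 0 :=
  M.sigI_eq ▸ M.sig_ne_zero M.neg_H_neg.le

theorem muI_ne_zero : (M.muI : ℂ) ≠ 0 := M.mu_ne_zero M.neg_H_neg.le

theorem generator_modeP {xi q : ℂ}
    (hq : q ^ 2 = (M.omega : ℂ) ^ 2 / (M.lamI + 2 * M.muI) - xi ^ 2) :
    (M.generator xi (-M.H)).mulVec (M.modeP xi q) = (-(I * q)) • M.modeP xi q := by
  have hs := M.sigI_ne_zero
  have hm := M.muI_ne_zero
  have hq' : (M.omega : ℂ) ^ 2 = (q ^ 2 + xi ^ 2) * (M.lamI + 2 * M.muI) := by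
    rw [hq]; field_simp; ring
  rw [M.generator_mulVec, M.sigI_eq, show M.mu (-M.H) = M.muI from rfl,
    show M.lam (-M.H) = M.lamI from rfl]
  ext i
  fin_cases i <;> simp [modeP] <;> field_simp <;> (try simp only [I_sq, hq']) <;> ring

theorem generator_modeS {xi q : ℂ} (hq : q ^ 2 = (M.omega : ℂ) ^ 2 / M.muI - xi ^ 2) :
    (M.generator xi (-M.H)).mulVec (M.modeS xi q) = (-(I * q)) • M.modeS xi q := by
  have hs := M.sigI_ne_zero
  have hm := M.muI_ne_zero
  have hq' : (M.omega : ℂ) ^ 2 = (q ^ 2 + xi ^ 2) * M.muI := by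
    rw [hq]; field_simp; ring
  rw [M.generator_mulVec, M.sigI_eq, show M.mu (-M.H) = M.muI from rfl,
    show M.lam (-M.H) = M.lamI from rfl]
  ext i
  fin_cases i <;> simp [modeS] <;> field_simp <;> (try simp only [I_sq, hq']) <;> ring

/-! ### Jost solutions as continuations of homogeneous modes -/

variable {M}

theorem hasDerivAt_mode (q : ℂ) (v : Fin 4 → ℂ) (Z : ℝ) :
    HasDerivAt (fun Z : ℝ => exp (-(I * Z * q)) • v) (exp (-(I * Z * q)) • (-(I * q)) • v) Z := by
  have h1 : HasDerivAt (fun Z : ℝ => -(I * Z * q)) (-(I * 1 * q)) Z :=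
    (((hasDerivAt_id Z).ofReal_comp.const_mul I).mul_const q).neg
  refine (h1.cexp.smul_const v).congr_deriv ?_
  rw [smul_smul, mul_one]

/-- The explicit mode below -H is glued to the solution of the Cauchy problem above. At -H both
pieces have the same value and satisfy the same equation, so the one-sided derivatives agree. -/
theorem exists_solution_from_below {xi q : ℂ} {v : Fin 4 → ℂ}
    (hv : (M.generator xi (-M.H)).mulVec v = (-(I * q)) • v) :
    ∃ Φ, IsRayleighSolution M xi Φ ∧
      ∀ Z < -M.H, Φ Z = (v 0 * exp (-(I * Z * q)), v 1 * exp (-(I * Z * q))) := by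
  obtain ⟨u, h1, h2, -⟩ := M.exists_generator_solution (exp (-(I * ↑(-M.H) * q)) • v)
  set m : ℝ → Fin 4 → ℂ := fun Z => exp (-(I * Z * q)) • v with hm
  set w : ℝ → Fin 4 → ℂ := fun Z => if Z ≤ -M.H then m Z else u xi Z with hw
  have hwm : EqOn w m (Iic (-M.H)) := fun Z hZ => if_pos hZ
  have hwu : EqOn w (u xi) (Ici (-M.H)) := by
    intro Z hZ
    by_cases h : Z ≤ -M.H
    · rw [hwm h, le_antisymm h hZ, h1]
    · exact if_neg h
  have hmd : ∀ Z ≤ -M.H, HasDerivAt m ((M.generator xi Z).mulVec (m Z)) Z := by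
    intro Z hZ
    rw [M.generator_eq_of_le hZ, hm, Matrix.mulVec_smul, hv]
    exact hasDerivAt_mode q v Z
  have hwd : ∀ Z ≤ 0, HasDerivAt w ((M.generator xi Z).mulVec (w Z)) Z := by
    intro Z hZ
    rcases lt_trichotomy Z (-M.H) with h | h | h
    · rw [hwm h.le]
      exact (hmd Z h.le).congr_of_eventuallyEq (hwm.eventuallyEq_of_mem (Iic_mem_nhds h))
    · have hl : HasDerivWithinAt w ((M.generator xi Z).mulVec (w Z)) (Iic Z) Z := by
        rw [hwm h.le]
        exact (hmd Z h.le).hasDerivWithinAt.congr_of_mem (h ▸ hwm) self_mem_Iic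
      have hr : HasDerivWithinAt w ((M.generator xi Z).mulVec (w Z)) (Ici Z) Z := by
        rw [hwu h.ge]
        exact (h2 xi Z ⟨h.ge, hZ⟩).hasDerivWithinAt.congr_of_mem (h ▸ hwu) self_mem_Ici
      have := hl.union hr
      rwa [Iic_union_Ici, hasDerivWithinAt_univ] at this
    · rw [hwu h.le]
      exact (h2 xi Z ⟨h.le, hZ⟩).congr_of_eventuallyEq
        (hwu.eventuallyEq_of_mem (Ici_mem_nhds h))
  refine ⟨_, isRayleighSolution_of_hasDerivWithinAt fun Z hZ => (hwd Z hZ).hasDerivWithinAt, ?_⟩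
  intro Z hZ
  simp [hwm hZ.le, hm, mul_comm]

end Medium

/-- Φ is prescribed only for Z < -H, strictly. The state at -H is the limit from below, which exists
because the state is continuous. -/
theorem IsRayleighSolution.state_neg_H {M : Medium} {xi q : ℂ} {v : Fin 4 → ℂ} {Φ : ℝ → ℂ × ℂ}
    (h : IsRayleighSolution M xi Φ) (hv : (M.generator xi (-M.H)).mulVec v = (-(I * q)) • v)
    (hΦ : ∀ Z < -M.H, Φ Z = (v 0 * exp (-(I * Z * q)), v 1 * exp (-(I * Z * q)))) :
    M.state xi Φ (-M.H) = exp (I * M.H * q) • v := by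
  have hm := M.muI_ne_zero
  have hs := M.sigI_ne_zero
  rw [M.generator_mulVec, M.sigI_eq, show M.mu (-M.H) = M.muI from rfl,
    show M.lam (-M.H) = M.lamI from rfl] at hv
  have hv0 := congrFun hv 0
  have hv1 := congrFun hv 1
  simp only [Pi.smul_apply, smul_eq_mul, Matrix.cons_val_zero, Matrix.cons_val_one] at hv0 hv1
  have hmode : ∀ Z < -M.H, M.state xi Φ Z = exp (-(I * Z * q)) • v := by
    intro Z hZ
    have hZ0 : Z < 0 := hZ.trans M.neg_H_neg
    have hev : Φ =ᶠ[nhds Z] fun Z => (v 0 * exp (-(I * Z * q)), v 1 * exp (-(I * Z * q))) := by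
      filter_upwards [Iio_mem_nhds hZ] with t ht using hΦ t ht
    have hd := hasDerivAt_pi.1 (Medium.hasDerivAt_mode q v Z)
    have h1 : dZ (fun Z => (Φ Z).1) Z = exp (-(I * Z * q)) * (-(I * q) * v 0) := by
      have : HasDerivAt (fun Z => (Φ Z).1) (exp (-(I * Z * q)) * (-(I * q) * v 0)) Z :=
        (hd 0).congr_of_eventuallyEq (hev.mono fun t ht => by simp [ht, mul_comm])
      exact this.hasDerivWithinAt.derivWithin (uniqueDiffOn_Iic 0 Z hZ0.le)
    have h3 : dZ (fun Z => (Φ Z).2) Z = exp (-(I * Z * q)) * (-(I * q) * v 1) := by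
      have : HasDerivAt (fun Z => (Φ Z).2) (exp (-(I * Z * q)) * (-(I * q) * v 1)) Z :=
        (hd 1).congr_of_eventuallyEq (hev.mono fun t ht => by simp [ht, mul_comm])
      exact this.hasDerivWithinAt.derivWithin (uniqueDiffOn_Iic 0 Z hZ0.le)
    have hmu : M.mu Z = M.muI := M.mu_const Z hZ.le
    have hlam : M.lam Z = M.lamI := M.lam_const Z hZ.le
    ext i
    fin_cases i
    · simp [Medium.state, hΦ Z hZ, mul_comm]
    · simp [Medium.state, hΦ Z hZ, mul_comm]
    · simp only [Medium.state, h3, ← hv1, hΦ Z hZ, hmu, hlam]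
      simp
      field_simp
      ring
    · simp only [Medium.state, h1, ← hv0, hΦ Z hZ, hmu, hlam]
      simp
      field_simp
      ring
  have ht1 : Filter.Tendsto (M.state xi Φ) (nhdsWithin (-M.H) (Iio (-M.H)))
      (nhds (M.state xi Φ (-M.H))) :=
    (h.continuousOn_state.continuousAt (Iic_mem_nhds M.neg_H_neg)).tendsto.mono_left
      nhdsWithin_le_nhds
  have ht2 : Filter.Tendsto (M.state xi Φ) (nhdsWithin (-M.H) (Iio (-M.H)))
      (nhds (exp (-(I * ↑(-M.H) * q)) • v)) := by
    refine Filter.Tendsto.congr' ?_ ((Medium.hasDerivAt_mode q v (-M.H)).continuousAt.tendsto.mono_left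
      nhdsWithin_le_nhds)
    filter_upwards [self_mem_nhdsWithin] with Z hZ using (hmode Z hZ).symm
  rw [tendsto_nhds_unique ht1 ht2]
  congr 2
  push_cast
  ring

/-- Existence justifies the choice made in `solutionFromBelow`. Every admissible Φ has the same
state at -H, and this is all that Δ depends on. -/
theorem solutionFromBelow_spec {M : Medium} {xi q : ℂ} {v : Fin 4 → ℂ} {Φ₀ : ℝ → ℂ × ℂ}
    (hv : (M.generator xi (-M.H)).mulVec v = (-(I * q)) • v)
    (hΦ₀ : ∀ Z : ℝ, Φ₀ Z = (v 0 * exp (-(I * Z * q)), v 1 * exp (-(I * Z * q)))) :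
    IsRayleighSolution M xi (solutionFromBelow M xi Φ₀) ∧
      M.state xi (solutionFromBelow M xi Φ₀) (-M.H) = exp (I * M.H * q) • v := by
  obtain ⟨Φ, h1, h2⟩ := Medium.exists_solution_from_below hv
  have h := Classical.epsilon_spec
    (p := fun Φ => IsRayleighSolution M xi Φ ∧ ∀ Z < -M.H, Φ Z = Φ₀ Z)
    ⟨Φ, h1, fun Z hZ => by rw [h2 Z hZ, hΦ₀]⟩
  exact ⟨h.1, h.1.state_neg_H hv fun Z hZ => by rw [← hΦ₀]; exact h.2 Z hZ⟩

theorem jostP_spec {M : Medium} (p : Surface M) :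
    IsRayleighSolution M p.xi (jostP p) ∧
      M.state p.xi (jostP p) (-M.H) = exp (I * M.H * p.qP) • M.modeP p.xi p.qP :=
  solutionFromBelow_spec (M.generator_modeP p.qP_sq) fun Z => by simp [jostP0, Medium.modeP]

theorem jostS_spec {M : Medium} (p : Surface M) :
    IsRayleighSolution M p.xi (jostS p) ∧
      M.state p.xi (jostS p) (-M.H) = exp (I * M.H * p.qS) • M.modeS p.xi p.qS :=
  solutionFromBelow_spec (M.generator_modeS p.qS_sq) fun Z => by simp [jostS0, Medium.modeS]

theorem rayleighDet_eq {M : Medium} (p : Surface M) :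
    rayleighDet p =
      M.state p.xi (jostP p) 0 2 * M.state p.xi (jostS p) 0 3
        - M.state p.xi (jostS p) 0 2 * M.state p.xi (jostP p) 0 3 := by
  simp [rayleighDet, boundaryMatrix, Matrix.det_fin_two, Medium.bdryA_eq_state,
    Medium.bdryB_eq_state]

/-! ### The function `F` is entire -/

/-- Near every point there is a branch of `√(c - z²)` that is continuous at this point, and
holomorphic there unless the point is a branch point. -/
theorem exists_local_sqrt (c z₀ : ℂ) : ∃ q : ℂ → ℂ, (∀ z, q z ^ 2 = c - z ^ 2) ∧
    ContinuousAt q z₀ ∧ (z₀ ^ 2 ≠ c → DifferentiableAt ℂ q z₀) := by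
  have hsq : ∀ w : ℂ, (w ^ (2⁻¹ : ℂ)) ^ 2 = w := fun w => by
    simp
  by_cases h : z₀ ^ 2 = c
  · refine ⟨fun z => (c - z ^ 2) ^ (2⁻¹ : ℂ), fun z => hsq _, ?_, fun h' => absurd h h'⟩
    -- At a branch point the argument of the root vanishes, and the principal root is continuous at
    -- 0.
    have h1 : ContinuousAt (fun w : ℂ => w ^ (2⁻¹ : ℂ)) (c - z₀ ^ 2) :=
      continuousAt_cpow_const_of_re_pos (Or.inl (by simp [h])) (by norm_num)
    exact h1.comp (f := fun z : ℂ => c - z ^ 2) (by fun_prop)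
  · obtain ⟨r, hr⟩ : ∃ r : ℂ, r ^ 2 = c - z₀ ^ 2 := ⟨_, hsq _⟩
    have hr0 : r ^ 2 ≠ 0 := by rw [hr]; exact sub_ne_zero.2 (Ne.symm h)
    -- Dividing by r² moves the argument of the root to 1, away from the cut.
    have hd : DifferentiableAt ℂ (fun z => r * ((c - z ^ 2) / r ^ 2) ^ (2⁻¹ : ℂ)) z₀ := by
      refine DifferentiableAt.const_mul (DifferentiableAt.cpow (by fun_prop) (by fun_prop) ?_) r
      rw [← hr, div_self hr0]
      exact one_mem_slitPlane
    refine ⟨fun z => r * ((c - z ^ 2) / r ^ 2) ^ (2⁻¹ : ℂ), fun z => ?_, hd.continuousAt,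
      fun _ => hd⟩
    rw [mul_pow, hsq, mul_div_cancel₀ _ hr0]

theorem finite_setOf_sq_eq (c : ℂ) : {z : ℂ | z ^ 2 = c}.Finite := by
  obtain ⟨r, hr⟩ : ∃ r : ℂ, r ^ 2 = c :=
    ⟨c ^ (2⁻¹ : ℂ), by simp⟩
  refine (Set.toFinite {r, -r}).subset fun z hz => ?_
  exact sq_eq_sq_iff_eq_or_eq_neg.1 (by rw [hr]; exact hz)

/-- A function that is continuous, and holomorphic away from a finite set, is entire. -/
theorem differentiable_of_continuous_of_finite {f : ℂ → ℂ} {S : Set ℂ} (hS : S.Finite)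
    (hc : Continuous f) (hd : ∀ z ∉ S, DifferentiableAt ℂ f z) : Differentiable ℂ f := by
  intro z₀
  refine (analyticAt_of_differentiable_on_punctured_nhds_of_continuousAt ?_
    hc.continuousAt).differentiableAt
  have h : (S \ {z₀})ᶜ ∈ nhds z₀ :=
    (hS.subset sdiff_subset).isClosed.isOpen_compl.mem_nhds (by simp)
  filter_upwards [nhdsWithin_le_nhds h, self_mem_nhdsWithin] with z hz hz'
  exact hd z fun hzS => hz ⟨hzS, hz'⟩

namespace Medium

variable (M : Medium)

/-- The Rayleigh determinant is an entire function of `ξ` and the two quasi-momenta. -/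
theorem exists_rayleighDet_eq : ∃ D : ℂ × ℂ × ℂ → ℂ, Differentiable ℂ D ∧
    ∀ p : Surface M, rayleighDet p = D (p.xi, p.qP, p.qS) := by
  obtain ⟨T, hT, hT'⟩ := M.exists_transfer
  set P : Fin 4 → ℂ × ℂ × ℂ → ℂ := fun i x =>
    (T x.1).mulVec (exp (I * M.H * x.2.1) • M.modeP x.1 x.2.1) i with hP
  set S : Fin 4 → ℂ × ℂ × ℂ → ℂ := fun i x =>
    (T x.1).mulVec (exp (I * M.H * x.2.2) • M.modeS x.1 x.2.2) i with hS
  have hPd : ∀ i, Differentiable ℂ (P i) := by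
    intro i
    simp only [hP, Matrix.mulVec, dotProduct]
    refine Differentiable.fun_sum fun j _ => ?_
    refine ((hT i j).comp differentiable_fst).mul ?_
    fin_cases j <;> simp [modeP] <;> fun_prop
  have hSd : ∀ i, Differentiable ℂ (S i) := by
    intro i
    simp only [hS, Matrix.mulVec, dotProduct]
    refine Differentiable.fun_sum fun j _ => ?_
    refine ((hT i j).comp differentiable_fst).mul ?_
    fin_cases j <;> simp [modeS] <;> fun_prop
  refine ⟨fun x => P 2 x * S 3 x - S 2 x * P 3 x,
    ((hPd 2).mul (hSd 3)).sub ((hSd 2).mul (hPd 3)), fun p => ?_⟩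
  rw [rayleighDet_eq, hT' _ _ (jostP_spec p).1, hT' _ _ (jostS_spec p).1, (jostP_spec p).2,
    (jostS_spec p).2]

/-- By `F_eq` any pair of roots may be inserted in the entire function `D`, so at each point a
branch that is well behaved there can be used. Only the zeros of q_P² and q_S² remain, and
continuity removes these singularities. -/
theorem differentiable_F : Differentiable ℂ (F M) := by
  obtain ⟨D, hD, hD'⟩ := M.exists_rayleighDet_eq
  set cP : ℂ := (M.omega : ℂ) ^ 2 / (M.lamI + 2 * M.muI) with hcP
  set cS : ℂ := (M.omega : ℂ) ^ 2 / M.muI with hcS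
  have hF : ∀ {qP qS : ℂ → ℂ}, (∀ z, qP z ^ 2 = cP - z ^ 2) → (∀ z, qS z ^ 2 = cS - z ^ 2) →
      F M = fun z => D (z, qP z, qS z) * D (z, -qP z, qS z) * D (z, qP z, -qS z)
        * D (z, -qP z, -qS z) := by
    intro qP qS hP hS
    funext z
    have := F_eq (M := M) ⟨z, qP z, qS z, hP z, hS z⟩
    rw [hD', hD', hD', hD'] at this
    exact this
  refine differentiable_of_continuous_of_finite
    ((finite_setOf_sq_eq cP).union (finite_setOf_sq_eq cS)) ?_ ?_
  · refine continuous_iff_continuousAt.2 fun z₀ => ?_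
    obtain ⟨qP, hP, hPc, -⟩ := exists_local_sqrt cP z₀
    obtain ⟨qS, hS, hSc, -⟩ := exists_local_sqrt cS z₀
    rw [hF hP hS]
    have hDc := hD.continuous
    fun_prop
  · intro z₀ hz₀
    obtain ⟨qP, hP, -, hPd⟩ := exists_local_sqrt cP z₀
    obtain ⟨qS, hS, -, hSd⟩ := exists_local_sqrt cS z₀
    have hPd' := hPd fun h => hz₀ (Or.inl h)
    have hSd' := hSd fun h => hz₀ (Or.inr h)
    rw [hF hP hS]
    fun_prop

end Medium

/-! ### The function `F` is of exponential type -/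

theorem norm_le_of_sq_eq {c q xi : ℂ} (h : q ^ 2 = c - xi ^ 2) (hxi : 1 ≤ ‖xi‖) :
    ‖q‖ ≤ (‖c‖ + 1) * ‖xi‖ := by
  have h1 : ‖q‖ ^ 2 ≤ ‖c‖ + ‖xi‖ ^ 2 := by
    rw [← norm_pow, ← norm_pow, h]
    exact norm_sub_le _ _
  refine abs_le_of_sq_le_sq' ?_ (by positivity) |>.2
  have h2 := norm_nonneg c
  have h3 : 1 ≤ ‖xi‖ ^ 2 := one_le_pow₀ hxi
  calc ‖q‖ ^ 2 ≤ ‖c‖ * ‖xi‖ ^ 2 + ‖xi‖ ^ 2 :=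
        h1.trans (by gcongr; exact le_mul_of_one_le_right h2 h3)
    _ = (‖c‖ + 1) * ‖xi‖ ^ 2 := by ring
    _ ≤ (‖c‖ + 1) ^ 2 * ‖xi‖ ^ 2 := by gcongr; nlinarith
    _ = _ := by ring

namespace Medium

variable (M : Medium)

/-- A bound on `[-H, 0]` for all the coefficients of the first-order system. -/
theorem exists_coefficient_bound : ∃ C : ℝ, 1 ≤ C ∧ ∀ Z ∈ Icc (-M.H) 0,
    ‖(1 : ℂ) / M.mu Z‖ ≤ C ∧ ‖(1 : ℂ) / M.sig Z‖ ≤ C ∧ ‖(M.lam Z : ℂ) / M.sig Z‖ ≤ C ∧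
      ‖M.sig Z - (M.lam Z : ℂ) ^ 2 / M.sig Z‖ ≤ C ∧ ‖(M.omega : ℂ) ^ 2‖ ≤ C := by
  have hmu := M.mu_contDiff_ofReal.continuousOn
  have hlam := M.lam_contDiff_ofReal.continuousOn
  have hsig := M.sig_contDiff_ofReal.continuousOn
  have hsub : Icc (-M.H) 0 ⊆ Iic 0 := Icc_subset_Iic_self
  obtain ⟨C₁, h₁⟩ := isCompact_Icc.exists_bound_of_continuousOn
    ((continuousOn_const (c := (1 : ℂ))).div (hmu.mono hsub) fun Z hZ => M.mu_ne_zero hZ.2)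
  obtain ⟨C₂, h₂⟩ := isCompact_Icc.exists_bound_of_continuousOn
    ((continuousOn_const (c := (1 : ℂ))).div (hsig.mono hsub) fun Z hZ => M.sig_ne_zero hZ.2)
  obtain ⟨C₃, h₃⟩ := isCompact_Icc.exists_bound_of_continuousOn
    ((hlam.mono hsub).div (hsig.mono hsub) fun Z hZ => M.sig_ne_zero hZ.2)
  obtain ⟨C₄, h₄⟩ := isCompact_Icc.exists_bound_of_continuousOn
    ((hsig.mono hsub).sub
      (((hlam.mono hsub).pow 2).div (hsig.mono hsub) fun Z hZ => M.sig_ne_zero hZ.2))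
  set C : ℝ := 1 + |C₁| + |C₂| + |C₃| + |C₄| + ‖(M.omega : ℂ) ^ 2‖ with hC
  have n₁ := abs_nonneg C₁
  have n₂ := abs_nonneg C₂
  have n₃ := abs_nonneg C₃
  have n₄ := abs_nonneg C₄
  have n₅ := norm_nonneg ((M.omega : ℂ) ^ 2)
  have l₁ := le_abs_self C₁
  have l₂ := le_abs_self C₂
  have l₃ := le_abs_self C₃
  have l₄ := le_abs_self C₄
  exact ⟨C, by linarith, fun Z hZ => ⟨(h₁ Z hZ).trans (by linarith), (h₂ Z hZ).trans (by linarith),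
    (h₃ Z hZ).trans (by linarith), (h₄ Z hZ).trans (by linarith), by linarith⟩⟩

/-- Solutions grow at most like `e^{C |ξ|}` between the depth `H` and the surface. -/
theorem exists_state_bound : ∃ C : ℝ, 0 ≤ C ∧ ∀ (xi : ℂ) (Φ : ℝ → ℂ × ℂ), 1 ≤ ‖xi‖ →
    IsRayleighSolution M xi Φ → ∀ i : Fin 4, 2 ≤ i →
    ‖M.state xi Φ 0 i‖ ≤ Real.exp (C * ‖xi‖) * ∑ j, ‖M.state xi Φ (-M.H) j‖ := by
  obtain ⟨C, hC1, hC⟩ := M.exists_coefficient_bound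
  have hC0 : 0 ≤ C := by linarith
  refine ⟨2 * C * 13 * M.H + 1, by have := M.H_pos; positivity, fun xi Φ hxi hΦ i hi => ?_⟩
  set n := ‖xi‖ with hn
  have hn0 : 0 ≤ n := by linarith
  set s := M.state xi Φ with hs
  -- Weighting the displacements by ξ balances the ξ² in the equation for b: every entry of the
  -- rescaled generator is O(|ξ|). The weights are 1 on a and b, hence the restriction to i ≥ 2; the
  -- factor |ξ| that they cost at depth H is absorbed by |ξ| ≤ e^{|ξ|}.
  set θ : Fin 4 → ℂ := ![xi, xi, 1, 1] with hθ
  have hH := M.neg_H_neg.le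
  have key := norm_le_of_dissipative (f := fun i Z => θ i * s Z i)
    (r := fun i Z => θ i * (M.generator xi Z).mulVec (s Z) i) (κ := 0) (ε := 0)
    (a := -M.H) (b := 0) (C := 2 * C * n) (by positivity) le_rfl
    (fun i => by simp)
    (fun i => continuousOn_const.mul
      (continuousOn_pi.1 (hΦ.continuousOn_state.mono Icc_subset_Iic_self) i))
    (fun i t ht => by
      simpa using ((hasDerivAt_pi.1 (hΦ.hasDerivAt_state ht.2)) i).const_mul (θ i))
    (fun i t ht => by
      obtain ⟨b1, b2, b3, b4, b5⟩ := hC t (Ioo_subset_Icc_self ht)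
      have p0 := norm_nonneg (s t 0)
      have p1 := norm_nonneg (s t 1)
      have p2 := norm_nonneg (s t 2)
      have p3 := norm_nonneg (s t 3)
      have hCn : C ≤ C * n := le_mul_of_one_le_right hC0 hxi
      have hCn2 : n ≤ C * n := le_mul_of_one_le_left hn0 hC1
      have hCn3 : C ≤ C * n * n := hCn.trans (le_mul_of_one_le_right (by positivity) hxi)
      rw [M.generator_mulVec]
      simp only [add_zero, Fin.sum_univ_four, norm_mul, hθ]
      fin_cases i
      · simp only [Fin.zero_eta, Matrix.cons_val_zero, Matrix.cons_val_one, Matrix.cons_val, norm_one,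
          one_mul, ← hn]
        have h1 : ‖-(I * xi) * s t 1 + 1 / (M.mu t) * s t 3‖ ≤ n * ‖s t 1‖ + C * ‖s t 3‖ := by
          refine (norm_add_le _ _).trans ?_
          rw [norm_mul, norm_mul, norm_neg, norm_mul, norm_I, one_mul]
          gcongr
        have h2 : n * (n * ‖s t 1‖) ≤ C * n * (n * ‖s t 1‖) := by gcongr
        have h3 := mul_le_mul_of_nonneg_left h1 hn0
        have h4 : 0 ≤ C * n * (n * ‖s t 0‖) := by positivity
        have h5 : 0 ≤ C * n * (n * ‖s t 1‖) := by positivity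
        have h6 : 0 ≤ C * n * ‖s t 2‖ := by positivity
        have h7 : 0 ≤ C * n * ‖s t 3‖ := by positivity
        nlinarith
      · simp only [Fin.mk_one, Matrix.cons_val_zero, Matrix.cons_val_one, Matrix.cons_val, norm_one,
          one_mul, ← hn]
        have h1 : ‖-(I * xi * M.lam t / M.sig t) * s t 0 + 1 / (M.sig t) * s t 2‖ ≤
            n * C * ‖s t 0‖ + C * ‖s t 2‖ := by
          refine (norm_add_le _ _).trans ?_
          rw [norm_mul, norm_mul, norm_neg, mul_div_assoc, norm_mul, norm_mul, norm_I, one_mul]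
          gcongr
        have h3 := mul_le_mul_of_nonneg_left h1 hn0
        have h4 : 0 ≤ C * n * (n * ‖s t 0‖) := by positivity
        have h5 : 0 ≤ C * n * (n * ‖s t 1‖) := by positivity
        have h6 : 0 ≤ C * n * ‖s t 2‖ := by positivity
        have h7 : 0 ≤ C * n * ‖s t 3‖ := by positivity
        nlinarith
      · simp only [Fin.reduceFinMk, Matrix.cons_val_zero, Matrix.cons_val_one, Matrix.cons_val, norm_one,
          one_mul, ← hn]
        have h1 : ‖-(M.omega : ℂ) ^ 2 * s t 1 + -(I * xi) * s t 3‖ ≤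
            C * ‖s t 1‖ + n * ‖s t 3‖ := by
          refine (norm_add_le _ _).trans ?_
          rw [norm_mul, norm_mul, norm_neg, norm_neg, norm_mul, norm_I, one_mul]
          gcongr
        have h2 : C * ‖s t 1‖ ≤ C * n * n * ‖s t 1‖ := by gcongr
        have h3 : n * ‖s t 3‖ ≤ C * n * ‖s t 3‖ := by gcongr
        have h4 : 0 ≤ C * n * (n * ‖s t 0‖) := by positivity
        have h5 : 0 ≤ C * n * (n * ‖s t 1‖) := by positivity
        have h6 : 0 ≤ C * n * ‖s t 2‖ := by positivity
        have h7 : 0 ≤ C * n * ‖s t 3‖ := by positivity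
        nlinarith
      · simp only [Fin.reduceFinMk, Matrix.cons_val_zero, Matrix.cons_val_one, Matrix.cons_val, norm_one,
          one_mul, ← hn]
        have h1 : ‖((M.sig t - (M.lam t : ℂ) ^ 2 / M.sig t) * xi ^ 2 - (M.omega : ℂ) ^ 2) * s t 0
            + -(I * xi * M.lam t / M.sig t) * s t 2‖ ≤
            (C * n ^ 2 + C) * ‖s t 0‖ + n * C * ‖s t 2‖ := by
          refine (norm_add_le _ _).trans ?_
          rw [norm_mul, norm_mul, norm_neg, mul_div_assoc, norm_mul, norm_mul, norm_I, one_mul]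
          gcongr
          refine (norm_sub_le _ _).trans ?_
          rw [norm_mul, norm_pow]
          gcongr
        have h2 : C * ‖s t 0‖ ≤ C * n * n * ‖s t 0‖ := by gcongr
        have h4 : 0 ≤ C * n * (n * ‖s t 0‖) := by positivity
        have h5 : 0 ≤ C * n * (n * ‖s t 1‖) := by positivity
        have h6 : 0 ≤ C * n * ‖s t 2‖ := by positivity
        have h7 : 0 ≤ C * n * ‖s t 3‖ := by positivity
        nlinarith)
    0 (right_mem_Icc.2 hH) i
  have hθi : θ i = 1 := by
    fin_cases i <;> simp_all
  have hsum : ∑ j, ‖θ j * s (-M.H) j‖ ≤ n * ∑ j, ‖s (-M.H) j‖ := by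
    rw [Finset.mul_sum]
    refine Finset.sum_le_sum fun j _ => ?_
    rw [norm_mul]
    gcongr
    fin_cases j <;> simp [hθ, ← hn, hxi]
  have hexp : n ≤ Real.exp n := by linarith [Real.add_one_le_exp n]
  have e : 2 * C * n * (3 * ((Fintype.card (Fin 4) : ℕ) : ℝ) + 1) * (0 - -M.H) =
      2 * C * 13 * M.H * n := by
    rw [Fintype.card_fin]
    push_cast
    ring
  rw [hθi, one_mul, add_zero, e] at key
  calc ‖s 0 i‖ ≤ _ := key
    _ ≤ Real.exp (2 * C * 13 * M.H * n) * (Real.exp n * ∑ j, ‖s (-M.H) j‖) := by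
        refine mul_le_mul_of_nonneg_left (hsum.trans ?_) (Real.exp_nonneg _)
        gcongr
    _ = _ := by rw [← mul_assoc, ← Real.exp_add]; congr 2; ring

theorem exists_mode_bound {c : ℂ} {v : ℂ → ℂ → Fin 4 → ℂ}
    (hv : v = M.modeP ∨ v = M.modeS) : ∃ C : ℝ, 0 ≤ C ∧
    ∀ xi q : ℂ, 1 ≤ ‖xi‖ → q ^ 2 = c - xi ^ 2 →
      ∑ j, ‖(exp (I * M.H * q) • v xi q) j‖ ≤ C * Real.exp (C * ‖xi‖) := by
  have hH := M.H_pos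
  set d := ‖c‖ + 1 with hd
  have hd0 : 0 ≤ d := by positivity
  set B := d + 1 + (‖(M.omega : ℂ) ^ 2‖ + ‖2 * (M.muI : ℂ)‖) + ‖2 * (M.muI : ℂ)‖ * d with hB
  -- Here `B` bounds the entries relative to |ξ|², `M.H * d` comes from |e^{iHq}| with |q| ≤ d|ξ|,
  -- and 2 from |ξ|² ≤ e^{2|ξ|}.
  refine ⟨B + (M.H * d + 2), by positivity, fun xi q hxi hq => ?_⟩
  have hqn : ‖q‖ ≤ d * ‖xi‖ := norm_le_of_sq_eq hq hxi
  set n := ‖xi‖ with hn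
  have hn2 : n ≤ n ^ 2 := by nlinarith
  have h1n2 : 1 ≤ n ^ 2 := by nlinarith
  have h1 : ‖xi‖ ≤ n ^ 2 := hn2
  have h2 : ‖q‖ ≤ d * n ^ 2 := hqn.trans (by gcongr)
  have h3 : ‖(M.omega : ℂ) ^ 2 - 2 * M.muI * xi ^ 2‖ ≤
      (‖(M.omega : ℂ) ^ 2‖ + ‖2 * (M.muI : ℂ)‖) * n ^ 2 := by
    refine (norm_sub_le _ _).trans ?_
    rw [norm_mul _ (xi ^ 2), norm_pow xi, add_mul]
    gcongr
    exact le_mul_of_one_le_right (norm_nonneg _) h1n2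
  have h4 : ‖2 * (M.muI : ℂ) * xi * q‖ ≤ ‖2 * (M.muI : ℂ)‖ * d * n ^ 2 := by
    rw [norm_mul, norm_mul]
    calc _ ≤ ‖2 * (M.muI : ℂ)‖ * n * (d * n) := by gcongr
      _ = _ := by ring
  have h5 : ∑ j, ‖v xi q j‖ ≤ B * n ^ 2 := by
    have h6 : ‖2 * I * (M.muI : ℂ) * xi * q‖ = ‖2 * (M.muI : ℂ) * xi * q‖ := by
      rw [show 2 * I * (M.muI : ℂ) * xi * q = I * (2 * (M.muI : ℂ) * xi * q) by ring, norm_mul,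
        norm_I, one_mul]
    rw [Fin.sum_univ_four]
    rcases hv with rfl | rfl
    · have e0 : ‖M.modeP xi q 0‖ = ‖xi‖ := rfl
      have e1 : ‖M.modeP xi q 1‖ = ‖q‖ := norm_neg _
      have e2 : ‖M.modeP xi q 2‖ = ‖(M.omega : ℂ) ^ 2 - 2 * M.muI * xi ^ 2‖ :=
        (norm_mul _ _).trans (by rw [norm_I, one_mul])
      have e3 : ‖M.modeP xi q 3‖ = ‖2 * (M.muI : ℂ) * xi * q‖ := (norm_neg _).trans h6
      rw [e0, e1, e2, e3]
      linarith
    · have e0 : ‖M.modeS xi q 0‖ = ‖q‖ := norm_neg _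
      have e1 : ‖M.modeS xi q 1‖ = ‖xi‖ := norm_neg _
      have e2 : ‖M.modeS xi q 2‖ = ‖2 * (M.muI : ℂ) * xi * q‖ := h6
      have e3 : ‖M.modeS xi q 3‖ = ‖(M.omega : ℂ) ^ 2 - 2 * M.muI * xi ^ 2‖ :=
        (norm_mul _ _).trans (by rw [norm_I, one_mul])
      rw [e0, e1, e2, e3]
      linarith
  have h6 : ‖exp (I * M.H * q)‖ ≤ Real.exp (M.H * d * n) := by
    refine (norm_exp_le_exp_norm _).trans (Real.exp_le_exp.2 ?_)
    rw [norm_mul, norm_mul, norm_I, one_mul, norm_real, Real.norm_of_nonneg hH.le, mul_assoc]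
    gcongr
  have h7 : n ^ 2 ≤ Real.exp (2 * n) := by
    have : n ≤ Real.exp n := by linarith [Real.add_one_le_exp n]
    calc n ^ 2 ≤ Real.exp n ^ 2 := by gcongr
      _ = _ := by rw [← Real.exp_nat_mul]; norm_num
  have hB0 : 0 ≤ B := by positivity
  simp only [Pi.smul_apply, smul_eq_mul, norm_mul, ← Finset.mul_sum]
  calc _ ≤ Real.exp (M.H * d * n) * (B * Real.exp (2 * n)) := by
        gcongr
        exact h5.trans (by gcongr)
    _ = B * Real.exp ((M.H * d + 2) * n) := by
        rw [add_mul (M.H * d), Real.exp_add]; ring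
    _ ≤ _ := by
        have hMd : 0 ≤ M.H * d := by positivity
        refine mul_le_mul (by linarith) (Real.exp_le_exp.2 ?_) (Real.exp_nonneg _) (by positivity)
        exact mul_le_mul_of_nonneg_right (by linarith) (by linarith)

theorem exists_rayleighDet_bound : ∃ A α : ℝ, 0 ≤ A ∧ ∀ p : Surface M, 1 ≤ ‖p.xi‖ →
    ‖rayleighDet p‖ ≤ A * Real.exp (α * ‖p.xi‖) := by
  obtain ⟨C, hC0, hC⟩ := M.exists_state_bound
  obtain ⟨P, hP0, hP⟩ := M.exists_mode_bound (c := (M.omega : ℂ) ^ 2 / (M.lamI + 2 * M.muI))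
    (v := M.modeP) (Or.inl rfl)
  obtain ⟨S, hS0, hS⟩ := M.exists_mode_bound (c := (M.omega : ℂ) ^ 2 / M.muI)
    (v := M.modeS) (Or.inr rfl)
  refine ⟨2 * (P * S), C + P + (C + S), by positivity, fun p hp => ?_⟩
  obtain ⟨jP, jP'⟩ := jostP_spec p
  obtain ⟨jS, jS'⟩ := jostS_spec p
  have bP : ∀ i : Fin 4, 2 ≤ i → ‖M.state p.xi (jostP p) 0 i‖ ≤
      Real.exp (C * ‖p.xi‖) * (P * Real.exp (P * ‖p.xi‖)) := fun i hi =>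
    (hC _ _ hp jP i hi).trans (by rw [jP']; gcongr; exact hP _ _ hp p.qP_sq)
  have bS : ∀ i : Fin 4, 2 ≤ i → ‖M.state p.xi (jostS p) 0 i‖ ≤
      Real.exp (C * ‖p.xi‖) * (S * Real.exp (S * ‖p.xi‖)) := fun i hi =>
    (hC _ _ hp jS i hi).trans (by rw [jS']; gcongr; exact hS _ _ hp p.qS_sq)
  rw [rayleighDet_eq]
  refine (norm_sub_le _ _).trans ?_
  rw [norm_mul, norm_mul]
  have h2 : (2 : Fin 4) ≤ 2 := le_rfl
  have h3 : (2 : Fin 4) ≤ 3 := by decide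
  have t1 := mul_le_mul (bP 2 h2) (bS 3 h3) (norm_nonneg _) (by positivity)
  have t2 := mul_le_mul (bS 2 h2) (bP 3 h3) (norm_nonneg _) (by positivity)
  refine (add_le_add t1 t2).trans (le_of_eq ?_)
  rw [add_mul, add_mul, add_mul, Real.exp_add, Real.exp_add, Real.exp_add]
  ring

theorem isExponentialType_F : IsExponentialType (F M) := by
  obtain ⟨A, α, hA, h⟩ := M.exists_rayleighDet_bound
  refine ⟨M.differentiable_F, A ^ 4, 4 * α, 1, fun z hz => ?_⟩
  set p := Surface.physical M z with hp
  have hF : F M z = rayleighDet p * rayleighDet p.wP * rayleighDet p.wS * rayleighDet p.wPS := rfl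
  rw [hF, norm_mul, norm_mul, norm_mul]
  have b1 := h p hz
  have b2 := h p.wP hz
  have b3 := h p.wS hz
  have b4 := h p.wPS hz
  have e : 0 ≤ A * Real.exp (α * ‖z‖) := by positivity
  calc _ ≤ (A * Real.exp (α * ‖z‖)) * (A * Real.exp (α * ‖z‖)) * (A * Real.exp (α * ‖z‖))
        * (A * Real.exp (α * ‖z‖)) := by
        gcongr
        exacts [b1, b2, b3, b4]
    _ = A ^ 4 * Real.exp (α * ‖z‖) ^ 4 := by ring
    _ = _ := by rw [← Real.exp_nat_mul]; push_cast; ring_nf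

end Medium

/-! ### The transformed system and its exponential amplitudes

With `y = (y₁, y₂)` as in the Pekeris–Markushevich transform and `m = ½ M₁`, the field
`w = y' - m y` satisfies `y' = m y + w`, `w' = m w + ξ² y + N y`, where `'` is the derivative in
the depth `x = -Z` and `N = M₀ + ¼ M₁² - ½ M₁'`. Hence the amplitudes `D_± = w ± ξ y` satisfy
`D_±' = m D_± ± ξ D_± + N y`. -/

theorem mulVec_fin_two (A : Matrix (Fin 2) (Fin 2) ℂ) (v : Fin 2 → ℂ) (i : Fin 2) :
    A.mulVec v i = A i 0 * v 0 + A i 1 * v 1 := by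
  simp [Matrix.mulVec, dotProduct, Fin.sum_univ_two]

namespace Medium

variable (M : Medium)

/-- The first derivative of `mu` on `Z ≤ 0`. -/
def mu1 : ℝ → ℝ := derivWithin M.mu (Iic 0)

/-- The second derivative of `mu` on `Z ≤ 0`. -/
def mu2 : ℝ → ℝ := derivWithin M.mu1 (Iic 0)

/-- The third derivative of `mu` on `Z ≤ 0`. -/
def mu3 : ℝ → ℝ := derivWithin M.mu2 (Iic 0)

/-- The first derivative of `λ + 2 μ` on `Z ≤ 0`. -/
def sig1 : ℝ → ℝ := derivWithin M.sig (Iic 0)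

theorem mu1_contDiff : ContDiffOn ℝ 2 M.mu1 (Iic 0) :=
  M.mu_contDiff.derivWithin (uniqueDiffOn_Iic 0) (by norm_num)

theorem mu2_contDiff : ContDiffOn ℝ 1 M.mu2 (Iic 0) :=
  M.mu1_contDiff.derivWithin (uniqueDiffOn_Iic 0) (by norm_num)

theorem continuousOn_mu3 : ContinuousOn M.mu3 (Iic 0) :=
  (M.mu2_contDiff.derivWithin (m := 0) (uniqueDiffOn_Iic 0) (by norm_num)).continuousOn

theorem continuousOn_sig1 : ContinuousOn M.sig1 (Iic 0) :=
  (M.sig_contDiff.derivWithin (m := 0) (uniqueDiffOn_Iic 0) (by norm_num)).continuousOn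

theorem hasDerivAt_derivWithin {f : ℝ → ℝ} {n : WithTop ℕ∞} (hf : ContDiffOn ℝ n f (Iic 0))
    (hn : n ≠ 0) {Z : ℝ} (hZ : Z < 0) : HasDerivAt f (derivWithin f (Iic 0) Z) Z :=
  ((hf.differentiableOn hn) Z hZ.le).hasDerivWithinAt.hasDerivAt (Iic_mem_nhds hZ)

/-- The two-sided derivative at -H equals the left derivative, which is that of a constant. -/
theorem mu1_neg_H : M.mu1 (-M.H) = 0 := by
  have h1 : HasDerivAt M.mu (M.mu1 (-M.H)) (-M.H) :=
    hasDerivAt_derivWithin M.mu_contDiff (by norm_num) M.neg_H_neg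
  have h2 : HasDerivWithinAt M.mu 0 (Iic (-M.H)) (-M.H) :=
    (hasDerivWithinAt_const (-M.H) (Iic (-M.H)) (M.mu (-M.H))).congr_of_mem
      (fun Z hZ => M.mu_const Z hZ) self_mem_Iic
  exact (uniqueDiffOn_Iic (-M.H) _ self_mem_Iic).eq_deriv _ h1.hasDerivWithinAt h2

/-- The matrix `½ M₁` as a function of `Z`. -/
def m (Z : ℝ) : Matrix (Fin 2) (Fin 2) ℂ :=
  !![(M.mu1 Z : ℂ) / M.mu Z, 1 / 2 * (1 / M.mu Z - 1 / M.sig Z);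
     M.mu2 Z - 2 * (M.mu1 Z : ℂ) ^ 2 / M.mu Z, -((M.mu1 Z : ℂ) / M.mu Z)]

/-- The matrix `M₀ + ¼ M₁² - ½ M₁'` as a function of `Z`. -/
def N (Z : ℝ) : Matrix (Fin 2) (Fin 2) ℂ :=
  !![-((M.omega : ℂ) ^ 2 / M.mu Z), -(M.sig1 Z / (M.sig Z : ℂ) ^ 2) +
        2 * M.mu1 Z / (M.mu Z * M.sig Z);
     2 * (M.omega : ℂ) ^ 2 * M.mu1 Z / M.mu Z, -((M.omega : ℂ) ^ 2 / M.sig Z) +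
        2 * (M.mu2 Z - 2 * (M.mu1 Z : ℂ) ^ 2 / M.mu Z) / M.sig Z]
  + M.m Z * M.m Z
  + !![M.mu2 Z / M.mu Z - (M.mu1 Z : ℂ) ^ 2 / (M.mu Z : ℂ) ^ 2,
        1 / 2 * (-(M.mu1 Z / (M.mu Z : ℂ) ^ 2) + M.sig1 Z / (M.sig Z : ℂ) ^ 2);
      M.mu3 Z - 4 * M.mu1 Z * M.mu2 Z / M.mu Z + 2 * (M.mu1 Z : ℂ) ^ 3 / (M.mu Z : ℂ) ^ 2,
        -(M.mu2 Z / M.mu Z - (M.mu1 Z : ℂ) ^ 2 / (M.mu Z : ℂ) ^ 2)]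

theorem N_apply (Z : ℝ) (i j : Fin 2) : M.N Z i j =
    !![-((M.omega : ℂ) ^ 2 / M.mu Z), -(M.sig1 Z / (M.sig Z : ℂ) ^ 2) +
        2 * M.mu1 Z / (M.mu Z * M.sig Z);
     2 * (M.omega : ℂ) ^ 2 * M.mu1 Z / M.mu Z, -((M.omega : ℂ) ^ 2 / M.sig Z) +
        2 * (M.mu2 Z - 2 * (M.mu1 Z : ℂ) ^ 2 / M.mu Z) / M.sig Z] i j
    + (M.m Z i 0 * M.m Z 0 j + M.m Z i 1 * M.m Z 1 j)
    + !![M.mu2 Z / M.mu Z - (M.mu1 Z : ℂ) ^ 2 / (M.mu Z : ℂ) ^ 2,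
        1 / 2 * (-(M.mu1 Z / (M.mu Z : ℂ) ^ 2) + M.sig1 Z / (M.sig Z : ℂ) ^ 2);
      M.mu3 Z - 4 * M.mu1 Z * M.mu2 Z / M.mu Z + 2 * (M.mu1 Z : ℂ) ^ 3 / (M.mu Z : ℂ) ^ 2,
        -(M.mu2 Z / M.mu Z - (M.mu1 Z : ℂ) ^ 2 / (M.mu Z : ℂ) ^ 2)] i j := by
  simp only [N, Matrix.add_apply, Matrix.mul_apply, Fin.sum_univ_two]

/-- The field `y` of the Pekeris–Markushevich transform of a state. -/
def y (xi : ℂ) (Z : ℝ) (s : Fin 4 → ℂ) : Fin 2 → ℂ :=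
  ![-s 1 / xi, -(2 * I * M.mu Z * s 0) - s 2 / xi]

/-- The derivative `y'` in the depth variable. -/
def y' (xi : ℂ) (Z : ℝ) (s : Fin 4 → ℂ) : Fin 2 → ℂ :=
  ![-(I * s 0) - M.y xi Z s 1 / M.sig Z,
    2 * I * M.mu1 Z * s 0 + I * s 3 + (2 * M.mu Z * xi - (M.omega : ℂ) ^ 2 / xi) * s 1]

/-- The field `w = y' - ½ M₁ y`. -/
def w (xi : ℂ) (Z : ℝ) (s : Fin 4 → ℂ) : Fin 2 → ℂ :=
  M.y' xi Z s - (M.m Z).mulVec (M.y xi Z s)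

theorem w_apply (xi : ℂ) (Z : ℝ) (s : Fin 4 → ℂ) (i : Fin 2) :
    M.w xi Z s i = M.y' xi Z s i - (M.m Z i 0 * M.y xi Z s 0 + M.m Z i 1 * M.y xi Z s 1) := by
  rw [w, Pi.sub_apply, mulVec_fin_two]

/-- The amplitude `D₊ = w + ξ y`. -/
def ampP (xi : ℂ) (Z : ℝ) (s : Fin 4 → ℂ) : Fin 2 → ℂ := M.w xi Z s + xi • M.y xi Z s

/-- The amplitude `D₋ = w - ξ y`. -/
def ampM (xi : ℂ) (Z : ℝ) (s : Fin 4 → ℂ) : Fin 2 → ℂ := M.w xi Z s - xi • M.y xi Z s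

section Derivatives

variable {M} {xi : ℂ} {s : ℝ → Fin 4 → ℂ} {Z : ℝ}

/-- This is y' = ½M₁y + w, with a minus sign because the derivative is taken in Z = -x. The stress a
eliminates φ₃', which is why y and y' are functions of the state alone. -/
theorem hasDerivAt_y (hxi : xi ≠ 0) (hZ : Z < 0)
    (hs : HasDerivAt s ((M.generator xi Z).mulVec (s Z)) Z) :
    HasDerivAt (fun Z => M.y xi Z (s Z))
      (-((M.m Z).mulVec (M.y xi Z (s Z)) + M.w xi Z (s Z))) Z := by
  have hmu : HasDerivAt (fun Z => (M.mu Z : ℂ)) (M.mu1 Z) Z :=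
    (hasDerivAt_derivWithin M.mu_contDiff (by norm_num) hZ).ofReal_comp
  have m0 := M.mu_ne_zero hZ.le
  have s0 := M.sig_ne_zero hZ.le
  have hlam : (M.lam Z : ℂ) = M.sig Z - 2 * M.mu Z := by simp [sig]
  rw [M.generator_mulVec, hasDerivAt_pi] at hs
  rw [w, add_sub_cancel, hasDerivAt_pi]
  intro i
  fin_cases i
  · refine ((hs 1).neg.div_const xi).congr_deriv ?_
    simp [y', y, hlam]
    field_simp
    ring
  · refine ((((hmu.const_mul (2 * I)).mul (hs 0)).neg).sub ((hs 2).div_const xi)).congr_deriv ?_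
    simp [y']
    field_simp
    ring_nf
    simp only [I_sq]
    ring

/-- With m = ½M₁, inserting y'' = ξ²y + 2my' + M₀y into (y' - my)' leaves mw + ξ²y + (M₀ + m² -
m')y, and the last bracket is `N`. The proof checks this directly on the state. -/
theorem hasDerivAt_w (hxi : xi ≠ 0) (hZ : Z < 0)
    (hs : HasDerivAt s ((M.generator xi Z).mulVec (s Z)) Z) :
    HasDerivAt (fun Z => M.w xi Z (s Z))
      (-((M.m Z).mulVec (M.w xi Z (s Z)) + xi ^ 2 • M.y xi Z (s Z)
        + (M.N Z).mulVec (M.y xi Z (s Z)))) Z := by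
  have hmu : HasDerivAt (fun Z => (M.mu Z : ℂ)) (M.mu1 Z) Z :=
    (hasDerivAt_derivWithin M.mu_contDiff (by norm_num) hZ).ofReal_comp
  have hmu1 : HasDerivAt (fun Z => (M.mu1 Z : ℂ)) (M.mu2 Z) Z :=
    (hasDerivAt_derivWithin M.mu1_contDiff (by norm_num) hZ).ofReal_comp
  have hmu2 : HasDerivAt (fun Z => (M.mu2 Z : ℂ)) (M.mu3 Z) Z :=
    (hasDerivAt_derivWithin M.mu2_contDiff (by norm_num) hZ).ofReal_comp
  have hsig : HasDerivAt (fun Z => (M.sig Z : ℂ)) (M.sig1 Z) Z :=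
    (hasDerivAt_derivWithin M.sig_contDiff (by norm_num) hZ).ofReal_comp
  have m0 := M.mu_ne_zero hZ.le
  have s0 := M.sig_ne_zero hZ.le
  -- λ is eliminated, so that μ, λ + 2μ and their derivatives are the only coefficients in the
  -- identity.
  have hlam : (M.lam Z : ℂ) = M.sig Z - 2 * M.mu Z := by simp [sig]
  have hy := hasDerivAt_pi.1 (hasDerivAt_y hxi hZ hs)
  have hy0 := hy 0
  have hy1 := hy 1
  rw [M.generator_mulVec, hasDerivAt_pi] at hs
  have hs0 := hs 0
  have hs1 := hs 1
  have hs3 := hs 3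
  have h11 := hmu1.div hmu m0
  have h12 := (((hasDerivAt_const Z (1 : ℂ)).div hmu m0).sub
    ((hasDerivAt_const Z (1 : ℂ)).div hsig s0)).const_mul (1 / 2 : ℂ)
  have h21 := hmu2.sub (((hmu1.pow 2).const_mul (2 : ℂ)).div hmu m0)
  rw [hasDerivAt_pi]
  intro i
  fin_cases i
  · have h := (((hs0.const_mul I).neg).sub (hy1.div hsig s0)).sub
      ((h11.mul hy0).add (h12.mul hy1))
    refine (h.congr_deriv ?_).congr_of_eventuallyEq (.of_forall fun t => ?_)
    · simp only [Fin.zero_eta, Pi.neg_apply, Pi.add_apply, Pi.smul_apply,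
        mulVec_fin_two, N_apply, w_apply]
      simp [y', y, m, hlam]
      field_simp
      ring_nf
      simp only [I_sq]
      ring
    · simp only [Fin.zero_eta, w_apply]
      simp [y', m]
  · have h := (((hmu1.const_mul (2 * I)).mul hs0).add (hs3.const_mul I)).add
      (((((hmu.const_mul (2 : ℂ)).mul_const xi).sub_const ((M.omega : ℂ) ^ 2 / xi))).mul hs1)
    have h' := h.sub ((h21.mul hy0).add (h11.neg.mul hy1))
    refine (h'.congr_deriv ?_).congr_of_eventuallyEq (.of_forall fun t => ?_)
    · simp only [Fin.mk_one, Pi.neg_apply, Pi.add_apply, Pi.smul_apply,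
        mulVec_fin_two, N_apply, w_apply]
      simp [y', y, m, hlam]
      field_simp
      ring_nf
      simp only [I_sq]
      ring
    · simp only [Fin.mk_one, w_apply]
      simp [y', m]

/-- Adding ξ times the equation for y to that for w combines ξ²y + ξw into ξD₊. This diagonalizes
the terms that grow with ξ. -/
theorem hasDerivAt_ampP (hxi : xi ≠ 0) (hZ : Z < 0)
    (hs : HasDerivAt s ((M.generator xi Z).mulVec (s Z)) Z) :
    HasDerivAt (fun Z => M.ampP xi Z (s Z))
      (-((M.m Z).mulVec (M.ampP xi Z (s Z)) + xi • M.ampP xi Z (s Z)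
        + (M.N Z).mulVec (M.y xi Z (s Z)))) Z := by
  refine ((hasDerivAt_w hxi hZ hs).add ((hasDerivAt_y hxi hZ hs).const_smul xi)).congr_deriv ?_
  simp only [ampP, Matrix.mulVec_add, Matrix.mulVec_smul]
  module

theorem hasDerivAt_ampM (hxi : xi ≠ 0) (hZ : Z < 0)
    (hs : HasDerivAt s ((M.generator xi Z).mulVec (s Z)) Z) :
    HasDerivAt (fun Z => M.ampM xi Z (s Z))
      (-((M.m Z).mulVec (M.ampM xi Z (s Z)) - xi • M.ampM xi Z (s Z)
        + (M.N Z).mulVec (M.y xi Z (s Z)))) Z := by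
  refine ((hasDerivAt_w hxi hZ hs).sub ((hasDerivAt_y hxi hZ hs).const_smul xi)).congr_deriv ?_
  simp only [ampM, Matrix.mulVec_sub, Matrix.mulVec_smul]
  module

end Derivatives

end Medium

namespace Medium

variable (M : Medium)

/-! ### Bounds for the amplitudes -/

theorem continuousOn_m (i j : Fin 2) : ContinuousOn (fun Z => M.m Z i j) (Iic 0) := by
  have h0 := M.mu_contDiff_ofReal.continuousOn
  have h1 : ContinuousOn (fun Z => (M.mu1 Z : ℂ)) (Iic 0) :=
    continuous_ofReal.comp_continuousOn M.mu1_contDiff.continuousOn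
  have h2 : ContinuousOn (fun Z => (M.mu2 Z : ℂ)) (Iic 0) :=
    continuous_ofReal.comp_continuousOn M.mu2_contDiff.continuousOn
  have hs := M.sig_contDiff_ofReal.continuousOn
  have n0 : ∀ Z ∈ Iic (0 : ℝ), (M.mu Z : ℂ) ≠ 0 := fun Z hZ => M.mu_ne_zero hZ
  have ns : ∀ Z ∈ Iic (0 : ℝ), (M.sig Z : ℂ) ≠ 0 := fun Z hZ => M.sig_ne_zero hZ
  fin_cases i <;> fin_cases j <;> simp only [m, Fin.zero_eta, Fin.mk_one, Matrix.of_apply,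
    Matrix.cons_val_zero, Matrix.cons_val_one, Matrix.cons_val_fin_one] <;>
    fun_prop (disch := assumption)

/-- `N` contains μ''' and the first derivative of λ + 2μ: here the assumptions μ ∈ C³ and λ ∈ C¹ are
used in full. -/
theorem continuousOn_N (i j : Fin 2) : ContinuousOn (fun Z => M.N Z i j) (Iic 0) := by
  have h0 := M.mu_contDiff_ofReal.continuousOn
  have h1 : ContinuousOn (fun Z => (M.mu1 Z : ℂ)) (Iic 0) :=
    continuous_ofReal.comp_continuousOn M.mu1_contDiff.continuousOn
  have h2 : ContinuousOn (fun Z => (M.mu2 Z : ℂ)) (Iic 0) :=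
    continuous_ofReal.comp_continuousOn M.mu2_contDiff.continuousOn
  have h3 : ContinuousOn (fun Z => (M.mu3 Z : ℂ)) (Iic 0) :=
    continuous_ofReal.comp_continuousOn M.continuousOn_mu3
  have hs := M.sig_contDiff_ofReal.continuousOn
  have hs1 : ContinuousOn (fun Z => (M.sig1 Z : ℂ)) (Iic 0) :=
    continuous_ofReal.comp_continuousOn M.continuousOn_sig1
  have n0 : ∀ Z ∈ Iic (0 : ℝ), (M.mu Z : ℂ) ≠ 0 := fun Z hZ => M.mu_ne_zero hZ
  have ns : ∀ Z ∈ Iic (0 : ℝ), (M.sig Z : ℂ) ≠ 0 := fun Z hZ => M.sig_ne_zero hZ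
  have n0' : ∀ Z ∈ Iic (0 : ℝ), (M.mu Z : ℂ) ^ 2 ≠ 0 := fun Z hZ => pow_ne_zero 2 (n0 Z hZ)
  have ns' : ∀ Z ∈ Iic (0 : ℝ), (M.sig Z : ℂ) ^ 2 ≠ 0 := fun Z hZ => pow_ne_zero 2 (ns Z hZ)
  have n1 : ∀ Z ∈ Iic (0 : ℝ), (M.mu Z : ℂ) * M.sig Z ≠ 0 :=
    fun Z hZ => mul_ne_zero (n0 Z hZ) (ns Z hZ)
  have hm : ∀ i j, ContinuousOn (fun Z => M.m Z i j) (Iic 0) := M.continuousOn_m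
  simp only [N_apply]
  refine ((?_ : ContinuousOn _ _).add (((hm i 0).mul (hm 0 j)).add ((hm i 1).mul (hm 1 j)))).add ?_
  all_goals
    fin_cases i <;> fin_cases j <;> simp only [Fin.zero_eta, Fin.mk_one, Matrix.of_apply,
      Matrix.cons_val', Matrix.cons_val_zero, Matrix.cons_val_one, Matrix.cons_val_fin_one] <;>
      fun_prop (disch := assumption)

/-- A common bound on `[-H, 0]` for the entries of `½ M₁` and of `M₀ + ¼ M₁² - ½ M₁'`. -/
theorem exists_matrix_bound : ∃ C : ℝ, 0 ≤ C ∧ ∀ Z ∈ Icc (-M.H) 0, ∀ i j,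
    ‖M.m Z i j‖ ≤ C ∧ ‖M.N Z i j‖ ≤ C := by
  choose Cm hm using fun i j => isCompact_Icc.exists_bound_of_continuousOn
    ((M.continuousOn_m i j).mono (Icc_subset_Iic_self (a := -M.H)))
  choose Cn hn using fun i j => isCompact_Icc.exists_bound_of_continuousOn
    ((M.continuousOn_N i j).mono (Icc_subset_Iic_self (a := -M.H)))
  refine ⟨∑ i, ∑ j, (|Cm i j| + |Cn i j|), by positivity, fun Z hZ i j => ?_⟩
  have h1 : |Cm i j| + |Cn i j| ≤ ∑ i, ∑ j, (|Cm i j| + |Cn i j|) :=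
    (Finset.single_le_sum (f := fun j => |Cm i j| + |Cn i j|) (fun _ _ => by positivity)
      (Finset.mem_univ j)).trans
    (Finset.single_le_sum (f := fun i => ∑ j, (|Cm i j| + |Cn i j|)) (fun _ _ => by positivity)
      (Finset.mem_univ i))
  have h2 := abs_nonneg (Cm i j)
  have h3 := abs_nonneg (Cn i j)
  exact ⟨(hm i j Z hZ).trans (by linarith [le_abs_self (Cm i j)]),
    (hn i j Z hZ).trans (by linarith [le_abs_self (Cn i j)])⟩

theorem norm_mulVec_le {A : Matrix (Fin 2) (Fin 2) ℂ} {C : ℝ} (hA : ∀ i j, ‖A i j‖ ≤ C)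
    (v : Fin 2 → ℂ) (i : Fin 2) : ‖A.mulVec v i‖ ≤ C * (‖v 0‖ + ‖v 1‖) := by
  rw [mulVec_fin_two, mul_add]
  refine (norm_add_le _ _).trans ?_
  rw [norm_mul, norm_mul]
  gcongr <;> exact hA _ _

variable {M}

theorem two_mul_xi_mul_y (xi : ℂ) (Z : ℝ) (s : Fin 4 → ℂ) (i : Fin 2) :
    2 * xi * M.y xi Z s i = M.ampP xi Z s i - M.ampM xi Z s i := by
  simp [ampP, ampM]
  ring

/-- This gain of 1/|ξ| makes the coupling of D₊ and D₋ through `N` a lower-order effect. -/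
theorem norm_y_le (xi : ℂ) (Z : ℝ) (s : Fin 4 → ℂ) (i : Fin 2) :
    2 * ‖xi‖ * ‖M.y xi Z s i‖ ≤ ‖M.ampP xi Z s i‖ + ‖M.ampM xi Z s i‖ := by
  have := norm_sub_le (M.ampP xi Z s i) (M.ampM xi Z s i)
  rw [← two_mul_xi_mul_y, norm_mul, norm_mul] at this
  simpa using this

theorem continuousOn_amp {xi : ℂ} {s : ℝ → Fin 4 → ℂ} (hs : ContinuousOn s (Iic 0)) (i : Fin 2) :
    ContinuousOn (fun Z => M.ampP xi Z (s Z) i) (Iic 0) ∧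
      ContinuousOn (fun Z => M.ampM xi Z (s Z) i) (Iic 0) := by
  have h0 := M.mu_contDiff_ofReal.continuousOn
  have h1 : ContinuousOn (fun Z => (M.mu1 Z : ℂ)) (Iic 0) :=
    continuous_ofReal.comp_continuousOn M.mu1_contDiff.continuousOn
  have hg := M.sig_contDiff_ofReal.continuousOn
  have ns : ∀ Z ∈ Iic (0 : ℝ), (M.sig Z : ℂ) ≠ 0 := fun Z hZ => M.sig_ne_zero hZ
  have hsi := continuousOn_pi.1 hs
  have hy : ∀ i, ContinuousOn (fun Z => M.y xi Z (s Z) i) (Iic 0) := by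
    intro i
    fin_cases i
    · exact (hsi 1).neg.div_const xi
    · exact (((continuousOn_const (c := 2 * I)).mul h0).mul (hsi 0)).neg.sub ((hsi 2).div_const xi)
  have hy' : ∀ i, ContinuousOn (fun Z => M.y' xi Z (s Z) i) (Iic 0) := by
    intro i
    fin_cases i
    · exact ((continuousOn_const (c := I)).mul (hsi 0)).neg.sub ((hy 1).div hg ns)
    · exact ((((continuousOn_const (c := 2 * I)).mul h1).mul (hsi 0)).add
        ((continuousOn_const (c := I)).mul (hsi 3))).add
        (((((continuousOn_const (c := 2)).mul h0).mul continuousOn_const).sub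
          continuousOn_const).mul (hsi 1))
  have hw : ContinuousOn (fun Z => M.w xi Z (s Z) i) (Iic 0) := by
    simp only [w_apply]
    exact (hy' i).sub (((M.continuousOn_m i 0).mul (hy 0)).add ((M.continuousOn_m i 1).mul (hy 1)))
  exact ⟨hw.add (continuousOn_const.mul (hy i)), hw.sub (continuousOn_const.mul (hy i))⟩

/-- An integrating factor normalized to 1 at the base point a. -/
theorem hasDerivAt_cexp_mul {f : ℝ → ℂ} {f' c : ℂ} {a Z : ℝ} (hf : HasDerivAt f f' Z) :
    HasDerivAt (fun Z : ℝ => exp (c * (Z - a : ℝ)) * f Z)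
      (exp (c * (Z - a : ℝ)) * (c * f Z + f')) Z := by
  have h1 : HasDerivAt (fun Z : ℝ => c * ((Z - a : ℝ) : ℂ)) (c * ((1 : ℝ) : ℂ)) Z :=
    (((hasDerivAt_id Z).sub_const a).ofReal_comp).const_mul c
  refine (h1.cexp.mul hf).congr_deriv ?_
  push_cast
  ring

variable (M)

/-- With a weight `θ ∈ [1 / |ξ|, |ξ|]` on `D₊`, the amplitudes grow at most like `e^{Re ξ (Z + H)}`. -/
theorem exists_weighted_amp_bound : ∃ K : ℝ, 0 ≤ K ∧ ∀ (xi : ℂ) (Φ : ℝ → ℂ × ℂ) (θ : ℝ),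
    1 ≤ ‖xi‖ → 0 ≤ xi.re → 1 ≤ θ * ‖xi‖ → θ ≤ ‖xi‖ → IsRayleighSolution M xi Φ →
    ∀ Z ∈ Icc (-M.H) 0, ∀ i,
      θ * ‖M.ampP xi Z (M.state xi Φ Z) i‖ ≤ K * Real.exp (xi.re * (Z + M.H)) *
        (θ * ∑ j, ‖M.ampP xi (-M.H) (M.state xi Φ (-M.H)) j‖
          + ∑ j, ‖M.ampM xi (-M.H) (M.state xi Φ (-M.H)) j‖) ∧
      ‖M.ampM xi Z (M.state xi Φ Z) i‖ ≤ K * Real.exp (xi.re * (Z + M.H)) *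
        (θ * ∑ j, ‖M.ampP xi (-M.H) (M.state xi Φ (-M.H)) j‖
          + ∑ j, ‖M.ampM xi (-M.H) (M.state xi Φ (-M.H)) j‖) := by
  obtain ⟨C, hC0, hC⟩ := M.exists_matrix_bound
  have hH := M.H_pos
  refine ⟨Real.exp (2 * C * 13 * M.H), by positivity, fun xi Φ θ hxi hre hθ1 hθ2 hΦ Z hZ => ?_⟩
  have hn : 0 < ‖xi‖ := by linarith
  have hxi0 : xi ≠ 0 := norm_pos_iff.1 hn
  have hθ : 0 < θ := by
    by_contra h
    nlinarith
  set P : ℝ → Fin 2 → ℂ := fun Z => M.ampP xi Z (M.state xi Φ Z) with hP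
  set Q : ℝ → Fin 2 → ℂ := fun Z => M.ampM xi Z (M.state xi Φ Z) with hQ
  set Y : ℝ → Fin 2 → ℂ := fun Z => M.y xi Z (M.state xi Φ Z) with hY
  -- Removing the growth e^{ξ(Z+H)} of D₋ leaves no large term in its equation and the damping -2ξ
  -- in that of D₊, which is dissipative because Re ξ ≥ 0.
  set E : ℝ → ℂ := fun Z => exp (-xi * (Z - -M.H : ℝ)) with hE
  have hEc : Continuous E := by fun_prop
  have hcP := fun i => ((continuousOn_amp (M := M) (xi := xi) hΦ.continuousOn_state i).1).mono
    (Icc_subset_Iic_self (a := -M.H))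
  have hcQ := fun i => ((continuousOn_amp (M := M) (xi := xi) hΦ.continuousOn_state i).2).mono
    (Icc_subset_Iic_self (a := -M.H))
  -- The two limits on θ are used here. θ ≥ 1/|ξ| bounds the source of D₋ by the weighted norm, and
  -- θ ≤ |ξ| does so for the weighted source of D₊.
  have hYle : ∀ t i, ‖Y t i‖ ≤ θ * ‖P t i‖ + ‖Q t i‖ ∧ θ * ‖Y t i‖ ≤ θ * ‖P t i‖ + ‖Q t i‖ := by
    intro t i
    have h1 : 2 * ‖xi‖ * ‖Y t i‖ ≤ ‖P t i‖ + ‖Q t i‖ := norm_y_le xi t _ i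
    have hp := norm_nonneg (P t i)
    have hq := norm_nonneg (Q t i)
    have hy := norm_nonneg (Y t i)
    have h2 : ‖P t i‖ ≤ θ * ‖xi‖ * ‖P t i‖ := le_mul_of_one_le_left hp hθ1
    have h3 : ‖Q t i‖ ≤ ‖xi‖ * ‖Q t i‖ := le_mul_of_one_le_left hq hxi
    have h4 : ‖Y t i‖ ≤ θ * ‖P t i‖ + ‖Q t i‖ := by
      have : ‖xi‖ * ‖Y t i‖ ≤ ‖xi‖ * (θ * ‖P t i‖ + ‖Q t i‖) := by nlinarith
      exact le_of_mul_le_mul_left this hn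
    refine ⟨h4, ?_⟩
    have h5 : θ * ‖Y t i‖ ≤ ‖xi‖ * ‖Y t i‖ := by gcongr
    have h6 : ‖P t i‖ + ‖Q t i‖ = 2 * ((‖P t i‖ + ‖Q t i‖) / 2) := by ring
    by_cases h : θ ≤ 1
    · calc θ * ‖Y t i‖ ≤ 1 * ‖Y t i‖ := by gcongr
        _ ≤ _ := by rw [one_mul]; exact h4
    · have : ‖P t i‖ ≤ θ * ‖P t i‖ := le_mul_of_one_le_left hp (by linarith)
      nlinarith
  have key := norm_le_of_dissipative (ι := Fin 2 ⊕ Fin 2) (a := -M.H) (b := 0) (C := 2 * C) (ε := 0)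
    (f := Sum.elim (fun i Z => (θ : ℂ) * (E Z * P Z i)) (fun i Z => E Z * Q Z i))
    (r := Sum.elim
      (fun i Z => (θ : ℂ) * (E Z * -((M.m Z).mulVec (P Z) i + (M.N Z).mulVec (Y Z) i)))
      (fun i Z => E Z * -((M.m Z).mulVec (Q Z) i + (M.N Z).mulVec (Y Z) i)))
    (κ := Sum.elim (fun _ => 2 * xi) (fun _ => 0)) (by positivity) le_rfl
    (by rintro (i | i) <;> simp [hre])
    (by
      rintro (i | i)
      · exact continuousOn_const.mul (hEc.continuousOn.mul (hcP i))
      · exact hEc.continuousOn.mul (hcQ i))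
    (by
      rintro (i | i) t ht
      · have h1 := (hasDerivAt_pi.1 (hasDerivAt_ampP hxi0 ht.2 (hΦ.hasDerivAt_state ht.2))) i
        refine ((hasDerivAt_cexp_mul (c := -xi) (a := -M.H) h1).const_mul (θ : ℂ)).congr_deriv ?_
        simp only [Sum.elim_inl, Pi.neg_apply, Pi.add_apply, Pi.smul_apply, smul_eq_mul, hP, hY, hE]
        ring
      · have h1 := (hasDerivAt_pi.1 (hasDerivAt_ampM hxi0 ht.2 (hΦ.hasDerivAt_state ht.2))) i
        refine (hasDerivAt_cexp_mul (c := -xi) (a := -M.H) h1).congr_deriv ?_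
        simp only [Sum.elim_inr, Pi.neg_apply, Pi.add_apply, Pi.sub_apply, Pi.smul_apply, smul_eq_mul,
          hQ, hY, hE]
        ring)
    (by
      intro i t ht
      have hb := hC t (Ioo_subset_Icc_self ht)
      have hN := norm_mulVec_le (fun i j => (hb i j).2) (Y t)
      have hmP := norm_mulVec_le (fun i j => (hb i j).1) (P t)
      have hmQ := norm_mulVec_le (fun i j => (hb i j).1) (Q t)
      simp only [Fintype.sum_sum_type, Sum.elim_inl, Sum.elim_inr, Fin.sum_univ_two, norm_mul,
        norm_real, Real.norm_of_nonneg hθ.le, add_zero]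
      have e0 := norm_nonneg (E t)
      have y0 := hYle t 0
      have y1 := hYle t 1
      have p0 : 0 ≤ θ * ‖P t 0‖ := by positivity
      have p1 : 0 ≤ θ * ‖P t 1‖ := by positivity
      have q0 := norm_nonneg (Q t 0)
      have q1 := norm_nonneg (Q t 1)
      rcases i with i | i
      · simp only [Sum.elim_inl, norm_mul, norm_neg, norm_real, Real.norm_of_nonneg hθ.le]
        have h1 : θ * ‖(M.m t).mulVec (P t) i + (M.N t).mulVec (Y t) i‖ ≤
            2 * C * (θ * ‖P t 0‖ + θ * ‖P t 1‖ + (‖Q t 0‖ + ‖Q t 1‖)) := by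
          calc _ ≤ θ * (C * (‖P t 0‖ + ‖P t 1‖) + C * (‖Y t 0‖ + ‖Y t 1‖)) := by
                gcongr
                exact (norm_add_le _ _).trans (add_le_add (hmP i) (hN i))
            _ = C * (θ * ‖P t 0‖ + θ * ‖P t 1‖ + (θ * ‖Y t 0‖ + θ * ‖Y t 1‖)) := by ring
            _ ≤ C * (2 * (θ * ‖P t 0‖ + θ * ‖P t 1‖ + (‖Q t 0‖ + ‖Q t 1‖))) := by
                gcongr
                linarith [y0.2, y1.2]
            _ = _ := by ring
        calc _ = ‖E t‖ * (θ * ‖(M.m t).mulVec (P t) i + (M.N t).mulVec (Y t) i‖) := by ring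
          _ ≤ ‖E t‖ * _ := mul_le_mul_of_nonneg_left h1 e0
          _ = _ := by ring
      · simp only [Sum.elim_inr, norm_mul, norm_neg]
        have h1 : ‖(M.m t).mulVec (Q t) i + (M.N t).mulVec (Y t) i‖ ≤
            2 * C * (θ * ‖P t 0‖ + θ * ‖P t 1‖ + (‖Q t 0‖ + ‖Q t 1‖)) := by
          calc _ ≤ C * (‖Q t 0‖ + ‖Q t 1‖) + C * (‖Y t 0‖ + ‖Y t 1‖) :=
                (norm_add_le _ _).trans (add_le_add (hmQ i) (hN i))
            _ = C * (‖Q t 0‖ + ‖Q t 1‖ + (‖Y t 0‖ + ‖Y t 1‖)) := by ring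
            _ ≤ C * (2 * (θ * ‖P t 0‖ + θ * ‖P t 1‖ + (‖Q t 0‖ + ‖Q t 1‖))) := by
                gcongr
                linarith [y0.1, y1.1]
            _ = _ := by ring
        calc _ ≤ ‖E t‖ * _ := mul_le_mul_of_nonneg_left h1 e0
          _ = _ := by ring)
    Z hZ
  have hE0 : E (-M.H) = 1 := by simp [hE]
  have hEn : ‖E Z‖ * Real.exp (xi.re * (Z + M.H)) = 1 := by
    rw [hE, norm_exp, ← Real.exp_add]
    simp
  have hexp : Real.exp (2 * C * (3 * ((Fintype.card (Fin 2 ⊕ Fin 2) : ℕ) : ℝ) + 1) * (Z - -M.H)) ≤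
      Real.exp (2 * C * 13 * M.H) := by
    refine Real.exp_le_exp.2 ?_
    rw [Fintype.card_sum, Fintype.card_fin]
    push_cast
    have : 2 * C * 13 * (Z + M.H) ≤ 2 * C * 13 * M.H := by
      gcongr
      linarith [hZ.2]
    linarith
  simp only [Fintype.sum_sum_type, Sum.elim_inl, Sum.elim_inr, norm_mul, norm_real,
    Real.norm_of_nonneg hθ.le, add_zero, hE0, one_mul, ← Finset.mul_sum] at key
  set S := θ * ∑ j, ‖P (-M.H) j‖ + ∑ j, ‖Q (-M.H) j‖ with hS
  have hS0 : 0 ≤ S := by positivity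
  have fin : ∀ x : ℝ, ‖E Z‖ * x ≤
      Real.exp (2 * C * (3 * ((Fintype.card (Fin 2 ⊕ Fin 2) : ℕ) : ℝ) + 1) * (Z - -M.H)) * S →
      x ≤ Real.exp (2 * C * 13 * M.H) * Real.exp (xi.re * (Z + M.H)) * S := by
    intro x hx
    calc x = ‖E Z‖ * Real.exp (xi.re * (Z + M.H)) * x := by rw [hEn, one_mul]
      _ = Real.exp (xi.re * (Z + M.H)) * (‖E Z‖ * x) := by ring
      _ ≤ Real.exp (xi.re * (Z + M.H)) * (Real.exp (2 * C * 13 * M.H) * S) := by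
          refine mul_le_mul_of_nonneg_left (hx.trans ?_) (Real.exp_nonneg _)
          gcongr
      _ = _ := by ring
  intro i
  refine ⟨fin _ ?_, fin _ ?_⟩
  · have := key (Sum.inl i)
    simp only [Sum.elim_inl, norm_mul, norm_real, Real.norm_of_nonneg hθ.le] at this
    linarith
  · have := key (Sum.inr i)
    simpa only [Sum.elim_inr, norm_mul] using this

end Medium

/-! ### The decaying amplitude, the boundary data and the incident waves -/

namespace Medium

variable (M : Medium)

/-- A bound for `D₊` at the surface that uses the smallness of its source term. -/
theorem exists_ampP_bound : ∃ K : ℝ, 0 ≤ K ∧ ∀ (xi : ℂ) (Φ : ℝ → ℂ × ℂ) (X : ℝ),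
    1 ≤ ‖xi‖ → 0 ≤ xi.re → 0 ≤ X → IsRayleighSolution M xi Φ →
    (∀ Z ∈ Icc (-M.H) 0, ∀ i,
      ‖M.ampM xi Z (M.state xi Φ Z) i‖ ≤ X * Real.exp (xi.re * (Z + M.H))) →
    ∀ i, ‖M.ampP xi 0 (M.state xi Φ 0) i‖ ≤ K * Real.exp (-(xi.re * M.H)) *
      (∑ j, ‖M.ampP xi (-M.H) (M.state xi Φ (-M.H)) j‖
        + X * Real.exp (2 * xi.re * M.H) / ‖xi‖) := by
  obtain ⟨C, hC0, hC⟩ := M.exists_matrix_bound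
  have hH := M.H_pos
  refine ⟨Real.exp (2 * C * 7 * M.H), by positivity, fun xi Φ X hxi hre hX hΦ hQ i => ?_⟩
  have hn : 0 < ‖xi‖ := by linarith
  have hxi0 : xi ≠ 0 := norm_pos_iff.1 hn
  -- After multiplication by e^{ξ(Z+H)}, which removes the decay of D₊, the part of y due to D₋ is
  -- at most X e^{2 Re ξ (Z+H)}/(2|ξ|). Its maximum is at Z = 0, and each of the two components
  -- contributes ε/2.
  set ε := X * Real.exp (2 * xi.re * M.H) / ‖xi‖ with hε
  have hε0 : 0 ≤ ε := by positivity
  set P : ℝ → Fin 2 → ℂ := fun Z => M.ampP xi Z (M.state xi Φ Z) with hP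
  set Q : ℝ → Fin 2 → ℂ := fun Z => M.ampM xi Z (M.state xi Φ Z) with hQ'
  set Y : ℝ → Fin 2 → ℂ := fun Z => M.y xi Z (M.state xi Φ Z) with hY
  set E : ℝ → ℂ := fun Z => exp (xi * (Z - -M.H : ℝ)) with hE
  have hEc : Continuous E := by fun_prop
  have hEn : ∀ Z, ‖E Z‖ = Real.exp (xi.re * (Z + M.H)) := fun Z => by
    rw [hE, norm_exp]
    simp
  have hcP := fun i => ((continuousOn_amp (M := M) (xi := xi) hΦ.continuousOn_state i).1).mono
    (Icc_subset_Iic_self (a := -M.H))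
  have key := norm_le_of_dissipative (a := -M.H) (b := 0) (C := 2 * C) (ε := ε)
    (f := fun i Z => E Z * P Z i)
    (r := fun i Z => E Z * -((M.m Z).mulVec (P Z) i + (M.N Z).mulVec (Y Z) i))
    (κ := fun _ => 0) (by positivity) hε0 (by simp) (fun i => hEc.continuousOn.mul (hcP i))
    (fun i t ht => by
      have h1 := (hasDerivAt_pi.1 (hasDerivAt_ampP hxi0 ht.2 (hΦ.hasDerivAt_state ht.2))) i
      refine (hasDerivAt_cexp_mul (c := xi) (a := -M.H) h1).congr_deriv ?_
      simp only [Pi.neg_apply, Pi.add_apply, Pi.smul_apply, smul_eq_mul, hP, hY, hE]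
      ring)
    (fun i t ht => by
      have hb := hC t (Ioo_subset_Icc_self ht)
      have hN := norm_mulVec_le (fun i j => (hb i j).2) (Y t) i
      have hmP := norm_mulVec_le (fun i j => (hb i j).1) (P t) i
      have e0 := norm_nonneg (E t)
      have hYle : ∀ j, ‖E t‖ * ‖Y t j‖ ≤ ‖E t‖ * ‖P t j‖ + ε / 2 := by
        intro j
        have h1 : 2 * ‖xi‖ * ‖Y t j‖ ≤ ‖P t j‖ + ‖Q t j‖ := norm_y_le xi t _ j
        have h2 : ‖E t‖ * ‖Q t j‖ ≤ ε * ‖xi‖ := by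
          rw [hε, div_mul_cancel₀ _ hn.ne', hEn]
          calc _ ≤ Real.exp (xi.re * (t + M.H)) * (X * Real.exp (xi.re * (t + M.H))) := by
                gcongr
                exact hQ t (Ioo_subset_Icc_self ht) j
            _ = X * Real.exp (2 * (xi.re * (t + M.H))) := by
                rw [two_mul, Real.exp_add]
                ring
            _ ≤ _ := by
                gcongr X * Real.exp ?_
                nlinarith [mul_nonneg hre (neg_nonneg.2 ht.2.le)]
        have h3 : 0 ≤ ‖E t‖ * ‖P t j‖ := by positivity
        have h4 : ‖E t‖ * ‖P t j‖ ≤ ‖xi‖ * (‖E t‖ * ‖P t j‖) := le_mul_of_one_le_left h3 hxi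
        have h5 := mul_le_mul_of_nonneg_left h1 e0
        have h6 : ‖xi‖ * (2 * (‖E t‖ * ‖Y t j‖)) ≤ ‖xi‖ * (2 * (‖E t‖ * ‖P t j‖ + ε / 2)) := by
          nlinarith
        have h7 := le_of_mul_le_mul_left h6 hn
        linarith
      have y0 := hYle 0
      have y1 := hYle 1
      simp only [Fin.sum_univ_two, norm_mul, norm_neg]
      calc _ ≤ ‖E t‖ * (C * (‖P t 0‖ + ‖P t 1‖) + C * (‖Y t 0‖ + ‖Y t 1‖)) := by
            gcongr
            exact (norm_add_le _ _).trans (add_le_add hmP hN)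
        _ = C * (‖E t‖ * ‖P t 0‖ + ‖E t‖ * ‖P t 1‖ + (‖E t‖ * ‖Y t 0‖ + ‖E t‖ * ‖Y t 1‖)) := by
            ring
        _ ≤ C * (2 * (‖E t‖ * ‖P t 0‖ + ‖E t‖ * ‖P t 1‖ + ε)) := by
            gcongr
            linarith
        _ = _ := by ring)
    0 (right_mem_Icc.2 (by linarith)) i
  have hE0 : E (-M.H) = 1 := by simp [hE]
  have e : 2 * C * (3 * ((Fintype.card (Fin 2) : ℕ) : ℝ) + 1) * (0 - -M.H) = 2 * C * 7 * M.H := by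
    rw [Fintype.card_fin]
    push_cast
    ring
  have hE1 : Real.exp (-(xi.re * M.H)) * ‖E 0‖ = 1 := by
    rw [hEn, ← Real.exp_add]
    simp
  rw [e, norm_mul] at key
  simp only [hE0, one_mul] at key
  calc ‖P 0 i‖ = Real.exp (-(xi.re * M.H)) * (‖E 0‖ * ‖P 0 i‖) := by rw [← mul_assoc, hE1, one_mul]
    _ ≤ Real.exp (-(xi.re * M.H)) * (Real.exp (2 * C * 7 * M.H) * (∑ j, ‖P (-M.H) j‖ + ε)) :=
        mul_le_mul_of_nonneg_left key (Real.exp_nonneg _)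
    _ = _ := by ring

/-- The boundary data of a state in terms of its amplitudes. The leading terms of `a` and `i b`
cancel in the sum, because `y' ≈ -ξ y` at the surface. -/
theorem exists_boundary_bound : ∃ X : ℝ, 0 ≤ X ∧ ∀ (xi : ℂ) (s : Fin 4 → ℂ) (A : ℝ), 1 ≤ ‖xi‖ →
    (∀ i, ‖M.ampP xi 0 s i‖ ≤ A) → (∀ i, ‖M.ampM xi 0 s i‖ ≤ ‖xi‖ * A) →
    ‖s 2‖ ≤ X * ‖xi‖ ^ 2 * A ∧ ‖s 2 + I * s 3‖ ≤ X * ‖xi‖ * A := by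
  obtain ⟨C, hC0, hC⟩ := M.exists_matrix_bound
  have hC := hC 0 (right_mem_Icc.2 M.neg_H_neg.le)
  have s0 := M.sig_ne_zero le_rfl
  set μ : ℂ := (M.mu 0 : ℂ) with hμ
  set μ₁ : ℂ := (M.mu1 0 : ℂ) with hμ₁
  set σ : ℂ := (M.sig 0 : ℂ) with hσ
  set W : ℝ := 1 + 2 * C with hW
  have hW1 : 1 ≤ W := by linarith
  set X : ℝ := ‖2 * μ‖ * W + ‖2 * μ / σ - 1‖ + W + ‖2 * μ₁‖ * (W + ‖1 / σ‖)
    + ‖(M.omega : ℂ) ^ 2‖ with hX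
  refine ⟨X, by positivity, fun xi s A hxi hp hm => ?_⟩
  have hn : 0 < ‖xi‖ := by linarith
  have hxi0 : xi ≠ 0 := norm_pos_iff.1 hn
  set n := ‖xi‖ with hn'
  have hA : 0 ≤ A := (norm_nonneg _).trans (hp 0)
  have hA' : A ≤ n * A := le_mul_of_one_le_left hA hxi
  set Y := M.y xi 0 s with hY
  set p := M.y' xi 0 s with hpdef
  have hYle : ∀ i, ‖Y i‖ ≤ A := by
    intro i
    have h1 : 2 * n * ‖Y i‖ ≤ ‖M.ampP xi 0 s i‖ + ‖M.ampM xi 0 s i‖ := norm_y_le xi 0 s i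
    have h2 : n * (2 * ‖Y i‖) ≤ n * (2 * A) := by nlinarith [hp i, hm i]
    linarith [le_of_mul_le_mul_left h2 hn]
  have hmY : ∀ i, ‖(M.m 0).mulVec Y i‖ ≤ 2 * C * A := by
    intro i
    calc _ ≤ C * (‖Y 0‖ + ‖Y 1‖) := norm_mulVec_le (fun i j => (hC i j).1) Y i
      _ ≤ C * (A + A) := by gcongr <;> exact hYle _
      _ = _ := by ring
  have hpY : ∀ i, ‖p i + xi * Y i‖ ≤ W * A := by
    intro i
    have : p i + xi * Y i = M.ampP xi 0 s i + (M.m 0).mulVec Y i := by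
      simp only [ampP, w, Pi.add_apply, Pi.sub_apply, Pi.smul_apply, smul_eq_mul]
      ring
    rw [this]
    refine (norm_add_le _ _).trans ?_
    linarith [hp i, hmY i]
  have hple : ∀ i, ‖p i‖ ≤ W * (n * A) := by
    intro i
    have : p i = (2 : ℂ)⁻¹ * (M.ampP xi 0 s i + M.ampM xi 0 s i) + (M.m 0).mulVec Y i := by
      simp only [ampP, ampM, w, Pi.add_apply, Pi.sub_apply, Pi.smul_apply, smul_eq_mul]
      ring
    rw [this]
    have h1 := norm_add_le (M.ampP xi 0 s i) (M.ampM xi 0 s i)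
    have h2 : ‖(2 : ℂ)⁻¹‖ = 2⁻¹ := by simp
    refine (norm_add_le _ _).trans ?_
    rw [norm_mul, h2]
    have h3 : 2 * C * A ≤ 2 * C * (n * A) := by gcongr
    have h4 := hp i
    have h5 := hm i
    have h6 := hmY i
    linarith
  have es0 : s 0 = I * (p 0 + Y 1 / σ) := by
    have : p 0 = -(I * s 0) - Y 1 / σ := rfl
    rw [this]
    ring_nf
    simp only [I_sq]
    ring
  have es1 : s 1 = -xi * Y 0 := by
    have : Y 0 = -s 1 / xi := rfl
    rw [this]
    field_simp
  have es2 : s 2 = xi * (2 * μ * p 0 + (2 * μ / σ - 1) * Y 1) := by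
    have h1 : Y 1 = -(2 * I * μ * s 0) - s 2 / xi := rfl
    have h2 : s 2 = -xi * (Y 1 + 2 * I * μ * s 0) := by
      rw [h1]
      field_simp
      ring
    rw [h2, es0]
    ring_nf
    simp only [I_sq]
    ring
  -- The top-order terms are 2μξ p₀ in a and 2μξ² Y₀ in ib, each O(|ξ|²A). Their sum is 2μξ(p₀ +
  -- ξY₀), and p + ξY = D₊ + mY is only O(A).
  have es3 : s 2 + I * s 3 = xi * (2 * μ * (p 0 + xi * Y 0) + (2 * μ / σ - 1) * Y 1)
      + (p 1 + 2 * μ₁ * (p 0 + 1 / σ * Y 1) - (M.omega : ℂ) ^ 2 * Y 0) := by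
    have h1 : p 1 = 2 * I * μ₁ * s 0 + I * s 3 + (2 * μ * xi - (M.omega : ℂ) ^ 2 / xi) * s 1 := rfl
    rw [h1, es2, es1, es0]
    field_simp
    ring_nf
    simp only [I_sq]
    ring
  have b1 : ‖xi * (2 * μ * p 0 + (2 * μ / σ - 1) * Y 1)‖ ≤
      n * (‖2 * μ‖ * (W * (n * A)) + ‖2 * μ / σ - 1‖ * A) := by
    rw [norm_mul]
    refine mul_le_mul_of_nonneg_left ((norm_add_le _ _).trans ?_) hn.le
    rw [norm_mul _ (p 0), norm_mul _ (Y 1)]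
    gcongr
    exacts [hple 0, hYle 1]
  have b2 : ‖xi * (2 * μ * (p 0 + xi * Y 0) + (2 * μ / σ - 1) * Y 1)‖ ≤
      n * (‖2 * μ‖ * (W * A) + ‖2 * μ / σ - 1‖ * A) := by
    rw [norm_mul]
    refine mul_le_mul_of_nonneg_left ((norm_add_le _ _).trans ?_) hn.le
    rw [norm_mul _ (p 0 + xi * Y 0), norm_mul _ (Y 1)]
    gcongr
    exacts [hpY 0, hYle 1]
  have b3 : ‖p 1 + 2 * μ₁ * (p 0 + 1 / σ * Y 1) - (M.omega : ℂ) ^ 2 * Y 0‖ ≤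
      W * (n * A) + ‖2 * μ₁‖ * (W * (n * A) + ‖1 / σ‖ * (n * A))
        + ‖(M.omega : ℂ) ^ 2‖ * (n * A) := by
    refine (norm_sub_le _ _).trans (add_le_add ((norm_add_le _ _).trans
      (add_le_add (hple 1) ?_)) ?_)
    · rw [norm_mul _ (p 0 + 1 / σ * Y 1)]
      refine mul_le_mul_of_nonneg_left ((norm_add_le _ _).trans (add_le_add (hple 0) ?_))
        (norm_nonneg _)
      rw [norm_mul _ (Y 1)]
      gcongr
      exact (hYle 1).trans hA'
    · rw [norm_mul]
      gcongr
      exact (hYle 0).trans hA'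
  have hAn : 0 ≤ n * A := by positivity
  constructor
  · rw [es2]
    refine b1.trans ?_
    have h1 : ‖2 * μ / σ - 1‖ * A ≤ ‖2 * μ / σ - 1‖ * (n * A) := by gcongr
    have h2 : ‖2 * μ‖ * W + ‖2 * μ / σ - 1‖ ≤ X := by
      have : 0 ≤ W + ‖2 * μ₁‖ * (W + ‖1 / σ‖) + ‖(M.omega : ℂ) ^ 2‖ := by positivity
      linarith
    calc _ ≤ n * ((‖2 * μ‖ * W + ‖2 * μ / σ - 1‖) * (n * A)) := by
          gcongr
          linarith
      _ ≤ n * (X * (n * A)) := by gcongr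
      _ = _ := by ring
  · rw [es3]
    refine (norm_add_le _ _).trans ((add_le_add b2 b3).trans (le_of_eq ?_))
    rw [hX]
    ring

/-! ### Waves at the depth `H` -/

/-- A polarization `v` for the quasi-momentum `q` whose field `y` is bounded in `ξ` and satisfies
`y' = i q y` at the depth `H`. -/
def IsWave (c : ℂ) (v : ℂ → ℂ → Fin 4 → ℂ) : Prop :=
  ∃ B : ℝ, 0 ≤ B ∧ ∀ xi q : ℂ, 1 ≤ ‖xi‖ → q ^ 2 = c - xi ^ 2 → ∀ i,
    ‖M.y xi (-M.H) (v xi q) i‖ ≤ B ∧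
      M.y' xi (-M.H) (v xi q) i = I * q * M.y xi (-M.H) (v xi q) i

/-- For the compressional wave y = (q/ξ, -iω²/ξ), bounded because |q| = O(|ξ|). The relation y' =
iqy reflects the dependence e^{-iZq} = e^{iqx}; in the first component it is the dispersion
relation. -/
theorem isWave_modeP : M.IsWave ((M.omega : ℂ) ^ 2 / (M.lamI + 2 * M.muI)) M.modeP := by
  set c : ℂ := (M.omega : ℂ) ^ 2 / (M.lamI + 2 * M.muI) with hc
  have hs := M.sigI_ne_zero
  refine ⟨(‖c‖ + 1) + ‖(M.omega : ℂ) ^ 2‖, by positivity, fun xi q hxi hq => ?_⟩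
  have hn : 0 < ‖xi‖ := by linarith
  have hxi0 : xi ≠ 0 := norm_pos_iff.1 hn
  have y0 : M.y xi (-M.H) (M.modeP xi q) 0 = q / xi := by simp [y, modeP]
  have y1 : M.y xi (-M.H) (M.modeP xi q) 1 = -(I * (M.omega : ℂ) ^ 2 / xi) := by
    simp only [y, modeP, show M.mu (-M.H) = M.muI from rfl]
    simp
    field_simp
    ring
  have d0 : M.y' xi (-M.H) (M.modeP xi q) 0 = I * q * (q / xi) := by
    have : M.y' xi (-M.H) (M.modeP xi q) 0 =
        -(I * xi) - M.y xi (-M.H) (M.modeP xi q) 1 / M.sig (-M.H) := rfl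
    rw [this, y1, M.sigI_eq]
    have e : I * q * (q / xi) = I * q ^ 2 / xi := by ring
    rw [e, hq, hc]
    field_simp
    ring
  have d1 : M.y' xi (-M.H) (M.modeP xi q) 1 = I * q * -(I * (M.omega : ℂ) ^ 2 / xi) := by
    simp only [y', modeP, M.mu1_neg_H, show M.mu (-M.H) = M.muI from rfl]
    simp
    field_simp
    ring_nf
    simp only [I_sq]
    ring
  have h1 : ‖q / xi‖ ≤ ‖c‖ + 1 := by
    rw [norm_div, div_le_iff₀ hn]
    exact norm_le_of_sq_eq hq hxi
  have h2 : ‖-(I * (M.omega : ℂ) ^ 2 / xi)‖ ≤ ‖(M.omega : ℂ) ^ 2‖ := by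
    rw [norm_neg, norm_div, norm_mul, norm_I, one_mul]
    exact div_le_self (norm_nonneg _) hxi
  intro i
  fin_cases i
  · exact ⟨by rw [Fin.zero_eta, y0]; linarith [norm_nonneg ((M.omega : ℂ) ^ 2)],
      by rw [Fin.zero_eta, y0, d0]⟩
  · exact ⟨by rw [Fin.mk_one, y1]; linarith [norm_nonneg c], by rw [Fin.mk_one, y1, d1]⟩

/-- For the shear wave the transform gives simply y = (1, 0). -/
theorem isWave_modeS : M.IsWave ((M.omega : ℂ) ^ 2 / M.muI) M.modeS := by
  have hm := M.muI_ne_zero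
  refine ⟨1, zero_le_one, fun xi q hxi hq => ?_⟩
  have hn : 0 < ‖xi‖ := by linarith
  have hxi0 : xi ≠ 0 := norm_pos_iff.1 hn
  have y0 : M.y xi (-M.H) (M.modeS xi q) 0 = 1 := by simp [y, modeS, hxi0]
  have y1 : M.y xi (-M.H) (M.modeS xi q) 1 = 0 := by
    simp only [y, modeS, show M.mu (-M.H) = M.muI from rfl]
    simp
    field_simp
    ring
  have d0 : M.y' xi (-M.H) (M.modeS xi q) 0 = I * q := by
    have : M.y' xi (-M.H) (M.modeS xi q) 0 =
        -(I * -q) - M.y xi (-M.H) (M.modeS xi q) 1 / M.sig (-M.H) := rfl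
    rw [this, y1]
    ring
  have d1 : M.y' xi (-M.H) (M.modeS xi q) 1 = 0 := by
    simp only [y', modeS, M.mu1_neg_H, show M.mu (-M.H) = M.muI from rfl]
    simp
    field_simp
    ring_nf
    simp only [I_sq]
    ring
  intro i
  fin_cases i
  · exact ⟨by rw [Fin.zero_eta, y0]; simp, by rw [Fin.zero_eta, y0, d0, mul_one]⟩
  · exact ⟨by rw [Fin.mk_one, y1]; simp, by rw [Fin.mk_one, y1, d1, mul_zero]⟩

end Medium

/-! ### Surface amplitudes on the sheets iq ≈ -ξ and iq ≈ ξ -/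

namespace Medium

variable {M : Medium}

theorem y_smul (xi : ℂ) (Z : ℝ) (e : ℂ) (s : Fin 4 → ℂ) : M.y xi Z (e • s) = e • M.y xi Z s := by
  ext i
  fin_cases i <;> simp [y] <;> ring

theorem y'_smul (xi : ℂ) (Z : ℝ) (e : ℂ) (s : Fin 4 → ℂ) :
    M.y' xi Z (e • s) = e • M.y' xi Z s := by
  ext i
  fin_cases i <;> simp [y', y_smul] <;> ring

theorem ampP_smul (xi : ℂ) (Z : ℝ) (e : ℂ) (s : Fin 4 → ℂ) :
    M.ampP xi Z (e • s) = e • M.ampP xi Z s := by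
  simp only [ampP, w, y_smul, y'_smul, Matrix.mulVec_smul]
  module

theorem ampM_smul (xi : ℂ) (Z : ℝ) (e : ℂ) (s : Fin 4 → ℂ) :
    M.ampM xi Z (e • s) = e • M.ampM xi Z s := by
  simp only [ampM, w, y_smul, y'_smul, Matrix.mulVec_smul]
  module

/-- The surface amplitudes of a wave are `O(1)` for `D₊` and `O(|ξ|)` for `D₋` on the sheet where
`i q ≈ -ξ`. On the sheet where `i q ≈ ξ` they are larger by the factor `e^{2 H Re ξ} / |ξ|`. -/
theorem IsWave.exists_amp_bound {c : ℂ} {v : ℂ → ℂ → Fin 4 → ℂ} (hv : M.IsWave c v) (K₀ : ℝ) :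
    ∃ X : ℝ, 0 ≤ X ∧ ∀ (xi q : ℂ) (Φ : ℝ → ℂ × ℂ), 1 ≤ ‖xi‖ → 0 ≤ xi.re → q ^ 2 = c - xi ^ 2 →
      IsRayleighSolution M xi Φ → M.state xi Φ (-M.H) = exp (I * M.H * q) • v xi q →
      (‖I * q + xi‖ ≤ ‖c‖ → ∀ i, ‖M.ampP xi 0 (M.state xi Φ 0) i‖ ≤ X ∧
        ‖M.ampM xi 0 (M.state xi Φ 0) i‖ ≤ ‖xi‖ * X) ∧
      (‖I * q - xi‖ ≤ ‖c‖ → ‖xi‖ ≤ K₀ * Real.exp (M.H * xi.re) → ∀ i,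
        ‖M.ampP xi 0 (M.state xi Φ 0) i‖ ≤ X * (Real.exp (2 * M.H * xi.re) / ‖xi‖) ∧
        ‖M.ampM xi 0 (M.state xi Φ 0) i‖ ≤
          ‖xi‖ * (X * (Real.exp (2 * M.H * xi.re) / ‖xi‖))) := by
  obtain ⟨B, hB0, hB⟩ := hv
  obtain ⟨C, hC0, hC⟩ := M.exists_matrix_bound
  obtain ⟨K, hK0, hK⟩ := M.exists_weighted_amp_bound
  obtain ⟨K', hK0', hK'⟩ := M.exists_ampP_bound
  have hH := M.H_pos
  have hC := hC (-M.H) (left_mem_Icc.2 M.neg_H_neg.le)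
  -- At depth H one has D_± = (iq ± ξ)y - my, up to the factor e^{iHq}. The amplitude with small iq
  -- ± ξ is at most `G`, the other at most `G` |ξ|. Below, `L` = e^{H‖c‖} is the cost of replacing
  -- |e^{iHq}| by e^{∓H Re ξ}.
  set G : ℝ := (‖c‖ + 2 + 2 * C) * B with hG
  have hG0 : 0 ≤ G := by positivity
  set L : ℝ := Real.exp (M.H * ‖c‖) with hL
  have hL0 : 0 < L := Real.exp_pos _
  -- The first summand serves the sheet iq ≈ -ξ and D₋ on the other sheet; the second serves D₊
  -- where iq ≈ ξ.
  refine ⟨4 * K * G * L + K' * L * G * (2 * K₀ ^ 2 + 4 * K), by positivity,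
    fun xi q Φ hxi hre hq hΦ hst => ?_⟩
  set n := ‖xi‖ with hn
  have hn0 : 0 < n := by linarith
  set e : ℂ := exp (I * M.H * q) with he
  have hmY : ∀ i, ‖(M.m (-M.H)).mulVec (M.y xi (-M.H) (v xi q)) i‖ ≤ 2 * C * B := by
    intro i
    calc _ ≤ C * (‖M.y xi (-M.H) (v xi q) 0‖ + ‖M.y xi (-M.H) (v xi q) 1‖) :=
          norm_mulVec_le (fun i j => (hC i j).1) _ i
      _ ≤ C * (B + B) := by gcongr <;> exact (hB xi q hxi hq _).1
      _ = _ := by ring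
  have hP : ∀ i, ‖M.ampP xi (-M.H) (M.state xi Φ (-M.H)) i‖ ≤
      ‖e‖ * ((‖I * q + xi‖ + 2 * C) * B) := by
    intro i
    obtain ⟨h1, h2⟩ := hB xi q hxi hq i
    have h3 : M.ampP xi (-M.H) (v xi q) i = (I * q + xi) * M.y xi (-M.H) (v xi q) i
        - (M.m (-M.H)).mulVec (M.y xi (-M.H) (v xi q)) i := by
      simp only [ampP, w, Pi.add_apply, Pi.sub_apply, Pi.smul_apply, smul_eq_mul, h2]
      ring
    rw [hst, ampP_smul, Pi.smul_apply, smul_eq_mul, norm_mul, h3, add_mul ‖I * q + xi‖]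
    gcongr
    refine (norm_sub_le _ _).trans (add_le_add ?_ (hmY i))
    rw [norm_mul]
    gcongr
  have hQ : ∀ i, ‖M.ampM xi (-M.H) (M.state xi Φ (-M.H)) i‖ ≤
      ‖e‖ * ((‖I * q - xi‖ + 2 * C) * B) := by
    intro i
    obtain ⟨h1, h2⟩ := hB xi q hxi hq i
    have h3 : M.ampM xi (-M.H) (v xi q) i = (I * q - xi) * M.y xi (-M.H) (v xi q) i
        - (M.m (-M.H)).mulVec (M.y xi (-M.H) (v xi q)) i := by
      simp only [ampM, w, Pi.sub_apply, Pi.smul_apply, smul_eq_mul, h2]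
      ring
    rw [hst, ampM_smul, Pi.smul_apply, smul_eq_mul, norm_mul, h3, add_mul ‖I * q - xi‖]
    gcongr
    refine (norm_sub_le _ _).trans (add_le_add ?_ (hmY i))
    rw [norm_mul]
    gcongr
  have hsmall : ∀ x : ℝ, x ≤ ‖c‖ → (x + 2 * C) * B ≤ G := fun x hx => by
    rw [hG]
    gcongr
    linarith
  have hlarge : ∀ x : ℝ, x ≤ ‖c‖ + 2 * n → (x + 2 * C) * B ≤ G * n := fun x hx => by
    have h1 : x + 2 * C ≤ (‖c‖ + 2 + 2 * C) * n := by
      nlinarith [norm_nonneg c]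
    calc (x + 2 * C) * B ≤ (‖c‖ + 2 + 2 * C) * n * B := by gcongr
      _ = _ := by rw [hG]; ring
  have hexp0 : Real.exp (xi.re * M.H) * Real.exp (-(xi.re * M.H)) = 1 := by
    rw [← Real.exp_add]
    simp
  constructor
  · intro h i
    have hel : ‖e‖ ≤ L * Real.exp (-(xi.re * M.H)) := by
      rw [he, norm_exp, hL, ← Real.exp_add]
      refine Real.exp_le_exp.2 ?_
      have h1 : (I * M.H * q).re = M.H * (I * q + xi).re - xi.re * M.H := by
        simp
        ring
      rw [h1]
      have := (re_le_norm (I * q + xi)).trans h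
      nlinarith
    have hm : ‖I * q - xi‖ ≤ ‖c‖ + 2 * n := by
      have h1 : I * q - xi = (I * q + xi) - 2 * xi := by ring
      rw [h1]
      refine (norm_sub_le _ _).trans ?_
      rw [norm_mul]
      simp only [Complex.norm_ofNat]
      linarith
    have hS : n * ∑ j, ‖M.ampP xi (-M.H) (M.state xi Φ (-M.H)) j‖
        + ∑ j, ‖M.ampM xi (-M.H) (M.state xi Φ (-M.H)) j‖ ≤
        L * Real.exp (-(xi.re * M.H)) * (4 * G * n) := by
      rw [Fin.sum_univ_two, Fin.sum_univ_two]
      have p : ∀ i, ‖M.ampP xi (-M.H) (M.state xi Φ (-M.H)) i‖ ≤ ‖e‖ * G := fun i =>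
        (hP i).trans (mul_le_mul_of_nonneg_left (hsmall _ h) (norm_nonneg _))
      have m : ∀ i, ‖M.ampM xi (-M.H) (M.state xi Φ (-M.H)) i‖ ≤ ‖e‖ * (G * n) := fun i =>
        (hQ i).trans (mul_le_mul_of_nonneg_left (hlarge _ hm) (norm_nonneg _))
      calc _ ≤ n * (‖e‖ * G + ‖e‖ * G) + (‖e‖ * (G * n) + ‖e‖ * (G * n)) := by
            gcongr
            exacts [p 0, p 1, m 0, m 1]
        _ = ‖e‖ * (4 * G * n) := by ring
        _ ≤ _ := by gcongr
    -- At depth H, D₊ is smaller than D₋ by |ξ|; the weight θ = |ξ| equalizes them. The growth e^{H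
    -- Re ξ} then cancels |e^{iHq}|.
    have key := hK xi Φ n hxi hre (by nlinarith) le_rfl hΦ 0 (right_mem_Icc.2 M.neg_H_neg.le) i
    rw [zero_add] at key
    have hfin : K * Real.exp (xi.re * M.H) *
        (n * ∑ j, ‖M.ampP xi (-M.H) (M.state xi Φ (-M.H)) j‖
        + ∑ j, ‖M.ampM xi (-M.H) (M.state xi Φ (-M.H)) j‖) ≤
        n * (4 * K * G * L + K' * L * G * (2 * K₀ ^ 2 + 4 * K)) := by
      calc _ ≤ K * Real.exp (xi.re * M.H) * (L * Real.exp (-(xi.re * M.H)) * (4 * G * n)) := by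
            gcongr
        _ = (Real.exp (xi.re * M.H) * Real.exp (-(xi.re * M.H))) * (n * (4 * K * G * L)) := by ring
        _ = n * (4 * K * G * L) := by rw [hexp0, one_mul]
        _ ≤ _ := by
            have : 0 ≤ K' * L * G * (2 * K₀ ^ 2 + 4 * K) := by positivity
            gcongr
            linarith
    exact ⟨le_of_mul_le_mul_left (key.1.trans hfin) hn0, key.2.trans hfin⟩
  · intro h hreg i
    have hel : ‖e‖ ≤ L * Real.exp (xi.re * M.H) := by
      rw [he, norm_exp, hL, ← Real.exp_add]
      refine Real.exp_le_exp.2 ?_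
      have h1 : (I * M.H * q).re = M.H * (I * q - xi).re + xi.re * M.H := by
        simp
        ring
      rw [h1]
      have := (re_le_norm (I * q - xi)).trans h
      nlinarith
    have hm : ‖I * q + xi‖ ≤ ‖c‖ + 2 * n := by
      have h1 : I * q + xi = (I * q - xi) + 2 * xi := by ring
      rw [h1]
      refine (norm_add_le _ _).trans ?_
      rw [norm_mul]
      simp only [Complex.norm_ofNat]
      linarith
    have p : ∀ i, ‖M.ampP xi (-M.H) (M.state xi Φ (-M.H)) i‖ ≤ ‖e‖ * (G * n) := fun i =>
      (hP i).trans (mul_le_mul_of_nonneg_left (hlarge _ hm) (norm_nonneg _))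
    have m : ∀ i, ‖M.ampM xi (-M.H) (M.state xi Φ (-M.H)) i‖ ≤ ‖e‖ * G := fun i =>
      (hQ i).trans (mul_le_mul_of_nonneg_left (hsmall _ h) (norm_nonneg _))
    have hS : n⁻¹ * ∑ j, ‖M.ampP xi (-M.H) (M.state xi Φ (-M.H)) j‖
        + ∑ j, ‖M.ampM xi (-M.H) (M.state xi Φ (-M.H)) j‖ ≤
        L * Real.exp (xi.re * M.H) * (4 * G) := by
      rw [Fin.sum_univ_two, Fin.sum_univ_two]
      calc _ ≤ n⁻¹ * (‖e‖ * (G * n) + ‖e‖ * (G * n)) + (‖e‖ * G + ‖e‖ * G) := by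
            gcongr
            exacts [p 0, p 1, m 0, m 1]
        _ = ‖e‖ * (4 * G) := by field_simp; ring
        _ ≤ _ := by gcongr
    set X₁ := K * (L * Real.exp (xi.re * M.H) * (4 * G)) with hX₁
    have hinv : n⁻¹ ≤ n := (inv_le_one_of_one_le₀ hxi).trans hxi
    have hQX : ∀ Z ∈ Icc (-M.H) 0, ∀ i, ‖M.ampM xi Z (M.state xi Φ Z) i‖ ≤
        X₁ * Real.exp (xi.re * (Z + M.H)) := by
      intro Z hZ i
      -- Now D₊ is the larger amplitude at depth H, so the weight is 1/|ξ|. This is sharp for D₋ but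
      -- loses a factor |ξ|² for D₊, which is estimated separately from the bound on D₋.
      refine (hK xi Φ n⁻¹ hxi hre (by rw [← hn, inv_mul_cancel₀ hn0.ne']) hinv hΦ Z hZ i).2.trans ?_
      calc _ ≤ K * Real.exp (xi.re * (Z + M.H)) * (L * Real.exp (xi.re * M.H) * (4 * G)) := by
            gcongr
        _ = _ := by rw [hX₁]; ring
    have hX0 : 0 ≤ X₁ := by positivity
    have h2 : Real.exp (2 * M.H * xi.re) = Real.exp (xi.re * M.H) * Real.exp (xi.re * M.H) := by
      rw [← Real.exp_add]
      ring_nf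
    have h2' : Real.exp (2 * xi.re * M.H) = Real.exp (2 * M.H * xi.re) := by ring_nf
    have hK1 : 0 ≤ K' * L * G * (2 * K₀ ^ 2 + 4 * K) := by positivity
    have hK2 : 0 ≤ 4 * K * G * L := by positivity
    constructor
    · refine (hK' xi Φ X₁ hxi hre hX0 hΦ hQX i).trans ?_
      have hsum : ∑ j, ‖M.ampP xi (-M.H) (M.state xi Φ (-M.H)) j‖ ≤
          L * Real.exp (xi.re * M.H) * (2 * G * n) := by
        rw [Fin.sum_univ_two]
        calc _ ≤ ‖e‖ * (G * n) + ‖e‖ * (G * n) := add_le_add (p 0) (p 1)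
          _ = ‖e‖ * (2 * G * n) := by ring
          _ ≤ _ := by gcongr
      -- The only use of the region |ξ| ≤ K₀ e^{H Re ξ}: the initial value of D₊ reaches the surface
      -- with size |ξ|, and |ξ|² ≤ K₀² e^{2H Re ξ} puts it below the forced part.
      have hnn : n ≤ K₀ ^ 2 * (Real.exp (2 * M.H * xi.re) / n) := by
        rw [← mul_div_assoc, le_div_iff₀ hn0]
        calc n * n ≤ (K₀ * Real.exp (M.H * xi.re)) * (K₀ * Real.exp (M.H * xi.re)) := by
              gcongr
              exact hn0.le.trans hreg
          _ = _ := by rw [h2]; ring_nf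
      rw [h2', ← hn]
      calc _ ≤ K' * Real.exp (-(xi.re * M.H)) *
            (L * Real.exp (xi.re * M.H) * (2 * G * n) + X₁ * Real.exp (2 * M.H * xi.re) / n) := by
            gcongr
        _ = (Real.exp (xi.re * M.H) * Real.exp (-(xi.re * M.H))) *
            (K' * L * G * (2 * n + 4 * K * (Real.exp (2 * M.H * xi.re) / n))) := by
            rw [hX₁]
            ring
        _ ≤ K' * L * G * (2 * (K₀ ^ 2 * (Real.exp (2 * M.H * xi.re) / n))
              + 4 * K * (Real.exp (2 * M.H * xi.re) / n)) := by
            rw [hexp0, one_mul]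
            gcongr
        _ = K' * L * G * (2 * K₀ ^ 2 + 4 * K) * (Real.exp (2 * M.H * xi.re) / n) := by ring
        _ ≤ _ := by
            gcongr
            linarith
    · have h3 := hQX 0 (right_mem_Icc.2 M.neg_H_neg.le) i
      rw [zero_add] at h3
      refine h3.trans ?_
      calc X₁ * Real.exp (xi.re * M.H) = 4 * K * G * L * Real.exp (2 * M.H * xi.re) := by
            rw [hX₁, h2]
            ring
        _ ≤ (4 * K * G * L + K' * L * G * (2 * K₀ ^ 2 + 4 * K)) * Real.exp (2 * M.H * xi.re) := by
            gcongr
            linarith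
        _ = _ := by field_simp

/-! ### The Rayleigh determinant at the four points above ξ -/

variable (M)

/-- On the part of the half-plane `Re ξ ≥ 0` where `|ξ| ≤ K₀ e^{H Re ξ}`, the Rayleigh determinant
is bounded by `|ξ|³`, times a factor `e^{2 H Re ξ} / |ξ|` for each quasi-momentum with
`i q ≈ ξ`. -/
theorem exists_rayleighDet_bound_of_sheet (K₀ : ℝ) : ∃ X : ℝ, 0 ≤ X ∧ ∀ (p : Surface M),
    1 ≤ ‖p.xi‖ → 0 ≤ p.xi.re → ‖p.xi‖ ≤ K₀ * Real.exp (M.H * p.xi.re) → ∀ AP AS : ℝ,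
    (‖I * p.qP + p.xi‖ ≤ ‖(M.omega : ℂ) ^ 2 / (M.lamI + 2 * M.muI)‖ ∧ AP = 1 ∨
      ‖I * p.qP - p.xi‖ ≤ ‖(M.omega : ℂ) ^ 2 / (M.lamI + 2 * M.muI)‖ ∧
        AP = Real.exp (2 * M.H * p.xi.re) / ‖p.xi‖) →
    (‖I * p.qS + p.xi‖ ≤ ‖(M.omega : ℂ) ^ 2 / M.muI‖ ∧ AS = 1 ∨
      ‖I * p.qS - p.xi‖ ≤ ‖(M.omega : ℂ) ^ 2 / M.muI‖ ∧
        AS = Real.exp (2 * M.H * p.xi.re) / ‖p.xi‖) →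
    ‖rayleighDet p‖ ≤ X * ‖p.xi‖ ^ 3 * (AP * AS) := by
  obtain ⟨XP, hXP, hP⟩ := M.isWave_modeP.exists_amp_bound K₀
  obtain ⟨XS, hXS, hS⟩ := M.isWave_modeS.exists_amp_bound K₀
  obtain ⟨Y, hY, hb⟩ := M.exists_boundary_bound
  refine ⟨2 * (Y * XP) * (Y * XS), by positivity, fun p hxi hre hreg AP AS hAP hAS => ?_⟩
  obtain ⟨jP, jP'⟩ := jostP_spec p
  obtain ⟨jS, jS'⟩ := jostS_spec p
  have aP : ∀ i, ‖M.ampP p.xi 0 (M.state p.xi (jostP p) 0) i‖ ≤ XP * AP ∧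
      ‖M.ampM p.xi 0 (M.state p.xi (jostP p) 0) i‖ ≤ ‖p.xi‖ * (XP * AP) := by
    obtain ⟨h1, h2⟩ := hP p.xi p.qP _ hxi hre p.qP_sq jP jP'
    rcases hAP with ⟨h, rfl⟩ | ⟨h, rfl⟩
    · simpa using h1 h
    · exact h2 h hreg
  have aS : ∀ i, ‖M.ampP p.xi 0 (M.state p.xi (jostS p) 0) i‖ ≤ XS * AS ∧
      ‖M.ampM p.xi 0 (M.state p.xi (jostS p) 0) i‖ ≤ ‖p.xi‖ * (XS * AS) := by
    obtain ⟨h1, h2⟩ := hS p.xi p.qS _ hxi hre p.qS_sq jS jS'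
    rcases hAS with ⟨h, rfl⟩ | ⟨h, rfl⟩
    · simpa using h1 h
    · exact h2 h hreg
  obtain ⟨bP, bP'⟩ := hb p.xi _ _ hxi (fun i => (aP i).1) (fun i => (aP i).2)
  obtain ⟨bS, bS'⟩ := hb p.xi _ _ hxi (fun i => (aS i).1) (fun i => (aS i).2)
  set sP := M.state p.xi (jostP p) 0
  set sS := M.state p.xi (jostS p) 0
  -- A row operation replaces b by a + ib, so each product in the determinant contains one factor
  -- that has gained a power of |ξ|.
  have hdet : rayleighDet p = -I * (sP 2 * (sS 2 + I * sS 3) - sS 2 * (sP 2 + I * sP 3)) := by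
    rw [rayleighDet_eq]
    ring_nf
    simp only [I_sq]
    ring
  rw [hdet, norm_mul, norm_neg, norm_I, one_mul]
  refine (norm_sub_le _ _).trans ?_
  rw [norm_mul, norm_mul]
  have t1 := mul_le_mul bP bS' (norm_nonneg _) ((norm_nonneg _).trans bP)
  have t2 := mul_le_mul bS bP' (norm_nonneg _) ((norm_nonneg _).trans bS)
  refine (add_le_add t1 t2).trans (le_of_eq ?_)
  ring

/-- The factors iq - ξ and iq + ξ have product -c, and their difference 2ξ has modulus at least 2.
So one of them has modulus at least 1, and the other at most |c|. -/
theorem exists_sheet {c q xi : ℂ} (hq : q ^ 2 = c - xi ^ 2) (hxi : 1 ≤ ‖xi‖) :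
    ‖I * q + xi‖ ≤ ‖c‖ ∨ ‖I * q - xi‖ ≤ ‖c‖ := by
  have h1 : ‖I * q - xi‖ * ‖I * q + xi‖ = ‖c‖ := by
    rw [← norm_mul, show (I * q - xi) * (I * q + xi) = -c by
      ring_nf
      rw [I_sq, hq]
      ring, norm_neg]
  have h2 : 2 * ‖xi‖ ≤ ‖I * q + xi‖ + ‖I * q - xi‖ := by
    have := norm_sub_le (I * q + xi) (I * q - xi)
    rw [show I * q + xi - (I * q - xi) = 2 * xi by ring, norm_mul] at this
    simpa using this
  by_cases h : 1 ≤ ‖I * q - xi‖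
  · left
    rw [← h1]
    exact le_mul_of_one_le_left (norm_nonneg _) h
  · right
    rw [← h1]
    exact le_mul_of_one_le_right (norm_nonneg _) (by linarith)

/-- Above every `ξ` with `|ξ| ≥ 1` there is a point of the surface where `i q_P ≈ -ξ` and
`i q_S ≈ -ξ`. -/
theorem exists_surface_point {xi : ℂ} (hxi : 1 ≤ ‖xi‖) : ∃ p : Surface M, p.xi = xi ∧
    ‖I * p.qP + xi‖ ≤ ‖(M.omega : ℂ) ^ 2 / (M.lamI + 2 * M.muI)‖ ∧
    ‖I * p.qS + xi‖ ≤ ‖(M.omega : ℂ) ^ 2 / M.muI‖ := by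
  set r := Surface.physical M xi with hr
  have hflip : ∀ q : ℂ, ‖I * -q + xi‖ = ‖I * q - xi‖ := fun q => by
    rw [← norm_neg]
    ring_nf
  rcases exists_sheet r.qP_sq hxi with hP | hP <;> rcases exists_sheet r.qS_sq hxi with hS | hS
  · exact ⟨r, rfl, hP, hS⟩
  · exact ⟨r.wS, rfl, hP, (hflip _).trans_le hS⟩
  · exact ⟨r.wP, rfl, (hflip _).trans_le hP, hS⟩
  · exact ⟨r.wPS, rfl, (hflip _).trans_le hP, (hflip _).trans_le hS⟩

/-- The four determinants are O(|ξ|³), twice O(|ξ|² e^{2H Re ξ}), and O(|ξ| e^{4H Re ξ}). The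
exponents add up to 8 in both places. -/
theorem exists_F_bound (K : ℝ) : ∃ C : ℝ, 0 < C ∧ ∃ R : ℝ, 0 < R ∧ ∀ ξ : ℂ, R ≤ ξ.re →
    ‖ξ‖ ≤ K * Real.exp (M.H * ξ.re) →
    ‖F M ξ‖ ≤ C * ‖ξ‖ ^ 8 * Real.exp (8 * M.H * |ξ.re|) := by
  obtain ⟨X, hX, hdet⟩ := M.exists_rayleighDet_bound_of_sheet K
  -- `R` = 1 ensures |ξ| ≥ 1 and Re ξ ≥ 0; the summand 1 makes the constant strictly positive.
  refine ⟨X ^ 4 + 1, by positivity, 1, one_pos, fun ξ hξ hreg => ?_⟩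
  have hxi : 1 ≤ ‖ξ‖ := hξ.trans (re_le_norm ξ)
  have hre : 0 ≤ ξ.re := by linarith
  obtain ⟨p, rfl, hP, hS⟩ := M.exists_surface_point hxi
  have hflip : ∀ q : ℂ, ‖I * -q - p.xi‖ = ‖I * q + p.xi‖ := fun q => by
    rw [← norm_neg]
    ring_nf
  set n := ‖p.xi‖ with hn
  set A := Real.exp (2 * M.H * p.xi.re) / n with hA
  have hn0 : 0 < n := by linarith
  have b1 : ‖rayleighDet p‖ ≤ X * n ^ 3 * (1 * 1) :=
    hdet p hxi hre hreg 1 1 (Or.inl ⟨hP, rfl⟩) (Or.inl ⟨hS, rfl⟩)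
  have b2 : ‖rayleighDet p.wP‖ ≤ X * n ^ 3 * (A * 1) :=
    hdet p.wP hxi hre hreg A 1 (Or.inr ⟨(hflip _).trans_le hP, rfl⟩) (Or.inl ⟨hS, rfl⟩)
  have b3 : ‖rayleighDet p.wS‖ ≤ X * n ^ 3 * (1 * A) :=
    hdet p.wS hxi hre hreg 1 A (Or.inl ⟨hP, rfl⟩) (Or.inr ⟨(hflip _).trans_le hS, rfl⟩)
  have b4 : ‖rayleighDet p.wPS‖ ≤ X * n ^ 3 * (A * A) :=
    hdet p.wPS hxi hre hreg A A (Or.inr ⟨(hflip _).trans_le hP, rfl⟩)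
      (Or.inr ⟨(hflip _).trans_le hS, rfl⟩)
  have hA0 : 0 ≤ A := by positivity
  have hA4 : (A * n) ^ 4 = Real.exp (8 * M.H * |p.xi.re|) := by
    rw [hA, div_mul_cancel₀ _ hn0.ne', ← Real.exp_nat_mul, abs_of_nonneg hre]
    congr 1
    push_cast
    ring
  rw [F_eq p, norm_mul, norm_mul, norm_mul]
  calc _ ≤ (X * n ^ 3 * (1 * 1)) * (X * n ^ 3 * (A * 1)) * (X * n ^ 3 * (1 * A))
        * (X * n ^ 3 * (A * A)) := by gcongr
    _ = X ^ 4 * n ^ 8 * (A * n) ^ 4 := by ring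
    _ ≤ _ := by
        rw [hA4]
        gcongr
        linarith

end Medium

end Rayleigh

end

theorem mainTheorem4 (M : Rayleigh.Medium) (hV : Rayleigh.PotentialClass M.H M.V) :
    Rayleigh.IsExponentialType (Rayleigh.F M) ∧
    ∀ K : ℝ, ∃ C : ℝ, 0 < C ∧ ∃ R : ℝ, 0 < R ∧ ∀ ξ : ℂ, R ≤ ξ.re →
      ‖ξ‖ ≤ K * Real.exp (M.H * ξ.re) →
      ‖Rayleigh.F M ξ‖ ≤ C * ‖ξ‖ ^ 8 * Real.exp (8 * M.H * |ξ.re|) :=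
  ⟨M.isExponentialType_F, M.exists_F_bound⟩
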